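/- **Setting.** Let $\mathcal S\subset\mathbb R^3$ be a nonempty connected compact set such that $\Omega=\mathbb R^3\setminus\mathcal S$ is connected with $C^\infty$ boundary; let $\nu$ be the unit normal to $\partial\Omega$ pointing out of $\Omega$. Let $\rho\ge 0$ be an integrable density on $\mathcal S$ with $\int_{\mathcal S}\rho=|\mathcal S|$ and $\int_{\mathcal S}\rho(y)\,y\,dy=0$, and put $m_0=\int_{\mathcal S}\rho$, $J_0=\int_{\mathcal S}\rho(y)(|y|^2\mathrm{Id}-yy^*)\,dy$. Let $m\ge1$ and $\chi_1,\dots,\chi_m\in C^\infty(\partial\Omega)$ with $\int_{\partial\Omega}\chi_j\,d\sigma=0$. Let $\phi_i,\varphi_i$ ($i=1,2,3$) and $\psi_j$ ($1\le j\le m$) be the functions, smooth on $\overline\Omega$, harmonic in $\Omega$, with gradient tending to $0$ at infinity, and with $\partial_\nu\phi_i=\nu_i$, $\partial_\nu\varphi_i=(y\times\nu)_i$, $\partial_\nu\psi_j=\chi_j$ on $\partial\Omega$ (unique up to additive constants). Set $$M_{ij}=\int_\Omega\nabla\phi_i\cdot\nabla\phi_j,\quad J_{ij}=\int_\Omega\nabla\varphi_i\cdot\nabla\varphi_j,\quad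 N_{ij}=\int_\Omega\nabla\phi_i\cdot\nabla\varphi_j,\quad C^M_{ij}=\int_\Omega\nabla\phi_i\cdot\nabla\psi_j,\quad C^J_{ij}=\int_\Omega\nabla\varphi_i\cdot\nabla\psi_j,$$ and for $1\le p\le m$ $$(L^M_p)_{ij}=\int_{\partial\Omega}(\nabla\phi_j)_i\chi_p,\quad (R^M_p)_{ij}=\int_{\partial\Omega}(\nabla\varphi_j)_i\chi_p,\quad (W^M_p)_{ij}=\int_{\partial\Omega}(\nabla\psi_j)_i\chi_p,$$ and let $L^J_p,R^J_p,W^J_p$ be defined by the same formulas with $y\times\nabla$ in place of $\nabla$. Let $$\mathcal J=\begin{pmatrix}m_0\mathrm{Id}+M&N\\N^*&J_0+J\end{pmatrix},\qquad C=-\begin{pmatrix}C^M\\C^J\end{pmatrix},$$ let $S(a)$ denote the matrix of $b\mapsto a\times b$, and for $l,r\in\mathbb R^3$, $w\in\mathbb R^m$ let $$F(l,r,w)=-\begin{pmatrix}S(r)&0\\S(l)&S(r)\end{pmatrix}\Big(\mathcal J\binom lr-Cw\Big)-\sum_{p=1}^m w_p\begin{pmatrix}L^M_pl+R^M_pr+W^M_pw\\L^J_pl+R^J_pr+W^J_pw\end{pmatrix}.$$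 The reduced control system, with state $(h,\vec q,l,r)\in\mathbb R^{12}$, $\|\vec q\|<1$, and control $w\in\mathbb R^m$, is $$h'=(1-\|\vec q\|^2)\,l+2\sqrt{1-\|\vec q\|^2}\;\vec q\times l+(l\cdot\vec q)\,\vec q-(\vec q\times l)\times\vec q,\qquad \vec q\,'=\tfrac12\big(\sqrt{1-\|\vec q\|^2}\,r+\vec q\times r\big),\qquad \binom lr'=\mathcal J^{-1}\big(Cw'+F(l,r,w)\big).\tag{S}$$ **Assumptions.** $\Omega$ and $\chi_1$ are invariant under the reflections $S_p(y)=y-2y_pe_p$ for $p=2,3$, and $\alpha\neq0$, where $$\alpha=\frac{-C^M_{11}}{m_0+M_{11}},\qquad\beta=\frac{-(L^M_1)_{11}}{m_0+M_{11}},\qquad\gamma=\frac{-(W^M_1)_{11}}{m_0+M_{11}}.$$ **Reference trajectory.** Let $T>0$, let $\xi\in C^\infty(\mathbb R;[0,1])$ with $\xi=0$ on $(-\infty,T/3)$ and $\xi=1$ on $(2T/3,\infty)$, let $\lambda\ne0$, and put $\bar h_1(t)=\lambda\xi(t)(t-T)^2$, $\bar l_1=\bar h_1'$. Assume that the solution $\bar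 w_1$ of $$\bar w_1'=\alpha^{-1}(\bar l_1'-\beta\bar l_1\bar w_1-\gamma\bar w_1^2),\qquad\bar w_1(0)=0,$$ exists on all of $[0,T]$ (this is the case when $|\lambda|$ is small enough). Let $\bar l=(\bar l_1,0,0)$, $\bar r=0$, $\bar w=(\bar w_1,0,\dots,0)$, let $A(t)=\big(\tfrac{\partial F}{\partial l}\,\big|\,\tfrac{\partial F}{\partial r}\big)$ and $B(t)=\tfrac{\partial F}{\partial w}$ be taken at $(\bar l(t),\bar r(t),\bar w(t))$, let $D(t)=\begin{pmatrix}0&-S(\bar l(t))\\0&0\end{pmatrix}\in\mathbb R^{6\times6}$, and $$\mathcal A=\begin{pmatrix}D&\mathrm{Id}\\0&\mathcal J^{-1}A\end{pmatrix},\quad\mathcal B=\begin{pmatrix}0\\\mathcal J^{-1}B\end{pmatrix},\quad\mathcal C=\begin{pmatrix}0\\\mathcal J^{-1}C\end{pmatrix},\qquad\mathcal M_0=\mathcal B+\mathcal A\mathcal C,\quad\mathcal M_i=\mathcal M_{i-1}'-\mathcal A\mathcal M_{i-1}\ (i\ge1)\quad\text{on }[0,T].$$ **Theorem.** If $$\mathrm{rank}\big(\mathcal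 C,\mathcal M_0(T),\mathcal M_1(T),\mathcal M_2(T),\dots\big)=12,$$ then (S) is locally controllable around the origin in time $T$, with controls $w\in H^2(0,T;\mathbb R^m)$ satisfying $w(0)=0$: all initial and final states close enough to $0$ can be joined in time $T$ by a trajectory of (S) for such a control. Moreover, for some $\eta>0$ there is a $C^1$ map from $B_{\mathbb R^{24}}(0,\eta)$ to $H^2(0,T;\mathbb R^m)$ which associates with $(h_0,\vec q_0,l_0,r_0,h_T,\vec q_T,l_T,r_T)$ a control $w$ with $w(0)=0$ steering the state of (S) from $(h_0,\vec q_0,l_0,r_0)$ at $t=0$ to $(h_T,\vec q_T,l_T,r_T)$ at $t=T$. -/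

import Mathlib

open MeasureTheory Set Filter Topology Matrix
open scoped ContDiff

noncomputable section

/-- Euclidean three-space. -/
abbrev E3 : Type := EuclideanSpace ℝ (Fin 3)

/-! ### Smooth domains, exterior Neumann problem -/

/-- `g` is a smooth function describing the open set `Ω` near the boundary point `x`:
`Ω` is locally `{g < 0}`, with `g x = 0` and `∇ g x ≠ 0`. -/
def IsLocalDefiningFunction (Ω : Set E3) (x : E3) (g : E3 → ℝ) : Prop :=
  ContDiff ℝ ∞ g ∧ g x = 0 ∧ gradient g x ≠ 0 ∧ ∀ᶠ y in 𝓝 x, (y ∈ Ω ↔ g y < 0)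

/-- The boundary of `Ω` is a `C^∞` hypersurface, with `Ω` locally on one side of it. -/
def HasSmoothBoundary (Ω : Set E3) : Prop :=
  ∀ x ∈ frontier Ω, ∃ g : E3 → ℝ, IsLocalDefiningFunction Ω x g

open Classical in
/-- The outward unit normal vector to `∂Ω` at `x`, i.e. `∇ g x / ‖∇ g x‖` for a local defining
function `g` (the value does not depend on the choice of `g`). -/
def outwardNormal (Ω : Set E3) (x : E3) : Fin 3 → ℝ :=
  if h : ∃ g : E3 → ℝ, IsLocalDefiningFunction Ω x g then
    (‖gradient h.choose x‖⁻¹ • gradient h.choose x).ofLp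
  else 0

/-- The gradient of a function on `closure Ω` (one-sided at boundary points), in coordinates. -/
def gradOn (Ω : Set E3) (f : E3 → ℝ) (y : E3) : Fin 3 → ℝ :=
  (gradientWithin f (closure Ω) y).ofLp

/-- `f ∈ C^∞(closure Ω)` solves the exterior Neumann problem: `Δ f = 0` in `Ω`, `∂f/∂ν = g` on `∂Ω`
and `∇ f(y) → 0` as `|y| → ∞`. -/
structure IsNeumannSolution (Ω : Set E3) (g : E3 → ℝ) (f : E3 → ℝ) : Prop where
  smooth : ContDiffOn ℝ ∞ f (closure Ω)
  harmonic : InnerProductSpace.HarmonicOnNhd f Ω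
  boundary : ∀ y ∈ frontier Ω, gradOn Ω f y ⬝ᵥ outwardNormal Ω y = g y
  decay : Tendsto (gradOn Ω f) (Bornology.cobounded E3 ⊓ 𝓟 Ω) (𝓝 0)

open Classical in
/-- The solution of the exterior Neumann problem with datum `g` (unique up to an additive
constant when `Ω` is a connected smooth exterior domain; only its gradient is used below). -/
def neumannPotential (Ω : Set E3) (g : E3 → ℝ) : E3 → ℝ :=
  if h : ∃ f : E3 → ℝ, IsNeumannSolution Ω g f then h.choose else 0

/-- The reflection `S_p(y) = y - 2 y_p e_p` with respect to the plane `{y_p = 0}`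
(coordinates are numbered `0, 1, 2`). -/
def planeReflection (p : Fin 3) (y : E3) : E3 :=
  y - (2 * y p) • EuclideanSpace.single p (1 : ℝ)

/-- Surface integral over `∂Ω`: integration with respect to the two-dimensional Hausdorff measure,
normalized so as to be the usual surface area. -/
def boundaryIntegral (Ω : Set E3) (f : E3 → ℝ) : ℝ :=
  ∫ y in frontier Ω, f y ∂(Measure.euclideanHausdorffMeasure 2)

/-! ### The vehicle -/

/-- A neutrally buoyant underwater vehicle with `m` controls: the rigid body at the initial time,
its density, and the flow profiles `χ_j` on its boundary.  The center of mass is at the origin. -/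
structure Vehicle (m : ℕ) where
  /-- the set occupied by the rigid body -/
  body : Set E3
  /-- the density of the rigid body -/
  density : E3 → ℝ
  /-- the profiles `χ_j` of the flow through the boundary -/
  flow : Fin m → E3 → ℝ
  isCompact_body : IsCompact body
  isConnected_body : IsConnected body
  isConnected_exterior : IsConnected bodyᶜ
  smooth_exterior : HasSmoothBoundary bodyᶜ
  density_nonneg : ∀ y ∈ body, 0 ≤ density y
  integrable_density : IntegrableOn density body
  neutral_buoyancy : ∫ y in body, density y = ∫ _y in body, (1 : ℝ)
  center_of_mass : ∀ i : Fin 3, ∫ y in body, density y * y i = 0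
  smooth_flow : ∀ j, ∃ f : E3 → ℝ, ContDiff ℝ ∞ f ∧ EqOn (flow j) f (frontier bodyᶜ)
  flux_zero : ∀ j, boundaryIntegral bodyᶜ (flow j) = 0

namespace Vehicle

/-- The domain `Ω` of the fluid in the frame linked to the body. -/
def exterior {m : ℕ} (V : Vehicle m) : Set E3 := V.bodyᶜ

/-- The outward unit normal `ν` to `∂Ω`. -/
def normal {m : ℕ} (V : Vehicle m) (y : E3) : Fin 3 → ℝ := outwardNormal V.exterior y

/-- `∇ φ_i`, where `∂φ_i/∂ν = ν_i`. -/
def gradPhi {m : ℕ} (V : Vehicle m) (i : Fin 3) : E3 → Fin 3 → ℝ :=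
  gradOn V.exterior (neumannPotential V.exterior fun y => V.normal y i)

/-- `∇ ϕ_i`, where `∂ϕ_i/∂ν = (y × ν)_i`. -/
def gradVarphi {m : ℕ} (V : Vehicle m) (i : Fin 3) : E3 → Fin 3 → ℝ :=
  gradOn V.exterior (neumannPotential V.exterior fun y => crossProduct y.ofLp (V.normal y) i)

/-- `∇ ψ_j`, where `∂ψ_j/∂ν = χ_j`. -/
def gradPsi {m : ℕ} (V : Vehicle m) (j : Fin m) : E3 → Fin 3 → ℝ :=
  gradOn V.exterior (neumannPotential V.exterior (V.flow j))

/-- The mass. -/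
def mass {m : ℕ} (V : Vehicle m) : ℝ := ∫ y in V.body, V.density y

/-- The inertia matrix `J_0 = ∫ ρ(x) (|x|² Id - x xᵀ) dx`. -/
def J0 {m : ℕ} (V : Vehicle m) : Matrix (Fin 3) (Fin 3) ℝ :=
  Matrix.of fun i j =>
    ∫ y in V.body, V.density y * (‖y‖ ^ 2 * (1 : Matrix (Fin 3) (Fin 3) ℝ) i j - y i * y j)

def matM {m : ℕ} (V : Vehicle m) : Matrix (Fin 3) (Fin 3) ℝ :=
  Matrix.of fun i j => ∫ y in V.exterior, V.gradPhi i y ⬝ᵥ V.gradPhi j y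

def matJ {m : ℕ} (V : Vehicle m) : Matrix (Fin 3) (Fin 3) ℝ :=
  Matrix.of fun i j => ∫ y in V.exterior, V.gradVarphi i y ⬝ᵥ V.gradVarphi j y

def matN {m : ℕ} (V : Vehicle m) : Matrix (Fin 3) (Fin 3) ℝ :=
  Matrix.of fun i j => ∫ y in V.exterior, V.gradPhi i y ⬝ᵥ V.gradVarphi j y

def matCM {m : ℕ} (V : Vehicle m) : Matrix (Fin 3) (Fin m) ℝ :=
  Matrix.of fun i j => ∫ y in V.exterior, V.gradPhi i y ⬝ᵥ V.gradPsi j y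

def matCJ {m : ℕ} (V : Vehicle m) : Matrix (Fin 3) (Fin m) ℝ :=
  Matrix.of fun i j => ∫ y in V.exterior, V.gradVarphi i y ⬝ᵥ V.gradPsi j y

def matLM {m : ℕ} (V : Vehicle m) (p : Fin m) : Matrix (Fin 3) (Fin 3) ℝ :=
  Matrix.of fun i j => boundaryIntegral V.exterior fun y => V.gradPhi j y i * V.flow p y

def matLJ {m : ℕ} (V : Vehicle m) (p : Fin m) : Matrix (Fin 3) (Fin 3) ℝ :=
  Matrix.of fun i j =>
    boundaryIntegral V.exterior fun y => crossProduct y.ofLp (V.gradPhi j y) i * V.flow p y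

def matRM {m : ℕ} (V : Vehicle m) (p : Fin m) : Matrix (Fin 3) (Fin 3) ℝ :=
  Matrix.of fun i j => boundaryIntegral V.exterior fun y => V.gradVarphi j y i * V.flow p y

def matRJ {m : ℕ} (V : Vehicle m) (p : Fin m) : Matrix (Fin 3) (Fin 3) ℝ :=
  Matrix.of fun i j =>
    boundaryIntegral V.exterior fun y => crossProduct y.ofLp (V.gradVarphi j y) i * V.flow p y

def matWM {m : ℕ} (V : Vehicle m) (p : Fin m) : Matrix (Fin 3) (Fin m) ℝ :=
  Matrix.of fun i j => boundaryIntegral V.exterior fun y => V.gradPsi j y i * V.flow p y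

def matWJ {m : ℕ} (V : Vehicle m) (p : Fin m) : Matrix (Fin 3) (Fin m) ℝ :=
  Matrix.of fun i j =>
    boundaryIntegral V.exterior fun y => crossProduct y.ofLp (V.gradPsi j y) i * V.flow p y

/-- The total inertia matrix `𝒥` (body plus added inertia of the fluid). -/
def inertia {m : ℕ} (V : Vehicle m) : Matrix (Fin 3 ⊕ Fin 3) (Fin 3 ⊕ Fin 3) ℝ :=
  Matrix.fromBlocks (V.mass • 1) 0 0 V.J0 + Matrix.fromBlocks V.matM V.matN V.matNᵀ V.matJ

/-- The matrix `C = -(C^M ; C^J)`. -/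
def matC {m : ℕ} (V : Vehicle m) : Matrix (Fin 3 ⊕ Fin 3) (Fin m) ℝ :=
  -Matrix.fromRows V.matCM V.matCJ

end Vehicle

/-- The matrix `S(y)` of the map `x ↦ y × x`. -/
def skew (y : Fin 3 → ℝ) : Matrix (Fin 3) (Fin 3) ℝ :=
  !![0, -y 2, y 1; y 2, 0, -y 0; -y 1, y 0, 0]

/-! ### The control system -/

/-- The state `(h, q⃗, l, r) ∈ ℝ^12`. -/
abbrev State : Type := (Fin 3 → ℝ) × (Fin 3 → ℝ) × (Fin 3 → ℝ) × (Fin 3 → ℝ)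

namespace Vehicle

/-- The nonlinear term `F(l, r, w)`, with `k = (l, r)`. -/
def F {m : ℕ} (V : Vehicle m) (k : Fin 3 ⊕ Fin 3 → ℝ) (w : Fin m → ℝ) : Fin 3 ⊕ Fin 3 → ℝ :=
  let l : Fin 3 → ℝ := k ∘ Sum.inl
  let r : Fin 3 → ℝ := k ∘ Sum.inr
  let Z : Matrix (Fin 3 ⊕ Fin 3) (Fin 3 ⊕ Fin 3) ℝ :=
    Matrix.fromBlocks (skew r) 0 (skew l) (skew r)
  (-Z) *ᵥ (V.inertia *ᵥ k - V.matC *ᵥ w)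
    - ∑ p, w p • Sum.elim (V.matLM p *ᵥ l + V.matRM p *ᵥ r + V.matWM p *ᵥ w)
        (V.matLJ p *ᵥ l + V.matRJ p *ᵥ r + V.matWJ p *ᵥ w)

/-- The right-hand side of `(l, r)' = 𝒥⁻¹ (C w' + F(l, r, w))`, where `w'` is written `dw`. -/
def accel {m : ℕ} (V : Vehicle m) (l r : Fin 3 → ℝ) (w dw : Fin m → ℝ) : Fin 3 ⊕ Fin 3 → ℝ :=
  V.inertia⁻¹ *ᵥ (V.matC *ᵥ dw + V.F (Sum.elim l r) w)

/-- The right-hand side of the reduced system in the state `(h, q⃗, l, r)`. -/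
def rhs {m : ℕ} (V : Vehicle m) (x : State) (w dw : Fin m → ℝ) : State :=
  let q := x.2.1
  let l := x.2.2.1
  let r := x.2.2.2
  ((1 - q ⬝ᵥ q) • l + (2 * Real.sqrt (1 - q ⬝ᵥ q)) • crossProduct q l + (l ⬝ᵥ q) • q
      - crossProduct (crossProduct q l) q,
    (1 / 2 : ℝ) • (Real.sqrt (1 - q ⬝ᵥ q) • r + crossProduct q r),
    V.accel l r w dw ∘ Sum.inl,
    V.accel l r w dw ∘ Sum.inr)

/-- `X` is a trajectory on `[0, T]` of the reduced system for the `C^1` control `w`, with attitude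
in the open half-sphere parameterized by `‖q⃗‖ < 1`. -/
def IsTrajectory {m : ℕ} (V : Vehicle m) (T : ℝ) (w : ℝ → EuclideanSpace ℝ (Fin m))
    (X : ℝ → State) : Prop :=
  ∀ t ∈ Icc 0 T, (X t).2.1 ⬝ᵥ (X t).2.1 < 1 ∧
    HasDerivWithinAt X (V.rhs (X t) (w t).ofLp (derivWithin w (Icc 0 T) t).ofLp) (Icc 0 T) t

/-- The `C^1` control `w` steers the reduced system from `x₀` at time `0` to `x₁` at time `T`. -/
def Steers {m : ℕ} (V : Vehicle m) (T : ℝ) (w : ℝ → EuclideanSpace ℝ (Fin m))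
    (x₀ x₁ : State) : Prop :=
  ∃ X : ℝ → State, V.IsTrajectory T w X ∧ X 0 = x₀ ∧ X T = x₁

end Vehicle

/-! ### The Sobolev space `H²(0, T; ℝ^m)` -/

/-- Lebesgue measure on `(0, T)`. -/
abbrev timeMeasure (T : ℝ) : Measure ℝ := volume.restrict (Ioo 0 T)

/-- `v` is the weak derivative of `u` on `(0, T)`. -/
def IsWeakDeriv {m : ℕ} (T : ℝ) (u v : ℝ → EuclideanSpace ℝ (Fin m)) : Prop :=
  ∀ f : ℝ → ℝ, ContDiff ℝ ∞ f → HasCompactSupport f → tsupport f ⊆ Ioo 0 T →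
    ∫ t, deriv f t • u t ∂(timeMeasure T) = -∫ t, f t • v t ∂(timeMeasure T)

theorem integrable_smul_Lp {m : ℕ} {T : ℝ} {f : ℝ → ℝ} (hf : Continuous f)
    (hc : HasCompactSupport f) (u : Lp (EuclideanSpace ℝ (Fin m)) 2 (timeMeasure T)) :
    Integrable (fun t => f t • u t) (timeMeasure T) := by
  obtain ⟨c, hc'⟩ := hf.bounded_above_of_compact_support hc
  have hu : Integrable (fun t => u t) (timeMeasure T) := (Lp.memLp u).integrable one_le_two
  exact hu.bdd_smul c hf.aestronglyMeasurable (Eventually.of_forall hc')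

theorem IsWeakDeriv.add {m : ℕ} {T : ℝ}
    {u v u' v' : Lp (EuclideanSpace ℝ (Fin m)) 2 (timeMeasure T)}
    (h : IsWeakDeriv T u v) (h' : IsWeakDeriv T u' v') :
    IsWeakDeriv T (u + u' : Lp _ 2 (timeMeasure T)) (v + v' : Lp _ 2 (timeMeasure T)) := by
  intro f hf hc hs
  have hd : Continuous (deriv f) := hf.continuous_deriv (by simp)
  have e1 : ∫ t, deriv f t • (u + u') t ∂(timeMeasure T)
      = ∫ t, (deriv f t • u t + deriv f t • u' t) ∂(timeMeasure T) := by
    refine integral_congr_ae ?_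
    filter_upwards [Lp.coeFn_add u u'] with t ht
    rw [ht, Pi.add_apply, smul_add]
  have e2 : ∫ t, f t • (v + v') t ∂(timeMeasure T)
      = ∫ t, (f t • v t + f t • v' t) ∂(timeMeasure T) := by
    refine integral_congr_ae ?_
    filter_upwards [Lp.coeFn_add v v'] with t ht
    rw [ht, Pi.add_apply, smul_add]
  rw [e1, e2, integral_add (integrable_smul_Lp hd hc.deriv u) (integrable_smul_Lp hd hc.deriv u'),
    integral_add (integrable_smul_Lp hf.continuous hc v) (integrable_smul_Lp hf.continuous hc v'),
    h f hf hc hs, h' f hf hc hs, neg_add]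

theorem IsWeakDeriv.smul {m : ℕ} {T : ℝ} (a : ℝ)
    {u v : Lp (EuclideanSpace ℝ (Fin m)) 2 (timeMeasure T)} (h : IsWeakDeriv T u v) :
    IsWeakDeriv T (a • u : Lp _ 2 (timeMeasure T)) (a • v : Lp _ 2 (timeMeasure T)) := by
  intro f hf hc hs
  have e1 : ∫ t, deriv f t • (a • u) t ∂(timeMeasure T)
      = ∫ t, a • (deriv f t • u t) ∂(timeMeasure T) := by
    refine integral_congr_ae ?_
    filter_upwards [Lp.coeFn_smul a u] with t ht
    rw [ht, Pi.smul_apply, smul_comm]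
  have e2 : ∫ t, f t • (a • v) t ∂(timeMeasure T)
      = ∫ t, a • (f t • v t) ∂(timeMeasure T) := by
    refine integral_congr_ae ?_
    filter_upwards [Lp.coeFn_smul a v] with t ht
    rw [ht, Pi.smul_apply, smul_comm]
  rw [e1, e2, integral_smul, integral_smul, h f hf hc hs, smul_neg]

theorem IsWeakDeriv.zero {m : ℕ} {T : ℝ} :
    IsWeakDeriv T (0 : Lp (EuclideanSpace ℝ (Fin m)) 2 (timeMeasure T))
      (0 : Lp (EuclideanSpace ℝ (Fin m)) 2 (timeMeasure T)) := by
  intro f hf hc hs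
  have e : ∀ g : ℝ → ℝ, ∫ t, g t • (0 : Lp (EuclideanSpace ℝ (Fin m)) 2 (timeMeasure T)) t
      ∂(timeMeasure T) = 0 := by
    intro g
    rw [integral_eq_zero_of_ae]
    filter_upwards [Lp.coeFn_zero (EuclideanSpace ℝ (Fin m)) 2 (timeMeasure T)] with t ht
    rw [ht]
    simp
  rw [e, e, neg_zero]

/-- The space `H²(0, T; ℝ^m)`: an element is recorded as the triple `(w, w', w'')` of square
integrable functions, the derivatives being weak ones, so that its norm is
`(‖w‖² + ‖w'‖² + ‖w''‖²)^(1/2)` with `L²` norms. -/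
def H2 (T : ℝ) (m : ℕ) :
    Submodule ℝ (PiLp 2 fun _ : Fin 3 => Lp (EuclideanSpace ℝ (Fin m)) 2 (timeMeasure T)) where
  carrier := {u | IsWeakDeriv T (u 0) (u 1) ∧ IsWeakDeriv T (u 1) (u 2)}
  add_mem' := fun hu hv => ⟨hu.1.add hv.1, hu.2.add hv.2⟩
  zero_mem' := ⟨IsWeakDeriv.zero, IsWeakDeriv.zero⟩
  smul_mem' := fun a _ hu => ⟨hu.1.smul a, hu.2.smul a⟩

/-- `w` is the representative in `C^1([0, T]; ℝ^m)` of the element `u` of `H²(0, T; ℝ^m)`. -/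
def IsC1Representative {T : ℝ} {m : ℕ} (u : H2 T m) (w : ℝ → EuclideanSpace ℝ (Fin m)) : Prop :=
  ContDiffOn ℝ 1 w (Icc 0 T) ∧ w =ᵐ[timeMeasure T] (u.1 0)

/-- Local controllability around the origin in time `T`, with controls in `H²(0, T; ℝ^m)`
such that `w(0) = 0`. -/
def Vehicle.LocallyControllable {m : ℕ} (V : Vehicle m) (T : ℝ) : Prop :=
  ∃ η > 0, ∀ x₀ ∈ Metric.ball (0 : State) η, ∀ x₁ ∈ Metric.ball (0 : State) η,
    ∃ (u : H2 T m) (w : ℝ → EuclideanSpace ℝ (Fin m)),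
      IsC1Representative u w ∧ w 0 = 0 ∧ V.Steers T w x₀ x₁

/-! ### The loop-shaped reference trajectory and the linearized system -/

/-- `h̄_1(t) = λ ξ(t) (t - T)²`. -/
def loopPosition (T lam : ℝ) (ξ : ℝ → ℝ) (t : ℝ) : ℝ := lam * ξ t * (t - T) ^ 2

/-- `l̄_1 = h̄_1'`. -/
def loopVelocity (T lam : ℝ) (ξ : ℝ → ℝ) (t : ℝ) : ℝ := deriv (loopPosition T lam ξ) t

/-- Linear systems `x' = 𝒜(t) x + ℬ(t) u + 𝒞 u'` on `[0, T]`: the matrices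
`ℳ_0 = ℬ + 𝒜 𝒞`, `ℳ_i = ℳ_{i-1}' - 𝒜 ℳ_{i-1}`. -/
def controlMatrix {n k : Type*} [Fintype n] (T : ℝ) (A : ℝ → Matrix n n ℝ)
    (B : ℝ → Matrix n k ℝ) (C : Matrix n k ℝ) : ℕ → ℝ → Matrix n k ℝ
  | 0 => fun t => B t + A t * C
  | i + 1 => fun t =>
      (Matrix.of fun a b => derivWithin (fun s => controlMatrix T A B C i s a b) (Icc 0 T) t)
        - A t * controlMatrix T A B C i t

namespace Vehicle

def alpha {m : ℕ} [NeZero m] (V : Vehicle m) : ℝ := -V.matCM 0 0 / (V.mass + V.matM 0 0)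

def beta {m : ℕ} [NeZero m] (V : Vehicle m) : ℝ := -V.matLM 0 0 0 / (V.mass + V.matM 0 0)

def gamma {m : ℕ} [NeZero m] (V : Vehicle m) : ℝ := -V.matWM 0 0 0 / (V.mass + V.matM 0 0)

/-- `w̄_1` solves on `[0, T]` the Cauchy problem
`w̄_1' = α⁻¹ (l̄_1' - β l̄_1 w̄_1 - γ w̄_1²)`, `w̄_1(0) = 0`. -/
def IsLoopControl {m : ℕ} [NeZero m] (V : Vehicle m) (T lam : ℝ) (ξ w₁ : ℝ → ℝ) : Prop :=
  w₁ 0 = 0 ∧ ∀ t ∈ Icc 0 T,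
    HasDerivWithinAt w₁
      (V.alpha⁻¹ * (deriv (loopVelocity T lam ξ) t - V.beta * loopVelocity T lam ξ t * w₁ t
        - V.gamma * w₁ t ^ 2)) (Icc 0 T) t

/-- `l̄ = (l̄_1, 0, 0)`. -/
def loopL (T lam : ℝ) (ξ : ℝ → ℝ) (t : ℝ) : Fin 3 → ℝ := Pi.single 0 (loopVelocity T lam ξ t)

/-- `(l̄, r̄) = (l̄, 0)`. -/
def loopK (T lam : ℝ) (ξ : ℝ → ℝ) (t : ℝ) : Fin 3 ⊕ Fin 3 → ℝ := Sum.elim (loopL T lam ξ t) 0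

/-- `w̄ = (w̄_1, 0, …, 0)`. -/
def loopW {m : ℕ} [NeZero m] (w₁ : ℝ → ℝ) (t : ℝ) : Fin m → ℝ := Pi.single 0 (w₁ t)

/-- `A(t) = (∂F/∂l | ∂F/∂r)` along the reference trajectory. -/
def linA {m : ℕ} [NeZero m] (V : Vehicle m) (T lam : ℝ) (ξ w₁ : ℝ → ℝ) (t : ℝ) :
    Matrix (Fin 3 ⊕ Fin 3) (Fin 3 ⊕ Fin 3) ℝ :=
  LinearMap.toMatrix'
    (fderiv ℝ (fun k => V.F k (loopW w₁ t)) (loopK T lam ξ t)).toLinearMap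

/-- `B(t) = ∂F/∂w` along the reference trajectory. -/
def linB {m : ℕ} [NeZero m] (V : Vehicle m) (T lam : ℝ) (ξ w₁ : ℝ → ℝ) (t : ℝ) :
    Matrix (Fin 3 ⊕ Fin 3) (Fin m) ℝ :=
  LinearMap.toMatrix'
    (fderiv ℝ (fun w => V.F (loopK T lam ξ t) w) (loopW w₁ t)).toLinearMap

/-- `𝒜(t)`: the linearization along the reference trajectory in the variables
`((ĥ, 2 q̂), (l̂, r̂))`. -/
def calA {m : ℕ} [NeZero m] (V : Vehicle m) (T lam : ℝ) (ξ w₁ : ℝ → ℝ) (t : ℝ) :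
    Matrix ((Fin 3 ⊕ Fin 3) ⊕ (Fin 3 ⊕ Fin 3)) ((Fin 3 ⊕ Fin 3) ⊕ (Fin 3 ⊕ Fin 3)) ℝ :=
  Matrix.fromBlocks (Matrix.fromBlocks 0 (-skew (loopL T lam ξ t)) 0 0) 1
    0 (V.inertia⁻¹ * V.linA T lam ξ w₁ t)

/-- `ℬ(t)`. -/
def calB {m : ℕ} [NeZero m] (V : Vehicle m) (T lam : ℝ) (ξ w₁ : ℝ → ℝ) (t : ℝ) :
    Matrix ((Fin 3 ⊕ Fin 3) ⊕ (Fin 3 ⊕ Fin 3)) (Fin m) ℝ :=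
  Matrix.fromRows 0 (V.inertia⁻¹ * V.linB T lam ξ w₁ t)

/-- `𝒞`. -/
def calC {m : ℕ} (V : Vehicle m) :
    Matrix ((Fin 3 ⊕ Fin 3) ⊕ (Fin 3 ⊕ Fin 3)) (Fin m) ℝ :=
  Matrix.fromRows 0 (V.inertia⁻¹ * V.matC)

/-- The rank of the matrix `(𝒞, ℳ_0(T), ℳ_1(T), ℳ_2(T), …)` with infinitely many columns, i.e. the
dimension of the span of its columns. -/
def loopRank {m : ℕ} [NeZero m] (V : Vehicle m) (T lam : ℝ) (ξ w₁ : ℝ → ℝ) : ℕ :=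
  Module.finrank ℝ (Submodule.span ℝ
    (range V.calC.col ∪ ⋃ i : ℕ, range
      (controlMatrix T (V.calA T lam ξ w₁) (V.calB T lam ξ w₁) V.calC i T).col))

end Vehicle

end

section ExteriorNeumann

open scoped Laplacian RealInnerProductSpace

section Laplacian

variable {E : Type*} [NormedAddCommGroup E] [InnerProductSpace ℝ E]

theorem iteratedFDeriv_two_eq_deriv_deriv {f : E → ℝ} {x : E} (hf : ContDiffAt ℝ 2 f x) (v : E) :
    iteratedFDeriv ℝ 2 f x ![v, v] = deriv (deriv fun s : ℝ => f (x + s • v)) 0 := by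
  have hline : ∀ s : ℝ, HasDerivAt (fun s : ℝ => x + s • v) v s := fun s => by
    simpa using ((hasDerivAt_id s).smul_const v).const_add x
  have hd : ∀ᶠ y in 𝓝 x, DifferentiableAt ℝ f y :=
    (hf.eventually (by simp)).mono fun y hy => hy.differentiableAt (by simp)
  have ht : Tendsto (fun s : ℝ => x + s • v) (𝓝 0) (𝓝 x) := by
    have := (hline 0).continuousAt.tendsto
    simpa using this
  have h1 : (deriv fun s : ℝ => f (x + s • v)) =ᶠ[𝓝 0] fun s => fderiv ℝ f (x + s • v) v := by
    filter_upwards [ht.eventually hd] with s hs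
    exact (hs.hasFDerivAt.comp_hasDerivAt s (hline s)).deriv
  rw [h1.deriv_eq, iteratedFDeriv_two_apply]
  have h2 : DifferentiableAt ℝ (fderiv ℝ f) x :=
    (hf.fderiv_right (m := 1) (by norm_num)).differentiableAt (by simp)
  have h3 : HasDerivAt (fun s : ℝ => fderiv ℝ f (x + s • v)) (fderiv ℝ (fderiv ℝ f) x v) 0 := by
    have h4 : HasFDerivAt (fderiv ℝ f) (fderiv ℝ (fderiv ℝ f) x) (x + (0 : ℝ) • v) := by
      simpa using h2.hasFDerivAt
    exact h4.comp_hasDerivAt 0 (hline 0)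
  simpa using ((h3.clm_apply (hasDerivAt_const 0 v)).deriv).symm

variable [FiniteDimensional ℝ E]

theorem laplacian_eq_sum_deriv_deriv {ι : Type*} [Fintype ι] (b : OrthonormalBasis ι ℝ E)
    {f : E → ℝ} {x : E} (hf : ContDiffAt ℝ 2 f x) :
    (Δ f) x = ∑ i, deriv (deriv fun s : ℝ => f (x + s • b i)) 0 := by
  rw [InnerProductSpace.laplacian_eq_iteratedFDeriv_orthonormalBasis f b]
  exact Finset.sum_congr rfl fun i _ => iteratedFDeriv_two_eq_deriv_deriv hf _

theorem laplacian_comp_linearIsometryEquiv (S : E ≃ₗᵢ[ℝ] E) {f : E → ℝ} {x : E}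
    (hf : ContDiffAt ℝ 2 f (S x)) : (Δ (f ∘ S)) x = (Δ f) (S x) := by
  have hS : ContDiffAt ℝ 2 (f ∘ S) x := hf.comp x S.contDiff.contDiffAt
  rw [laplacian_eq_sum_deriv_deriv (stdOrthonormalBasis ℝ E) hS,
    laplacian_eq_sum_deriv_deriv ((stdOrthonormalBasis ℝ E).map S) hf]
  simp

theorem harmonicAt_comp_linearIsometryEquiv (S : E ≃ₗᵢ[ℝ] E) {f : E → ℝ} {x : E}
    (hf : InnerProductSpace.HarmonicAt f (S x)) : InnerProductSpace.HarmonicAt (f ∘ S) x := by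
  refine ⟨hf.1.comp x S.contDiff.contDiffAt, ?_⟩
  have := (S.continuous.tendsto x).eventually hf.eventually
  filter_upwards [this] with y hy
  rw [laplacian_comp_linearIsometryEquiv S hy.1]
  exact hy.2.eq_of_nhds

theorem deriv_deriv_nonpos_of_isLocalMax {φ : ℝ → ℝ} {x : ℝ} (h : IsLocalMax φ x)
    (hc : ContinuousAt φ x) : deriv (deriv φ) x ≤ 0 := by
  by_contra! hpos
  have hmin := isLocalMin_of_deriv_deriv_pos hpos h.deriv_eq_zero hc
  have heq : φ =ᶠ[𝓝 x] fun _ => φ x := by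
    filter_upwards [h, hmin] with y h1 h2 using le_antisymm h1 h2
  have := heq.deriv.deriv_eq
  simp at this
  linarith

theorem laplacian_nonpos_of_isLocalMax {f : E → ℝ} {x : E} (hf : ContDiffAt ℝ 2 f x)
    (h : IsLocalMax f x) : (Δ f) x ≤ 0 := by
  rw [laplacian_eq_sum_deriv_deriv (stdOrthonormalBasis ℝ E) hf]
  refine Finset.sum_nonpos fun i _ => ?_
  have hc : ContinuousAt (fun s : ℝ => x + s • stdOrthonormalBasis ℝ E i) 0 := by fun_prop
  refine deriv_deriv_nonpos_of_isLocalMax ?_ ?_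
  · have : Tendsto (fun s : ℝ => x + s • stdOrthonormalBasis ℝ E i) (𝓝 0) (𝓝 x) := by
      simpa using hc.tendsto
    have h2 := this.eventually h
    simpa [IsLocalMax, IsMaxFilter] using h2
  · refine ContinuousAt.comp (g := f) ?_ hc
    simpa using hf.continuousAt

theorem laplacian_norm_sq (x : E) :
    (Δ (fun y : E => ‖y‖ ^ 2)) x = (2 : ℝ) * Module.finrank ℝ E := by
  rw [laplacian_eq_sum_deriv_deriv (stdOrthonormalBasis ℝ E) (contDiff_norm_sq ℝ).contDiffAt]
  have : ∀ i, deriv (deriv fun s : ℝ => ‖x + s • stdOrthonormalBasis ℝ E i‖ ^ 2) 0 = 2 := by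
    intro i
    have h0 : (fun s : ℝ => ‖x + s • stdOrthonormalBasis ℝ E i‖ ^ 2)
        = fun s => ‖x‖ ^ 2 + (2 * ⟪x, stdOrthonormalBasis ℝ E i⟫) * s + s ^ 2 := by
      ext s
      rw [norm_add_sq_real, real_inner_smul_right, norm_smul]
      simp
      ring
    have h1 : deriv (fun s : ℝ => ‖x‖ ^ 2 + (2 * ⟪x, stdOrthonormalBasis ℝ E i⟫) * s + s ^ 2)
        = fun s => 2 * ⟪x, stdOrthonormalBasis ℝ E i⟫ + 2 * s := by
      ext s
      refine HasDerivAt.deriv ?_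
      have := (((hasDerivAt_id s).const_mul (2 * ⟪x, stdOrthonormalBasis ℝ E i⟫)).const_add
        (‖x‖ ^ 2)).add (hasDerivAt_pow 2 s)
      simp only [mul_one, Nat.cast_ofNat, Nat.add_one_sub_one, pow_one] at this
      exact this
    rw [h0, h1]
    refine HasDerivAt.deriv ?_
    simpa using ((hasDerivAt_id (0 : ℝ)).const_mul 2).const_add
      (2 * ⟪x, stdOrthonormalBasis ℝ E i⟫)
  rw [Finset.sum_congr rfl fun i _ => this i]
  simp [mul_comm]

/-- Weak maximum principle for subharmonic functions on a compact set. -/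
theorem le_of_subharmonic_of_isCompact [Nontrivial E] {K : Set E} (hK : IsCompact K) {u : E → ℝ}
    {A : ℝ} (hu : ContinuousOn u K)
    (h : ∀ x ∈ K, u x ≤ A ∨ (K ∈ 𝓝 x ∧ ContDiffAt ℝ 2 u x ∧ 0 ≤ (Δ u) x)) :
    ∀ x ∈ K, u x ≤ A := by
  intro x hx
  obtain ⟨R, hR⟩ := hK.isBounded.exists_norm_le
  have key : ∀ ε > 0, u x ≤ A + ε * R ^ 2 := by
    intro ε hε
    have hcont : ContinuousOn (fun y => u y + ε * ‖y‖ ^ 2) K := by fun_prop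
    obtain ⟨z, hz, hmax⟩ := hK.exists_isMaxOn ⟨x, hx⟩ hcont
    have hxz : u x + ε * ‖x‖ ^ 2 ≤ u z + ε * ‖z‖ ^ 2 := hmax hx
    have hzR : ‖z‖ ^ 2 ≤ R ^ 2 := by
      have := hR z hz
      gcongr
    have hx0 : 0 ≤ ε * ‖x‖ ^ 2 := by positivity
    rcases h z hz with h1 | ⟨hKz, hC, hΔ⟩
    · nlinarith
    · exfalso
      have hC2 : ContDiffAt ℝ 2 (ε • fun y : E => ‖y‖ ^ 2) z :=
        contDiffAt_const.smul (contDiff_norm_sq ℝ).contDiffAt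
      have hloc : IsLocalMax (u + ε • fun y : E => ‖y‖ ^ 2) z := by
        filter_upwards [hKz] with y hy using hmax hy
      have h1 := laplacian_nonpos_of_isLocalMax (hC.add hC2) hloc
      change (Δ (u + ε • fun y : E => ‖y‖ ^ 2)) z ≤ 0 at h1
      rw [hC.laplacian_add hC2,
        InnerProductSpace.laplacian_smul ε (contDiff_norm_sq ℝ).contDiffAt,
        laplacian_norm_sq] at h1
      have : (0 : ℝ) < Module.finrank ℝ E := by exact_mod_cast Module.finrank_pos
      have : 0 < ε • (2 * (Module.finrank ℝ E : ℝ)) := by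
        rw [smul_eq_mul]; positivity
      linarith
  by_contra! hlt
  rcases eq_or_ne R 0 with rfl | hR0
  · have := key 1 one_pos
    norm_num at this
    linarith
  · have hR2 : 0 < R ^ 2 := by positivity
    have := key ((u x - A) / 2 / R ^ 2) (by apply div_pos _ hR2; linarith)
    rw [div_mul_cancel₀ _ hR2.ne'] at this
    linarith

end Laplacian

section Newtonian

/-- The fundamental solution `1 / |x - c|` in dimension three. -/
noncomputable def newtonian (c x : E3) : ℝ := ‖x - c‖⁻¹

theorem contDiffAt_newtonian {c x : E3} (h : x ≠ c) : ContDiffAt ℝ 2 (newtonian c) x := by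
  have h1 : ContDiffAt ℝ 2 (fun y : E3 => ‖y - c‖) x :=
    (contDiffAt_id.sub contDiffAt_const).norm ℝ (by simpa [sub_eq_zero] using h)
  exact h1.inv (by simpa [sub_eq_zero] using h)

theorem laplacian_newtonian {c x : E3} (h : x ≠ c) : (Δ (newtonian c)) x = 0 := by
  rw [laplacian_eq_sum_deriv_deriv (EuclideanSpace.basisFun (Fin 3) ℝ) (contDiffAt_newtonian h)]
  set y := x - c with hy
  have hy0 : 0 < ‖y‖ := by simpa [hy, sub_eq_zero] using h
  set a := ‖y‖ ^ 2 with ha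
  have ha0 : 0 < a := by positivity
  have key : ∀ i, deriv (deriv fun s : ℝ =>
      newtonian c (x + s • EuclideanSpace.basisFun (Fin 3) ℝ i)) 0
      = 3 * (y i) ^ 2 * (‖y‖⁻¹) ^ 5 - (‖y‖⁻¹) ^ 3 := by
    intro i
    set p : ℝ → ℝ := fun s => a + 2 * y i * s + s ^ 2 with hp
    have hpd : ∀ s, HasDerivAt p (2 * y i + 2 * s) s := fun s => by
      have := (((hasDerivAt_id s).const_mul (2 * y i)).const_add a).add (hasDerivAt_pow 2 s)
      simp only [mul_one, Nat.cast_ofNat, Nat.add_one_sub_one, pow_one] at this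
      exact this
    have h0 : (fun s : ℝ => newtonian c (x + s • EuclideanSpace.basisFun (Fin 3) ℝ i))
        = fun s => (Real.sqrt (p s))⁻¹ := by
      ext s
      have : x + s • EuclideanSpace.basisFun (Fin 3) ℝ i - c
          = y + s • EuclideanSpace.basisFun (Fin 3) ℝ i := by rw [hy]; abel
      rw [newtonian, this, ← Real.sqrt_sq (norm_nonneg _), norm_add_sq_real,
        real_inner_smul_right, norm_smul]
      congr 2
      simp [hp, ha, EuclideanSpace.basisFun_apply, EuclideanSpace.inner_single_right]
      ring
    have hp0 : p 0 = a := by simp [hp]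
    have hev : ∀ᶠ s in 𝓝 (0 : ℝ), 0 < p s := by
      have : ContinuousAt p 0 := (hpd 0).continuousAt
      exact this.eventually_const_lt (by rw [hp0]; exact ha0)
    have h1 : (deriv fun s => (Real.sqrt (p s))⁻¹)
        =ᶠ[𝓝 0] fun s => -((y i + s) * ((Real.sqrt (p s))⁻¹) ^ 3) := by
      filter_upwards [hev] with s hs
      have hs' : Real.sqrt (p s) ≠ 0 := (Real.sqrt_pos.2 hs).ne'
      refine (((hpd s).sqrt hs.ne').inv hs').deriv.trans ?_
      field_simp
    rw [h0, h1.deriv_eq]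
    have hs' : Real.sqrt (p 0) = ‖y‖ := by rw [hp0, ha, Real.sqrt_sq hy0.le]
    have hne : Real.sqrt (p 0) ≠ 0 := by rw [hs']; exact hy0.ne'
    have h2 := ((((hasDerivAt_id (0 : ℝ)).const_add (y i)).mul
      ((((hpd 0).sqrt (by rw [hp0]; exact ha0.ne')).inv hne).pow 3)).neg).deriv
    simp only [Pi.neg_def, Pi.mul_def, Pi.pow_def, Pi.inv_def] at h2
    simp only [id] at h2
    rw [h2, hs']
    simp only [Nat.cast_ofNat, Nat.add_one_sub_one, mul_zero, add_zero, one_mul]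
    field_simp
    ring
  rw [Finset.sum_congr rfl fun i _ => key i, Finset.sum_sub_distrib, ← Finset.sum_mul,
    ← Finset.mul_sum]
  have : ∑ i, y i ^ 2 = ‖y‖ ^ 2 := by
    rw [EuclideanSpace.norm_sq_eq]; simp
  rw [this]
  simp only [Finset.sum_const, Finset.card_univ, Fintype.card_fin, nsmul_eq_mul]
  field_simp
  norm_num

end Newtonian

section Hopf

/-- Hopf's boundary point lemma: a harmonic function in a ball whose strict maximum is reached at
a boundary point grows at least linearly in the normal direction. -/
theorem hopf_linear_growth {c p : E3} {R M : ℝ} (hR : 0 < R) {f : E3 → ℝ}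
    (hf : ContinuousOn f (Metric.closedBall c R))
    (hharm : ∀ x ∈ Metric.ball c R, InnerProductSpace.HarmonicAt f x)
    (hlt : ∀ x ∈ Metric.ball c R, f x < M) (hle : ∀ x ∈ Metric.closedBall c R, f x ≤ M)
    (hp : dist p c = R) :
    ∃ κ > 0, ∀ t ∈ Icc (0 : ℝ) (1 / 2), f (p - t • (p - c)) ≤ M - κ * t := by
  have hsub : Metric.sphere c (R / 2) ⊆ Metric.ball c R := fun x hx => by
    rw [Metric.mem_sphere] at hx; rw [Metric.mem_ball, hx]; linarith
  have hhalf : c + (1 / 2 : ℝ) • (p - c) ∈ Metric.sphere c (R / 2) := by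
    rw [Metric.mem_sphere, dist_eq_norm, add_sub_cancel_left, norm_smul, ← dist_eq_norm, hp]
    norm_num; ring
  obtain ⟨z, hz, hmax⟩ := (isCompact_sphere c (R / 2)).exists_isMaxOn ⟨_, hhalf⟩
    (hf.mono (hsub.trans Metric.ball_subset_closedBall))
  set μ := M - f z with hμ
  have hμ0 : 0 < μ := by have := hlt z (hsub hz); linarith
  set u : E3 → ℝ := f + (μ * R) • newtonian c with hu
  set K : Set E3 := Metric.closedBall c R ∩ {x | R / 2 ≤ dist x c} with hK
  have hKc : IsCompact K := (isCompact_closedBall c R).inter_right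
    (isClosed_le continuous_const (continuous_id.dist continuous_const))
  have hne : ∀ x ∈ K, x ≠ c := by
    rintro x ⟨-, hx⟩ rfl
    rw [mem_ofPred_eq, dist_self] at hx
    linarith
  have huc : ContinuousOn u K := by
    refine (hf.mono inter_subset_left).add (ContinuousOn.const_smul ?_ _)
    exact fun x hx => (contDiffAt_newtonian (hne x hx)).continuousAt.continuousWithinAt
  have hmain : ∀ x ∈ K, u x ≤ M + μ := by
    refine le_of_subharmonic_of_isCompact hKc huc fun x hx => ?_
    have hxd : 0 < dist x c := dist_pos.2 (hne x hx)
    have hux : u x = f x + μ * R * (dist x c)⁻¹ := by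
      simp [hu, newtonian, dist_eq_norm]
    rcases eq_or_lt_of_le (show dist x c ≤ R from hx.1) with h1 | h1
    · left
      rw [hux, h1, mul_assoc, mul_inv_cancel₀ hR.ne', mul_one]
      have := hle x hx.1
      linarith
    rcases eq_or_lt_of_le (show R / 2 ≤ dist x c from hx.2) with h2 | h2
    · left
      have h3 : f x ≤ f z := hmax (show x ∈ Metric.sphere c (R / 2) from h2.symm)
      have h4 : μ * R * (dist x c)⁻¹ = 2 * μ := by rw [← h2]; field_simp
      rw [hux, h4]
      linarith
    · right
      have hC := contDiffAt_newtonian (hne x hx)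
      have hH := hharm x h1
      refine ⟨?_, hH.1.add (contDiffAt_const.smul hC), ?_⟩
      · filter_upwards [Metric.isOpen_ball.mem_nhds (show x ∈ Metric.ball c R from h1),
          (isOpen_lt continuous_const (continuous_id.dist continuous_const)).mem_nhds h2]
          with y hy hy2
        exact ⟨Metric.ball_subset_closedBall hy, le_of_lt hy2⟩
      · have hC2 : ContDiffAt ℝ 2 ((μ * R) • newtonian c) x := contDiffAt_const.smul hC
        rw [hu, hH.1.laplacian_add hC2,
          InnerProductSpace.laplacian_smul _ hC, laplacian_newtonian (hne x hx), hH.2.eq_of_nhds]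
        simp
  refine ⟨μ, hμ0, fun t ht => ?_⟩
  have hd : dist (p - t • (p - c)) c = (1 - t) * R := by
    have : p - t • (p - c) - c = (1 - t) • (p - c) := by module
    rw [dist_eq_norm, this, norm_smul, ← dist_eq_norm p c, hp, Real.norm_eq_abs, abs_of_nonneg]
    linarith [ht.2]
  have h1t : 0 < 1 - t := by linarith [ht.2]
  have hmem : p - t • (p - c) ∈ K := by
    refine ⟨?_, ?_⟩
    · rw [Metric.mem_closedBall, hd]; nlinarith [ht.1]
    · rw [mem_ofPred_eq, hd]; nlinarith [ht.2]
  have h1 := hmain _ hmem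
  have h2 : u (p - t • (p - c)) = f (p - t • (p - c)) + μ / (1 - t) := by
    simp only [hu, newtonian, Pi.add_apply, Pi.smul_apply, ← dist_eq_norm, hd, smul_eq_mul]
    field_simp
  have h3 : μ * (1 + t) ≤ μ / (1 - t) := by
    rw [le_div_iff₀ h1t]
    nlinarith [sq_nonneg t, mul_nonneg hμ0.le (sq_nonneg t)]
  nlinarith

/-- The derivative form of Hopf's lemma. -/
theorem hopf_deriv_pos {c p : E3} {R M : ℝ} (hR : 0 < R) {f : E3 → ℝ}
    (hf : ContinuousOn f (Metric.closedBall c R))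
    (hharm : ∀ x ∈ Metric.ball c R, InnerProductSpace.HarmonicAt f x)
    (hlt : ∀ x ∈ Metric.ball c R, f x < M) (hle : ∀ x ∈ Metric.closedBall c R, f x ≤ M)
    (hp : dist p c = R) (hfp : f p = M) {s : Set E3} (hs : Metric.closedBall c R ⊆ s)
    {f' : E3 →L[ℝ] ℝ} (hf' : HasFDerivWithinAt f f' s p) : 0 < f' (p - c) := by
  obtain ⟨κ, hκ, h⟩ := hopf_linear_growth hR hf hharm hlt hle hp
  have hline : HasDerivWithinAt (fun t : ℝ => p - t • (p - c)) (-(p - c)) (Icc 0 (1 / 2)) 0 := by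
    simpa using (((hasDerivAt_id (0 : ℝ)).smul_const (p - c)).const_sub p).hasDerivWithinAt
  have hmaps : MapsTo (fun t : ℝ => p - t • (p - c)) (Icc 0 (1 / 2)) s := by
    intro t ht
    apply hs
    have : p - t • (p - c) - c = (1 - t) • (p - c) := by module
    have h1t : 0 ≤ 1 - t := by linarith [ht.2]
    rw [Metric.mem_closedBall, dist_eq_norm, this, norm_smul, ← dist_eq_norm p c, hp,
      Real.norm_eq_abs, abs_of_nonneg h1t]
    nlinarith [ht.1]
  have hcomp : HasDerivWithinAt (fun t : ℝ => f (p - t • (p - c)) + κ * t)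
      (f' (-(p - c)) + κ) (Icc 0 (1 / 2)) 0 := by
    have h1 : HasFDerivWithinAt f f' s (p - (0 : ℝ) • (p - c)) := by simpa using hf'
    have h2 := h1.comp_hasDerivWithinAt (0 : ℝ) hline hmaps
    have h3 := h2.add ((hasDerivAt_id (0 : ℝ)).const_mul κ).hasDerivWithinAt
    rw [mul_one] at h3
    exact h3
  have hle0 : f' (-(p - c)) + κ ≤ 0 := by
    rw [hasDerivWithinAt_iff_tendsto_slope] at hcomp
    have hnb : (𝓝[Icc (0 : ℝ) (1 / 2) \ {0}] 0).NeBot := by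
      have : Icc (0 : ℝ) (1 / 2) \ {0} = Ioc 0 (1 / 2) := by
        rw [Icc_sdiff_left]
      rw [this, nhdsWithin_Ioc_eq_nhdsGT (by norm_num)]
      infer_instance
    refine le_of_tendsto hcomp ?_
    filter_upwards [self_mem_nhdsWithin] with t ht
    have ht0 : 0 < t := lt_of_le_of_ne ht.1.1 (Ne.symm ht.2)
    rw [slope_def_field]
    have h3 := h t ht.1
    simp only [zero_smul, sub_zero, mul_zero, add_zero, hfp]
    exact div_nonpos_of_nonpos_of_nonneg (by linarith) ht0.le
  rw [map_neg] at hle0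
  linarith

/-- The strong maximum principle. -/
theorem eqOn_of_isMaxOn_of_harmonic {Ω : Set E3} (ho : IsOpen Ω) (hc : IsPreconnected Ω)
    {f : E3 → ℝ} (hharm : InnerProductSpace.HarmonicOnNhd f Ω) {z : E3} (hz : z ∈ Ω)
    (hmax : ∀ x ∈ Ω, f x ≤ f z) : ∀ x ∈ Ω, f x = f z := by
  set M := f z with hM
  have hcont : ContinuousOn f Ω := hharm.continuousOn
  have hU : IsOpen (Ω ∩ f ⁻¹' Iio M) := hcont.isOpen_inter_preimage ho isOpen_Iio
  have hV : IsOpen {x | x ∈ Ω ∧ f x = M} := by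
    rw [Metric.isOpen_iff]
    rintro x ⟨hx, hxM⟩
    obtain ⟨d, hd, hball⟩ := Metric.isOpen_iff.1 ho x hx
    refine ⟨d / 4, by positivity, fun y hy => ?_⟩
    have hyd : dist y x < d / 4 := hy
    have hyΩ : y ∈ Ω := hball (by rw [Metric.mem_ball]; linarith)
    refine ⟨hyΩ, ?_⟩
    by_contra hne
    have hylt : f y < M := lt_of_le_of_ne (hmax y hyΩ) hne
    have hsub : Metric.closedBall x (d / 2) ⊆ Ω := fun w hw => hball (by
      rw [Metric.mem_closedBall] at hw; rw [Metric.mem_ball]; linarith)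
    set Z := Metric.closedBall x (d / 2) ∩ f ⁻¹' {M} with hZ
    have hZc : IsCompact Z := by
      refine (isCompact_closedBall x (d / 2)).of_isClosed_subset ?_ inter_subset_left
      exact (hcont.mono hsub).preimage_isClosed_of_isClosed Metric.isClosed_closedBall
        isClosed_singleton
    have hxZ : x ∈ Z := ⟨Metric.mem_closedBall_self (by positivity), hxM⟩
    obtain ⟨p, hp, hmin⟩ := hZc.exists_isMinOn ⟨x, hxZ⟩
      (continuous_id.dist (continuous_const (y := y))).continuousOn
    simp only [id] at hmin
    have hpx : dist p y ≤ dist x y := hmin hxZ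
    rw [dist_comm x y] at hpx
    have hpy : 0 < dist p y := dist_pos.2 (by
      rintro rfl
      exact hne hp.2)
    have hbs : Metric.closedBall y (dist p y) ⊆ Metric.closedBall x (d / 2) := fun w hw => by
      rw [Metric.mem_closedBall] at hw ⊢
      have := dist_triangle w y x
      linarith
    have hgrad := hopf_deriv_pos hpy (hcont.mono (hbs.trans hsub))
      (fun w hw => hharm w (hsub (hbs (Metric.ball_subset_closedBall hw))))
      (fun w hw => lt_of_le_of_ne (hmax w (hsub (hbs (Metric.ball_subset_closedBall hw))))
        fun hwM => absurd (hmin ⟨hbs (Metric.ball_subset_closedBall hw), hwM⟩)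
          (not_le.2 (Metric.mem_ball.1 hw)))
      (fun w hw => hmax w (hsub (hbs hw))) rfl hp.2 (subset_univ _)
      ((hharm p (hsub hp.1)).1.differentiableAt (by simp)).hasFDerivAt.hasFDerivWithinAt
    have hloc : IsLocalMax f p := by
      filter_upwards [ho.mem_nhds (hsub hp.1)] with w hw
      rw [show f p = M from hp.2]
      exact hmax w hw
    rw [hloc.fderiv_eq_zero] at hgrad
    simp at hgrad
  have hsub := hc.subset_left_of_subset_union hV hU
    (disjoint_left.2 fun x hx hx' => (ne_of_lt hx'.2) hx.2)
    (fun x hx => by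
      rcases eq_or_lt_of_le (hmax x hx) with h | h
      · exact Or.inl ⟨hx, h⟩
      · exact Or.inr ⟨hx, h⟩) ⟨z, hz, hz, rfl⟩
  exact fun x hx => (hsub hx).2

end Hopf

section Infinity

theorem harmonicAt_newtonian {c x : E3} (h : x ≠ c) :
    InnerProductSpace.HarmonicAt (newtonian c) x :=
  ⟨contDiffAt_newtonian h, by
    filter_upwards [isOpen_ne.mem_nhds h] with y hy using laplacian_newtonian hy⟩

theorem harmonicAt_clm (l : E3 →L[ℝ] ℝ) (x : E3) : InnerProductSpace.HarmonicAt l x := by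
  refine ⟨l.contDiff.contDiffAt, Eventually.of_forall fun y => ?_⟩
  rw [laplacian_eq_sum_deriv_deriv (stdOrthonormalBasis ℝ E3) l.contDiff.contDiffAt]
  refine Finset.sum_eq_zero fun i _ => ?_
  have : (deriv fun s : ℝ => l (y + s • stdOrthonormalBasis ℝ E3 i))
      = fun _ => l (stdOrthonormalBasis ℝ E3 i) := by
    ext s
    simp
  rw [this, deriv_const]

theorem le_of_harmonic_of_isCompact {K : Set E3} (hK : IsCompact K) {u : E3 → ℝ}
    (hu : ContinuousOn u K)
    (h : ∀ x ∈ K, u x ≤ 0 ∨ (K ∈ 𝓝 x ∧ InnerProductSpace.HarmonicAt u x)) :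
    ∀ x ∈ K, u x ≤ 0 :=
  le_of_subharmonic_of_isCompact hK hu fun x hx => (h x hx).imp_right fun h =>
    ⟨h.1, h.2.1, (h.2.2.eq_of_nhds).symm.le⟩

theorem exists_unit_orthogonal (n x : E3) : ∃ e : E3, ‖e‖ = 1 ∧ ⟪n, e⟫ = 0 ∧ 0 ≤ ⟪x, e⟫ := by
  have h : ∃ v : E3, ⟪n, v⟫ = 0 ∧ v ≠ 0 := by
    by_contra! hcon
    have hinj : LinearMap.ker (innerSL ℝ n).toLinearMap = ⊥ := by
      rw [LinearMap.ker_eq_bot']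
      exact hcon
    have := LinearMap.finrank_le_finrank_of_injective (LinearMap.ker_eq_bot.1 hinj)
    simp at this
  obtain ⟨v, hv, hv0⟩ := h
  have hn : ‖(‖v‖⁻¹ • v)‖ = 1 := by
    rw [norm_smul, norm_inv, norm_norm, inv_mul_cancel₀ (norm_ne_zero_iff.2 hv0)]
  rcases le_total 0 ⟪x, ‖v‖⁻¹ • v⟫ with h | h
  · exact ⟨_, hn, by rw [real_inner_smul_right, hv, mul_zero], h⟩
  · refine ⟨-(‖v‖⁻¹ • v), by rwa [norm_neg], ?_, ?_⟩
    · rw [inner_neg_right, real_inner_smul_right, hv, mul_zero, neg_zero]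
    · rw [inner_neg_right]; linarith

theorem abs_sub_le_of_segment {f : E3 → ℝ} {δ ρ : ℝ}
    (hf : ∀ y, ρ ≤ ‖y‖ → DifferentiableAt ℝ f y ∧ ‖fderiv ℝ f y‖ ≤ δ) {a v : E3}
    (h : ∀ τ ∈ Icc (0 : ℝ) 1, ρ ≤ ‖a + τ • v‖) : |f (a + v) - f a| ≤ δ * ‖v‖ := by
  have hseg : ∀ y ∈ segment ℝ a (a + v), ρ ≤ ‖y‖ := by
    intro y hy
    rw [segment_eq_image'] at hy
    obtain ⟨τ, hτ, rfl⟩ := hy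
    simpa using h τ hτ
  have := (convex_segment a (a + v)).norm_image_sub_le_of_norm_fderiv_le
    (fun y hy => (hf y (hseg y hy)).1) (fun y hy => (hf y (hseg y hy)).2)
    (left_mem_segment ℝ _ _) (right_mem_segment ℝ _ _)
  simpa using this

theorem le_norm_of_sq_le {ρ : ℝ} {y : E3} (h : ρ ^ 2 ≤ ‖y‖ ^ 2) : ρ ≤ ‖y‖ :=
  le_of_sq_le_sq h (norm_nonneg y)

/-- The increment of `f` between two points exchanged by a reflection, along a path that avoids
the ball through these points. -/
theorem abs_sub_reflected_le {f : E3 → ℝ} {δ : ℝ} {n x : E3} (hn : ‖n‖ = 1)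
    (hf : ∀ y, ‖x‖ ≤ ‖y‖ → DifferentiableAt ℝ f y ∧ ‖fderiv ℝ f y‖ ≤ δ)
    (hx : 0 ≤ ⟪x, n⟫) : |f x - f (x - (2 * ⟪x, n⟫) • n)| ≤ δ * (4 * ⟪x, n⟫) := by
  obtain ⟨e, he, hne, hxe⟩ := exists_unit_orthogonal n x
  set s := ⟪x, n⟫ with hs
  have hnn : ⟪n, n⟫ = 1 := by rw [real_inner_self_eq_norm_sq, hn]; norm_num
  have hee : ⟪e, e⟫ = 1 := by rw [real_inner_self_eq_norm_sq, he]; norm_num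
  have hen : ⟪e, n⟫ = 0 := by rw [real_inner_comm]; exact hne
  have hnx : ⟪n, x⟫ = s := real_inner_comm _ _
  have hex : ⟪e, x⟫ = ⟪x, e⟫ := real_inner_comm _ _
  have hsxe : 0 ≤ s * ⟪x, e⟫ := mul_nonneg hx hxe
  have expand : ∀ a b : ℝ, ‖x + a • n + b • e‖ ^ 2
      = ‖x‖ ^ 2 + 2 * a * s + 2 * b * ⟪x, e⟫ + a ^ 2 + b ^ 2 := by
    intro a b
    simp only [← real_inner_self_eq_norm_sq, inner_add_left, inner_add_right,
      real_inner_smul_left, real_inner_smul_right, hnn, hee, hen, hne, hnx, hex, ← hs]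
    ring
  have h1 : |f (x + s • e) - f x| ≤ δ * ‖s • e‖ := abs_sub_le_of_segment hf fun τ hτ => by
    refine le_norm_of_sq_le ?_
    have := expand 0 (τ * s)
    rw [zero_smul, add_zero, mul_smul] at this
    rw [this]
    nlinarith [mul_nonneg hτ.1 hsxe, sq_nonneg (τ * s)]
  have h2 : |f (x + s • e + (-(2 * s)) • n) - f (x + s • e)| ≤ δ * ‖(-(2 * s)) • n‖ :=
    abs_sub_le_of_segment hf fun τ hτ => by
      refine le_norm_of_sq_le ?_
      have := expand (τ * (-(2 * s))) s
      rw [mul_smul, add_right_comm] at this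
      rw [this]
      nlinarith [sq_nonneg (s * (1 - 2 * τ)), hsxe]
  have h3 : |f (x + (-(2 * s)) • n + s • e) - f (x + (-(2 * s)) • n)| ≤ δ * ‖s • e‖ :=
    abs_sub_le_of_segment hf fun τ hτ => by
      refine le_norm_of_sq_le ?_
      have := expand (-(2 * s)) (τ * s)
      rw [mul_smul τ] at this
      rw [this]
      nlinarith [mul_nonneg hτ.1 hsxe, sq_nonneg (τ * s)]
  rw [norm_smul, he, Real.norm_eq_abs, abs_of_nonneg hx, mul_one] at h1 h3
  rw [norm_smul, hn, Real.norm_eq_abs, abs_neg, abs_of_nonneg (by linarith : 0 ≤ 2 * s), mul_one,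
    add_right_comm] at h2
  have h4 : x - (2 * s) • n = x + (-(2 * s)) • n := by rw [neg_smul, sub_eq_add_neg]
  rw [h4]
  rw [abs_le] at h1 h2 h3 ⊢
  constructor <;> linarith [h1.1, h1.2, h2.1, h2.2, h3.1, h3.2]

/-- Functions which are harmonic near infinity, with gradient tending to zero. -/
structure IsExteriorHarmonic (R : ℝ) (f : E3 → ℝ) : Prop where
  pos : 0 < R
  harmonicAt : ∀ x, R ≤ ‖x‖ → InnerProductSpace.HarmonicAt f x
  decay : ∀ δ > 0, ∃ ρ, ∀ x, ρ ≤ ‖x‖ → ‖fderiv ℝ f x‖ ≤ δ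

theorem IsExteriorHarmonic.neg {R : ℝ} {f : E3 → ℝ} (h : IsExteriorHarmonic R f) :
    IsExteriorHarmonic R (-f) where
  pos := h.pos
  harmonicAt x hx := (h.harmonicAt x hx).neg
  decay δ hδ := by
    obtain ⟨ρ, hρ⟩ := h.decay δ hδ
    refine ⟨ρ, fun x hx => ?_⟩
    rw [fderiv_neg, norm_neg]
    exact hρ x hx

theorem reflection_orthogonal_unit_apply {n : E3} (hn : ‖n‖ = 1) (x : E3) :
    (ℝ ∙ n)ᗮ.reflection x = x - (2 * ⟪x, n⟫) • n := by
  rw [Submodule.reflection_orthogonal_apply, Submodule.reflection_singleton_apply, hn,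
    real_inner_comm]
  simp [two_smul, two_mul, add_smul]

theorem IsExteriorHarmonic.sub_reflected_le {R : ℝ} {f : E3 → ℝ} (h : IsExteriorHarmonic R f)
    {A : ℝ} (hA : ∀ x, ‖x‖ = R → |f x| ≤ A) {n : E3} (hn : ‖n‖ = 1) {x : E3} (hx : R ≤ ‖x‖)
    (hxn : 0 ≤ ⟪x, n⟫) : f x - f (x - (2 * ⟪x, n⟫) • n) ≤ 2 * A * R / ‖x‖ := by
  have hR := h.pos
  have hA0 : 0 ≤ A := by
    have : ‖R • n‖ = R := by rw [norm_smul, hn, Real.norm_eq_abs, abs_of_pos hR, mul_one]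
    exact (abs_nonneg _).trans (hA _ this)
  set S := (ℝ ∙ n)ᗮ.reflection with hS
  have hSx : ∀ y, S y = y - (2 * ⟪y, n⟫) • n := reflection_orthogonal_unit_apply hn
  have key : ∀ ε > 0, f x - f (S x) ≤ 2 * A * R / ‖x‖ + ε * ⟪x, n⟫ := by
    intro ε hε
    obtain ⟨ρ₀, hρ₀⟩ := h.decay (ε / 4) (by positivity)
    set ρ := max ρ₀ ‖x‖ with hρ
    have hRρ : R ≤ ρ := hx.trans (le_max_right _ _)
    set K : Set E3 := Metric.closedBall 0 ρ ∩ ({y | R ≤ ‖y‖} ∩ {y | 0 ≤ ⟪n, y⟫}) with hK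
    have hKc : IsCompact K := (isCompact_closedBall 0 ρ).inter_right
      ((isClosed_le continuous_const continuous_norm).inter
        (isClosed_le continuous_const (by fun_prop)))
    set u : E3 → ℝ := f - f ∘ S - (2 * A * R) • newtonian 0 - ε • ⇑(innerSL ℝ n) with hu
    have hux : ∀ y, u y = f y - f (S y) - 2 * A * R / ‖y‖ - ε * ⟪n, y⟫ := fun y => by
      simp [hu, newtonian, div_eq_mul_inv]
    have hharm : ∀ y ∈ K, InnerProductSpace.HarmonicAt u y := by
      intro y hy
      have hy0 : y ≠ 0 := norm_pos_iff.1 (hR.trans_le hy.2.1)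
      refine (((h.harmonicAt y hy.2.1).sub ?_).sub ?_).sub ?_
      · refine harmonicAt_comp_linearIsometryEquiv S (h.harmonicAt _ ?_)
        rw [S.norm_map]; exact hy.2.1
      · exact (harmonicAt_newtonian hy0).const_smul
      · exact (harmonicAt_clm _ y).const_smul
    have hle := le_of_harmonic_of_isCompact hKc
      (fun y hy => (hharm y hy).1.continuousAt.continuousWithinAt) (fun y hy => ?_)
      x ⟨by rw [mem_closedBall_zero_iff]; exact le_max_right _ _, hx, by
        rw [mem_ofPred_eq, real_inner_comm]; exact hxn⟩
    · rw [hux, real_inner_comm] at hle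
      linarith
    have hyR : R ≤ ‖y‖ := hy.2.1
    have hyn : 0 ≤ ⟪n, y⟫ := hy.2.2
    have hyρ : ‖y‖ ≤ ρ := mem_closedBall_zero_iff.1 hy.1
    have hy0 : 0 < ‖y‖ := hR.trans_le hyR
    rcases eq_or_lt_of_le hyR with h1 | h1
    · left
      rw [hux, ← h1, mul_div_cancel_right₀ _ hR.ne']
      have h2 := abs_le.1 (hA y h1.symm)
      have h3 := abs_le.1 (hA (S y) (by rw [S.norm_map]; exact h1.symm))
      have := mul_nonneg hε.le hyn
      linarith [h2.2, h3.1]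
    rcases eq_or_lt_of_le hyn with h2 | h2
    · left
      have : S y = y := by rw [hSx, real_inner_comm, ← h2]; simp
      rw [hux, this, ← h2, sub_self, mul_zero, zero_sub, sub_zero, neg_nonpos]
      positivity
    rcases eq_or_lt_of_le hyρ with h3 | h3
    · left
      have h4 := abs_sub_reflected_le (δ := ε / 4) hn (x := y) (f := f) (fun z hz => ⟨
        (h.harmonicAt z (hyR.trans hz)).1.differentiableAt (by simp),
        hρ₀ z ((le_max_left _ _).trans (h3.symm.le.trans hz))⟩) (by
          rw [real_inner_comm]; exact hyn)
      rw [← hSx, real_inner_comm] at h4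
      rw [hux]
      have h5 := (abs_le.1 h4).2
      have : 0 ≤ 2 * A * R / ‖y‖ := by positivity
      linarith
    · right
      refine ⟨?_, hharm y hy⟩
      have ho1 : IsOpen {z : E3 | R < ‖z‖} := isOpen_lt continuous_const continuous_norm
      have ho2 : IsOpen {z : E3 | 0 < ⟪n, z⟫} := isOpen_lt continuous_const (by fun_prop)
      have ho3 : IsOpen {z : E3 | ‖z‖ < ρ} := isOpen_lt continuous_norm continuous_const
      filter_upwards [ho1.mem_nhds h1, ho2.mem_nhds h2, ho3.mem_nhds h3] with z hz1 hz2 hz3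
      exact ⟨by rw [mem_closedBall_zero_iff]; exact le_of_lt hz3, le_of_lt hz1, le_of_lt hz2⟩
  rw [← hSx]
  refine le_of_forall_pos_le_add fun ε hε => ?_
  have hpos : 0 < ⟪x, n⟫ + 1 := by linarith
  refine (key (ε / (⟪x, n⟫ + 1)) (by positivity)).trans ?_
  have : ε / (⟪x, n⟫ + 1) * ⟪x, n⟫ ≤ ε := by
    rw [div_mul_eq_mul_div, div_le_iff₀ hpos]
    nlinarith
  linarith

/-- The oscillation on spheres. -/
theorem IsExteriorHarmonic.abs_sub_le {R : ℝ} {f : E3 → ℝ} (h : IsExteriorHarmonic R f)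
    {A : ℝ} (hA : ∀ x, ‖x‖ = R → |f x| ≤ A) {x y : E3} (hx : R ≤ ‖x‖) (hxy : ‖x‖ = ‖y‖) :
    f x - f y ≤ 2 * A * R / ‖x‖ := by
  have hR := h.pos
  rcases eq_or_ne x y with rfl | hne
  · rw [sub_self]
    have hx0 := hR.trans_le hx
    have hA0 : 0 ≤ A := by
      have : ‖(R / ‖x‖) • x‖ = R := by
        rw [norm_smul, norm_div, norm_norm, Real.norm_eq_abs, abs_of_pos hR]
        field_simp
      exact (abs_nonneg _).trans (hA _ this)
    positivity
  have hd : 0 < ‖x - y‖ := norm_pos_iff.2 (sub_ne_zero.2 hne)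
  set n := ‖x - y‖⁻¹ • (x - y) with hn
  have hn1 : ‖n‖ = 1 := by
    rw [hn, norm_smul, norm_inv, norm_norm, inv_mul_cancel₀ hd.ne']
  have hin : ⟪x, x - y⟫ = ‖x - y‖ ^ 2 / 2 := by
    rw [norm_sub_sq_real, inner_sub_right, real_inner_self_eq_norm_sq, ← hxy]
    ring
  have hxn : ⟪x, n⟫ = ‖x - y‖ / 2 := by
    rw [hn, real_inner_smul_right, hin]
    field_simp
  have href : x - (2 * ⟪x, n⟫) • n = y := by
    rw [hxn, hn, smul_smul, mul_div_cancel₀ _ two_ne_zero, mul_inv_cancel₀ hd.ne', one_smul]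
    abel
  have := h.sub_reflected_le hA hn1 hx (by rw [hxn]; positivity)
  rwa [href] at this

end Infinity

section Infinity

theorem IsExteriorHarmonic.le_interpolation {R : ℝ} {f : E3 → ℝ} (h : IsExteriorHarmonic R f)
    {A : ℝ} (hA : ∀ x, ‖x‖ = R → |f x| ≤ A) {e : E3} (he : ‖e‖ = 1) {r ρ : ℝ} (hr : R ≤ r)
    (hrρ : r < ρ) {x : E3} (hx : r ≤ ‖x‖) (hxρ : ‖x‖ ≤ ρ) :
    f x ≤ 2 * A * R / r + (f (ρ • e)
      + (f (r • e) - f (ρ • e)) / (r⁻¹ - ρ⁻¹) * (‖x‖⁻¹ - ρ⁻¹)) := by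
  have hR := h.pos
  have hr0 : 0 < r := hR.trans_le hr
  have hρ0 : 0 < ρ := hr0.trans hrρ
  have hinv : 0 < r⁻¹ - ρ⁻¹ := sub_pos.2 (inv_strictAnti₀ hr0 hrρ)
  have hnorm : ∀ s : ℝ, 0 < s → ‖s • e‖ = s := fun s hs => by
    rw [norm_smul, he, Real.norm_eq_abs, abs_of_pos hs, mul_one]
  have hA0 : 0 ≤ A := (abs_nonneg _).trans (hA _ (hnorm R hR))
  set κ := (f (r • e) - f (ρ • e)) / (r⁻¹ - ρ⁻¹) with hκ
  set C := 2 * A * R / r + f (ρ • e) - κ * ρ⁻¹ with hC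
  set K : Set E3 := Metric.closedBall 0 ρ ∩ {y | r ≤ ‖y‖} with hK
  have hKc : IsCompact K := (isCompact_closedBall 0 ρ).inter_right
    (isClosed_le continuous_const continuous_norm)
  set u : E3 → ℝ := f - κ • newtonian 0 - fun _ => C with hu
  have hux : ∀ y, u y = f y - κ * ‖y‖⁻¹ - C := fun y => by simp [hu, newtonian]
  have hharm : ∀ y ∈ K, InnerProductSpace.HarmonicAt u y := fun y hy =>
    ((h.harmonicAt y (hr.trans hy.2)).sub
      (harmonicAt_newtonian (norm_pos_iff.1 (hr0.trans_le hy.2))).const_smul).sub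
      (InnerProductSpace.harmonicAt_const C)
  have hle := le_of_harmonic_of_isCompact hKc
    (fun y hy => (hharm y hy).1.continuousAt.continuousWithinAt) (fun y hy => ?_)
    x ⟨by rw [mem_closedBall_zero_iff]; exact hxρ, hx⟩
  · rw [hux] at hle
    linarith
  have hyρ : ‖y‖ ≤ ρ := mem_closedBall_zero_iff.1 hy.1
  have hyr : r ≤ ‖y‖ := hy.2
  rcases eq_or_lt_of_le hyr with h1 | h1
  · left
    have h2 := h.abs_sub_le hA (hr.trans hyr) (y := r • e) (by rw [hnorm r hr0, h1])
    have h3 : κ * r⁻¹ - κ * ρ⁻¹ = f (r • e) - f (ρ • e) := by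
      rw [← mul_sub, hκ, div_mul_cancel₀ _ hinv.ne']
    rw [hux, ← h1]
    rw [← h1] at h2
    linarith
  rcases eq_or_lt_of_le hyρ with h2 | h2
  · left
    have h3 := h.abs_sub_le hA (hr.trans hyr) (y := ρ • e) (by rw [hnorm ρ hρ0, h2])
    have h4 : 2 * A * R / ρ ≤ 2 * A * R / r := by gcongr
    rw [hux, h2]
    rw [h2] at h3
    linarith
  · right
    refine ⟨?_, hharm y hy⟩
    have ho1 : IsOpen {z : E3 | r < ‖z‖} := isOpen_lt continuous_const continuous_norm
    have ho3 : IsOpen {z : E3 | ‖z‖ < ρ} := isOpen_lt continuous_norm continuous_const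
    filter_upwards [ho1.mem_nhds h1, ho3.mem_nhds h2] with z hz1 hz3
    exact ⟨by rw [mem_closedBall_zero_iff]; exact le_of_lt hz3, le_of_lt hz1⟩

/-- Values along a ray at large distance are nearly determined by two nearer ones. -/
theorem IsExteriorHarmonic.le_extrapolation {R : ℝ} {f : E3 → ℝ} (h : IsExteriorHarmonic R f)
    {A : ℝ} (hA : ∀ x, ‖x‖ = R → |f x| ≤ A) {e : E3} (he : ‖e‖ = 1) {r ρ : ℝ} (hr : R ≤ r)
    (hrρ : 2 * r ≤ ρ) :
    2 * f ((2 * r) • e) - f (r • e) - 2 * r / ρ * (f ((2 * r) • e) - f (r • e)) - f (ρ • e)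
      ≤ 4 * A * R / r := by
  have hr0 : 0 < r := h.pos.trans_le hr
  have hρ0 : 0 < ρ := by linarith
  have hρr : 0 < ρ - r := by linarith
  have hnorm : ‖(2 * r) • e‖ = 2 * r := by
    rw [norm_smul, he, Real.norm_eq_abs, abs_of_pos (by positivity), mul_one]
  have hA0 : 0 ≤ A := by
    refine (abs_nonneg _).trans (hA (R • e) ?_)
    rw [norm_smul, he, Real.norm_eq_abs, abs_of_pos h.pos, mul_one]
  have h1 := h.le_interpolation hA he hr (ρ := ρ) (by linarith) (x := (2 * r) • e)
    (by rw [hnorm]; linarith) (by rw [hnorm]; exact hrρ)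
  rw [hnorm] at h1
  set a := f ((2 * r) • e)
  set b := f (r • e)
  set c := f (ρ • e)
  have h2 : (b - c) / (r⁻¹ - ρ⁻¹) * ((2 * r)⁻¹ - ρ⁻¹) = (b - c) * (ρ - 2 * r) / (2 * (ρ - r)) := by
    have : r⁻¹ - ρ⁻¹ ≠ 0 := (sub_pos.2 (inv_strictAnti₀ hr0 (by linarith))).ne'
    field_simp
  rw [h2] at h1
  have h3 : (a - c) * (2 * (ρ - r)) ≤ 2 * A * R / r * (2 * (ρ - r)) + (b - c) * (ρ - 2 * r) := by
    have : (b - c) * (ρ - 2 * r) = (b - c) * (ρ - 2 * r) / (2 * (ρ - r)) * (2 * (ρ - r)) := by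
      field_simp
    rw [this, ← add_mul]
    gcongr
    linarith
  have h4 : 0 ≤ 2 * A * R / r * r := by have := h.pos; positivity
  have h5 : 2 * a - b - 2 * r / ρ * (a - b) - c
      = ((a - c) * (2 * (ρ - r)) - (b - c) * (ρ - 2 * r)) / ρ := by
    field_simp
    ring
  rw [h5, div_le_iff₀ hρ0]
  have h6 : 4 * A * R / r * ρ = 2 * A * R / r * (2 * (ρ - r)) + 2 * (2 * A * R / r * r) := by
    field_simp
    ring
  rw [h6]
  linarith

theorem IsExteriorHarmonic.exists_tendsto {R : ℝ} {f : E3 → ℝ} (h : IsExteriorHarmonic R f) :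
    ∃ c, Tendsto f (Bornology.cobounded E3) (𝓝 c) := by
  have hR := h.pos
  obtain ⟨A, hA⟩ : ∃ A, ∀ x : E3, ‖x‖ = R → |f x| ≤ A := by
    obtain ⟨A, hA⟩ := (isCompact_sphere (0 : E3) R).exists_bound_of_continuousOn (f := f)
      fun x hx => (h.harmonicAt x (mem_sphere_zero_iff_norm.1 hx).ge).1.continuousAt
        |>.continuousWithinAt
    exact ⟨A, fun x hx => hA x (mem_sphere_zero_iff_norm.2 hx)⟩
  have hA' : ∀ x, ‖x‖ = R → |(-f) x| ≤ A := fun x hx => by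
    rw [Pi.neg_apply, abs_neg]; exact hA x hx
  obtain ⟨e, he, -, -⟩ := exists_unit_orthogonal 0 0
  have hnorm : ∀ s : ℝ, 0 ≤ s → ‖s • e‖ = s := fun s hs => by
    rw [norm_smul, he, Real.norm_eq_abs, abs_of_nonneg hs, mul_one]
  have hcauchy : Cauchy (map (fun s : ℝ => f (s • e)) atTop) := by
    rw [Metric.cauchy_iff]
    refine ⟨inferInstance, fun ε hε => ?_⟩
    have hlim : Tendsto (fun r : ℝ => 4 * A * R / r) atTop (𝓝 0) :=
      tendsto_const_nhds.div_atTop tendsto_id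
    obtain ⟨r, hr, hrR⟩ := ((hlim.eventually_lt_const (show 0 < ε / 4 by positivity)).and
      (eventually_ge_atTop R)).exists
    have hlim2 : Tendsto (fun ρ : ℝ => 2 * r / ρ * (f ((2 * r) • e) - f (r • e))) atTop (𝓝 0) := by
      have : Tendsto (fun ρ : ℝ => 2 * r / ρ) atTop (𝓝 0) :=
        tendsto_const_nhds.div_atTop tendsto_id
      simpa using this.mul_const _
    have hev : ∀ᶠ ρ in (atTop : Filter ℝ), |f (ρ • e) - (2 * f ((2 * r) • e) - f (r • e))| < ε / 2 := by
      filter_upwards [eventually_ge_atTop (2 * r),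
        (hlim2.abs.eventually_lt_const (show |(0 : ℝ)| < ε / 4 by simpa using hε))] with ρ h1 h2
      have h3 := h.le_extrapolation hA he hrR h1
      have h4 := h.neg.le_extrapolation hA' he hrR h1
      simp only [Pi.neg_apply] at h4
      have h5 : 2 * r / ρ * (-f ((2 * r) • e) - -f (r • e))
        = -(2 * r / ρ * (f ((2 * r) • e) - f (r • e))) := by ring
      rw [h5] at h4
      rw [abs_lt] at h2 ⊢
      constructor <;> linarith [h2.1, h2.2]
    refine ⟨_, image_mem_map hev, ?_⟩
    rintro _ ⟨s, hs, rfl⟩ _ ⟨s', hs', rfl⟩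
    rw [mem_ofPred_eq, abs_lt] at hs hs'
    rw [Real.dist_eq, abs_lt]
    constructor <;> linarith [hs.1, hs.2, hs'.1, hs'.2]
  obtain ⟨c, hc⟩ := cauchy_map_iff_exists_tendsto.1 hcauchy
  refine ⟨c, ?_⟩
  have h1 : Tendsto (fun x : E3 => f (‖x‖ • e)) (Bornology.cobounded E3) (𝓝 c) :=
    hc.comp tendsto_norm_cobounded_atTop
  have h2 : Tendsto (fun x : E3 => 2 * A * R / ‖x‖) (Bornology.cobounded E3) (𝓝 0) :=
    tendsto_const_nhds.div_atTop tendsto_norm_cobounded_atTop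
  have h3 : Tendsto (fun x : E3 => f x - f (‖x‖ • e)) (Bornology.cobounded E3) (𝓝 0) := by
    refine squeeze_zero_norm' ?_ h2
    filter_upwards [tendsto_norm_cobounded_atTop.eventually (eventually_ge_atTop R)] with x hx
    have hxn : ‖x‖ = ‖‖x‖ • e‖ := (hnorm _ (norm_nonneg _)).symm
    have h4 := h.abs_sub_le hA hx hxn
    have h5 := h.neg.abs_sub_le hA' hx hxn
    simp only [Pi.neg_apply] at h5
    rw [Real.norm_eq_abs, abs_le]
    constructor <;> linarith
  simpa using h3.add h1

end Infinity

section Boundary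

theorem exists_taylor_bound {g : E3 → ℝ} (hg : ContDiff ℝ ∞ g) (z : E3) :
    ∃ C > 0, ∃ d > 0, ∀ y, ‖y - z‖ < d → |g y - g z - fderiv ℝ g z (y - z)| ≤ C * ‖y - z‖ ^ 2 := by
  have h1 : ContDiffAt ℝ 1 (fderiv ℝ g) z :=
    (hg.contDiffAt.fderiv_right (m := 1) (by norm_cast))
  obtain ⟨K, t, ht, hK⟩ := h1.exists_lipschitzOnWith
  obtain ⟨d, hd, hball⟩ := Metric.mem_nhds_iff.1 ht
  refine ⟨K + 1, by positivity, d, hd, fun y hy => ?_⟩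
  have hsub : ∀ w ∈ Metric.closedBall z ‖y - z‖, w ∈ t := fun w hw =>
    hball (lt_of_le_of_lt (Metric.mem_closedBall.1 hw) hy)
  have := (convex_closedBall z ‖y - z‖).norm_image_sub_le_of_norm_fderiv_le' (f := g)
    (φ := fderiv ℝ g z) (C := K * ‖y - z‖) (x := z) (y := y)
    (fun w _ => (hg.differentiable (by simp)) w)
    (fun w hw => by
      have h2 := hK.dist_le_mul w (hsub w hw) z (mem_of_mem_nhds ht)
      rw [dist_eq_norm] at h2
      exact h2.trans (mul_le_mul_of_nonneg_left (Metric.mem_closedBall.1 hw) K.2))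
    (Metric.mem_closedBall_self (norm_nonneg _))
    (by rw [Metric.mem_closedBall, dist_eq_norm])
  rw [Real.norm_eq_abs] at this
  nlinarith [sq_nonneg ‖y - z‖]

/-- The interior ball condition. -/
theorem IsLocalDefiningFunction.exists_ball_subset {Ω : Set E3} {z : E3} {g : E3 → ℝ}
    (h : IsLocalDefiningFunction Ω z g) :
    ∃ R > 0, Metric.ball (z - R • (‖gradient g z‖⁻¹ • gradient g z)) R ⊆ Ω := by
  obtain ⟨hg, hz, hgrad, hΩ⟩ := h
  set G := ‖gradient g z‖ with hG
  have hG0 : 0 < G := norm_pos_iff.2 hgrad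
  set n := G⁻¹ • gradient g z with hn
  have hn1 : ‖n‖ = 1 := by rw [hn, norm_smul, norm_inv, hG, norm_norm, inv_mul_cancel₀ hG0.ne']
  obtain ⟨C, hC, d, hd, hT⟩ := exists_taylor_bound hg z
  obtain ⟨d', hd', hΩ'⟩ := Metric.eventually_nhds_iff.1 hΩ
  set R := min (min (d / 2) (d' / 2)) (G / (2 * C)) with hR
  have hR0 : 0 < R := by positivity
  refine ⟨R, hR0, fun y hy => ?_⟩
  set v := y - z with hv
  have hin : ⟪gradient g z, v⟫ = G * ⟪n, v⟫ := by
    rw [hn, real_inner_smul_left, ← mul_assoc, mul_inv_cancel₀ hG0.ne', one_mul]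
  have hy1 : ‖v + R • n‖ < R := by
    rw [Metric.mem_ball, dist_eq_norm] at hy
    have h0 : v + R • n = y - (z - R • n) := by rw [hv]; abel
    rwa [h0]
  have hsq : ‖v‖ ^ 2 < -(2 * R * ⟪n, v⟫) := by
    have h1 : ‖v + R • n‖ ^ 2 < R ^ 2 := by gcongr
    rw [norm_add_sq_real, real_inner_smul_right, norm_smul, hn1, Real.norm_eq_abs, mul_one,
      sq_abs, real_inner_comm] at h1
    linarith
  have hvR : ‖v‖ < 2 * R := by
    have h1 : ‖v‖ ≤ ‖v + R • n‖ + ‖R • n‖ := by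
      simpa using norm_sub_le (v + R • n) (R • n)
    rw [norm_smul, hn1, Real.norm_eq_abs, abs_of_pos hR0, mul_one] at h1
    linarith
  have hRd : R ≤ d / 2 := (min_le_left _ _).trans (min_le_left _ _)
  have hRd' : R ≤ d' / 2 := (min_le_left _ _).trans (min_le_right _ _)
  have hRC : R * (2 * C) ≤ G := (le_div_iff₀ (by positivity)).1 (min_le_right _ _)
  refine (hΩ' (by rw [dist_eq_norm]; linarith)).2 ?_
  have hT' := (abs_le.1 (hT y (by linarith))).2
  rw [hz, ← inner_gradient_left, ← hv, hin] at hT'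
  have hnv : ⟪n, v⟫ < 0 := by
    by_contra! hcon
    have : 0 ≤ 2 * R * ⟪n, v⟫ := by positivity
    nlinarith [sq_nonneg ‖v‖]
  nlinarith [mul_lt_mul_of_pos_left hsq hC]

theorem eventually_pos_of_inner_gradient_pos {g : E3 → ℝ} {z v : E3} (hg : ContDiff ℝ ∞ g)
    (hz : g z = 0) (hv : 0 < ⟪gradient g z, v⟫) : ∀ᶠ t : ℝ in 𝓝[>] 0, 0 < g (z + t • v) := by
  have hline : HasDerivAt (fun t : ℝ => z + t • v) v 0 := by
    simpa using ((hasDerivAt_id (0 : ℝ)).smul_const v).const_add z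
  have h1 : HasFDerivAt g (fderiv ℝ g z) (z + (0 : ℝ) • v) := by
    simpa using ((hg.differentiable (by simp)) z).hasFDerivAt
  have h2 := h1.comp_hasDerivAt (0 : ℝ) hline
  rw [← inner_gradient_left] at h2
  have h3 := (hasDerivAt_iff_tendsto_slope.1 h2).mono_left
    (nhdsWithin_mono (0 : ℝ) (s := Ioi 0) fun t ht => ne_of_gt ht)
  filter_upwards [h3.eventually_const_lt hv, self_mem_nhdsWithin] with t ht ht0
  rw [slope_def_field] at ht
  simp only [Function.comp_apply, zero_smul, add_zero, hz, sub_zero] at ht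
  exact (div_pos_iff_of_pos_right ht0).1 ht

theorem IsLocalDefiningFunction.unit_gradient_eq {Ω : Set E3} {z : E3} {g₁ g₂ : E3 → ℝ}
    (h₁ : IsLocalDefiningFunction Ω z g₁) (h₂ : IsLocalDefiningFunction Ω z g₂) :
    ‖gradient g₁ z‖⁻¹ • gradient g₁ z = ‖gradient g₂ z‖⁻¹ • gradient g₂ z := by
  have hG₁ : 0 < ‖gradient g₁ z‖ := norm_pos_iff.2 h₁.2.2.1
  have hG₂ : 0 < ‖gradient g₂ z‖ := norm_pos_iff.2 h₂.2.2.1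
  set n₁ := ‖gradient g₁ z‖⁻¹ • gradient g₁ z with hn₁
  set n₂ := ‖gradient g₂ z‖⁻¹ • gradient g₂ z with hn₂
  have hu₁ : ‖n₁‖ = 1 := by rw [hn₁, norm_smul, norm_inv, norm_norm, inv_mul_cancel₀ hG₁.ne']
  have hu₂ : ‖n₂‖ = 1 := by rw [hn₂, norm_smul, norm_inv, norm_norm, inv_mul_cancel₀ hG₂.ne']
  by_contra hne
  have hlt : ⟪n₁, n₂⟫ < 1 := by
    have : 0 < ‖n₁ - n₂‖ ^ 2 := by
      have := norm_pos_iff.2 (sub_ne_zero.2 hne)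
      positivity
    rw [norm_sub_sq_real, hu₁, hu₂] at this
    linarith
  have hg₁ : gradient g₁ z = ‖gradient g₁ z‖ • n₁ := by
    rw [hn₁, smul_smul, mul_inv_cancel₀ hG₁.ne', one_smul]
  have hg₂ : gradient g₂ z = ‖gradient g₂ z‖ • n₂ := by
    rw [hn₂, smul_smul, mul_inv_cancel₀ hG₂.ne', one_smul]
  have e₂ := eventually_pos_of_inner_gradient_pos (v := n₂ - n₁) h₂.1 h₂.2.1 (by
    rw [hg₂, real_inner_smul_left, inner_sub_right, real_inner_self_eq_norm_sq, hu₂,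
      real_inner_comm]
    exact mul_pos hG₂ (by linarith))
  have e₁ := eventually_pos_of_inner_gradient_pos (g := -g₁) (z := z) (v := n₂ - n₁) h₁.1.neg
    (by simp [h₁.2.1]) (by
      rw [inner_gradient_left, fderiv_neg, _root_.neg_apply, ← inner_gradient_left,
        hg₁, real_inner_smul_left, inner_sub_right, real_inner_self_eq_norm_sq, hu₁]
      nlinarith)
  have hT : Tendsto (fun t : ℝ => z + t • (n₂ - n₁)) (𝓝[>] 0) (𝓝 z) := by
    have : Continuous fun t : ℝ => z + t • (n₂ - n₁) := by fun_prop
    simpa using (this.tendsto 0).mono_left (nhdsWithin_le_nhds (s := Ioi 0))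
  obtain ⟨t, h1, h2, h3, h4⟩ := (e₁.and (e₂.and ((hT.eventually h₁.2.2.2).and
    (hT.eventually h₂.2.2.2)))).exists
  have h5 : g₁ (z + t • (n₂ - n₁)) < 0 := by simpa using h1
  have h6 := h4.1 (h3.2 h5)
  linarith

theorem IsLocalDefiningFunction.outwardNormal_eq {Ω : Set E3} {z : E3} {g : E3 → ℝ}
    (h : IsLocalDefiningFunction Ω z g) :
    outwardNormal Ω z = (‖gradient g z‖⁻¹ • gradient g z).ofLp := by
  have hex : ∃ g : E3 → ℝ, IsLocalDefiningFunction Ω z g := ⟨g, h⟩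
  rw [outwardNormal, dif_pos hex, hex.choose_spec.unit_gradient_eq h]

theorem gradOn_dotProduct (Ω : Set E3) (f : E3 → ℝ) (z n : E3) :
    gradOn Ω f z ⬝ᵥ n.ofLp = fderivWithin ℝ f (closure Ω) z n := by
  rw [gradOn, ← inner_gradientWithin_left, EuclideanSpace.inner_eq_star_dotProduct,
    dotProduct_comm]
  simp

/-- The boundary point lemma on a domain with smooth boundary: the normal derivative is positive at
a strict maximum point. -/
theorem normal_deriv_pos {Ω : Set E3} {z : E3}
    {g : E3 → ℝ} (hg : IsLocalDefiningFunction Ω z g) (hz : z ∈ closure Ω) {f : E3 → ℝ}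
    (hd : DifferentiableOn ℝ f (closure Ω)) (hharm : InnerProductSpace.HarmonicOnNhd f Ω)
    (hlt : ∀ x ∈ Ω, f x < f z) (hle : ∀ x ∈ closure Ω, f x ≤ f z) :
    0 < gradOn Ω f z ⬝ᵥ outwardNormal Ω z := by
  obtain ⟨R, hR, hball⟩ := hg.exists_ball_subset
  rw [hg.outwardNormal_eq, gradOn_dotProduct]
  have hG : 0 < ‖gradient g z‖ := norm_pos_iff.2 hg.2.2.1
  set n := ‖gradient g z‖⁻¹ • gradient g z with hn
  have hn1 : ‖n‖ = 1 := by rw [hn, norm_smul, norm_inv, norm_norm, inv_mul_cancel₀ hG.ne']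
  have hcl : Metric.closedBall (z - R • n) R ⊆ closure Ω := by
    rw [← closure_ball _ hR.ne']
    exact closure_mono hball
  have hzn : z - (z - R • n) = R • n := by abel
  have := hopf_deriv_pos hR (hd.continuousOn.mono hcl) (fun x hx => hharm x (hball hx))
    (fun x hx => hlt x (hball hx)) (fun x hx => hle x (hcl hx))
    (by rw [dist_eq_norm, hzn, norm_smul, hn1, Real.norm_eq_abs, abs_of_pos hR, mul_one])
    rfl hcl (hd z hz).hasFDerivWithinAt
  rw [hzn, map_smul, smul_eq_mul] at this
  exact (pos_iff_pos_of_mul_pos this).1 hR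

theorem isExteriorHarmonic_of_decay {Ω : Set E3} (ho : IsOpen Ω)
    (hcompl : Bornology.IsBounded Ωᶜ) {f : E3 → ℝ}
    (hharm : InnerProductSpace.HarmonicOnNhd f Ω)
    (hdec : Tendsto (gradOn Ω f) (Bornology.cobounded E3 ⊓ 𝓟 Ω) (𝓝 0)) :
    ∃ R, (∀ x, R ≤ ‖x‖ → x ∈ Ω) ∧ IsExteriorHarmonic R f := by
  obtain ⟨r, hr⟩ := hcompl.exists_norm_le
  have hmem : ∀ x, max r 0 + 1 ≤ ‖x‖ → x ∈ Ω := fun x hx => by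
    by_contra hcon
    have := hr x hcon
    linarith [le_max_left r 0]
  refine ⟨max r 0 + 1, hmem, by positivity, fun x hx => hharm x (hmem x hx), fun δ hδ => ?_⟩
  have hΩ : Ω ∈ Bornology.cobounded E3 := by
    rw [← compl_compl Ω]; exact hcompl
  rw [inf_eq_left.2 (le_principal_iff.2 hΩ)] at hdec
  have h1 : Tendsto (fun x => ‖gradientWithin f (closure Ω) x‖) (Bornology.cobounded E3) (𝓝 0) := by
    have := ((PiLp.continuous_toLp 2 (fun _ : Fin 3 => ℝ)).tendsto 0).comp hdec
    simpa [gradOn, Function.comp_def] using this.norm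
  have h2 := (h1.eventually_le_const hδ).and hΩ
  rw [← comap_norm_atTop] at h2
  obtain ⟨s, hs, hs2⟩ := mem_comap.1 h2
  obtain ⟨ρ, hρ⟩ := mem_atTop_sets.1 hs
  refine ⟨ρ, fun x hx => ?_⟩
  obtain ⟨h3, h4⟩ := hs2 (show x ∈ norm ⁻¹' s from hρ _ hx)
  have h5 : fderivWithin ℝ f (closure Ω) x = fderiv ℝ f x :=
    fderivWithin_of_mem_nhds (mem_of_superset (ho.mem_nhds h4) subset_closure)
  rw [gradientWithin, h5] at h3
  simpa using h3

theorem uniqueDiffOn_closure_of_smoothBoundary {Ω : Set E3} (ho : IsOpen Ω)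
    (hb : HasSmoothBoundary Ω) : UniqueDiffOn ℝ (closure Ω) := by
  intro z hz
  by_cases hzΩ : z ∈ Ω
  · exact (ho.uniqueDiffWithinAt hzΩ).mono subset_closure
  obtain ⟨g, hg⟩ := hb z (by rw [ho.frontier_eq]; exact ⟨hz, hzΩ⟩)
  obtain ⟨R, hR, hball⟩ := hg.exists_ball_subset
  have hG : 0 < ‖gradient g z‖ := norm_pos_iff.2 hg.2.2.1
  have hcl := closure_mono hball
  rw [closure_ball _ hR.ne'] at hcl
  refine (uniqueDiffWithinAt_convex (convex_closedBall _ _) ?_ ?_).mono hcl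
  · rw [interior_closedBall _ hR.ne']
    exact ⟨_, Metric.mem_ball_self hR⟩
  · refine subset_closure ?_
    rw [Metric.mem_closedBall, dist_eq_norm, sub_sub_cancel, norm_smul, norm_smul, norm_inv,
      norm_norm, inv_mul_cancel₀ hG.ne', Real.norm_eq_abs, abs_of_pos hR, mul_one]

theorem le_limit_of_neumann_zero {Ω : Set E3} (ho : IsOpen Ω) (hc : IsPreconnected Ω)
    (hb : HasSmoothBoundary Ω) {R : ℝ} (hR : ∀ x, R ≤ ‖x‖ → x ∈ Ω) {f : E3 → ℝ} {c : ℝ}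
    (hd : DifferentiableOn ℝ f (closure Ω)) (hharm : InnerProductSpace.HarmonicOnNhd f Ω)
    (hbdry : ∀ y ∈ frontier Ω, gradOn Ω f y ⬝ᵥ outwardNormal Ω y = 0)
    (hlim : Tendsto f (Bornology.cobounded E3) (𝓝 c)) : ∀ x ∈ closure Ω, f x ≤ c := by
  by_contra! hcon
  obtain ⟨x₀, hx₀, hlt⟩ := hcon
  have h2 := hlim.eventually_lt_const hlt
  rw [← comap_norm_atTop] at h2
  obtain ⟨s, hs, hs2⟩ := mem_comap.1 h2
  obtain ⟨ρ, hρ⟩ := mem_atTop_sets.1 hs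
  have hfar : ∀ x, ρ ≤ ‖x‖ → f x < f x₀ := fun x hx => hs2 (show x ∈ norm ⁻¹' s from hρ _ hx)
  have hx₀ρ : ‖x₀‖ ≤ ρ := by
    by_contra! h
    exact lt_irrefl _ (hfar x₀ h.le)
  obtain ⟨z, hz, hmax⟩ := ((isCompact_closedBall (0 : E3) ρ).inter_left
    isClosed_closure).exists_isMaxOn ⟨x₀, hx₀, mem_closedBall_zero_iff.2 hx₀ρ⟩
    (hd.continuousOn.mono inter_subset_left)
  have hzx₀ : f x₀ ≤ f z := hmax ⟨hx₀, mem_closedBall_zero_iff.2 hx₀ρ⟩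
  have hle : ∀ x ∈ closure Ω, f x ≤ f z := fun x hx => by
    rcases le_total ‖x‖ ρ with h | h
    · exact hmax ⟨hx, mem_closedBall_zero_iff.2 h⟩
    · exact (hfar x h).le.trans hzx₀
  by_cases hex : ∃ w ∈ Ω, f w = f z
  · obtain ⟨w, hw, hwz⟩ := hex
    have hconst := eqOn_of_isMaxOn_of_harmonic ho hc hharm hw
      fun x hx => hwz ▸ hle x (subset_closure hx)
    obtain ⟨e, he, -, -⟩ := exists_unit_orthogonal 0 0
    have hn : ‖(max 0 (max R ρ)) • e‖ = max 0 (max R ρ) := by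
      rw [norm_smul, he, Real.norm_eq_abs, abs_of_nonneg (le_max_left _ _), mul_one]
    have h3 := hconst _ (hR _ (by
      rw [hn]; exact (le_max_left R ρ).trans (le_max_right _ _)))
    have h4 := hfar _ (by
      rw [hn]; exact (le_max_right R ρ).trans (le_max_right _ _))
    linarith
  · push Not at hex
    have hzf : z ∈ frontier Ω := by
      rw [ho.frontier_eq]
      exact ⟨hz.1, fun h => hex z h rfl⟩
    obtain ⟨g, hg⟩ := hb z hzf
    have := normal_deriv_pos hg hz.1 hd hharm
      (fun x hx => lt_of_le_of_ne (hle x (subset_closure hx)) (hex x hx)) hle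
    rw [hbdry z hzf] at this
    exact lt_irrefl _ this

theorem gradOn_neg {Ω : Set E3} (f : E3 → ℝ) {y : E3}
    (hy : UniqueDiffWithinAt ℝ (closure Ω) y) : gradOn Ω (-f) y = -gradOn Ω f y := by
  simp [gradOn, gradientWithin, fderivWithin_neg hy]

/-- Uniqueness in the exterior Neumann problem. -/
theorem gradOn_eq_zero_of_neumann_zero {Ω : Set E3} (ho : IsOpen Ω) (hc : IsPreconnected Ω)
    (hb : HasSmoothBoundary Ω) (hcompl : Bornology.IsBounded Ωᶜ) {f : E3 → ℝ}
    (hd : DifferentiableOn ℝ f (closure Ω)) (hharm : InnerProductSpace.HarmonicOnNhd f Ω)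
    (hbdry : ∀ y ∈ frontier Ω, gradOn Ω f y ⬝ᵥ outwardNormal Ω y = 0)
    (hdec : Tendsto (gradOn Ω f) (Bornology.cobounded E3 ⊓ 𝓟 Ω) (𝓝 0)) :
    ∀ y ∈ closure Ω, gradOn Ω f y = 0 := by
  obtain ⟨R, hR, hext⟩ := isExteriorHarmonic_of_decay ho hcompl hharm hdec
  obtain ⟨c, hlim⟩ := hext.exists_tendsto
  have h1 := le_limit_of_neumann_zero ho hc hb hR hd hharm hbdry hlim
  have h2 := le_limit_of_neumann_zero (f := -f) ho hc hb hR hd.neg hharm.neg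
    (fun y hy => by
      rw [gradOn_neg f (uniqueDiffOn_closure_of_smoothBoundary ho hb y hy.1), neg_dotProduct,
        hbdry y hy, neg_zero]) hlim.neg
  have heq : EqOn f (fun _ => c) (closure Ω) := fun x hx =>
    le_antisymm (h1 x hx) (neg_le_neg_iff.1 (h2 x hx))
  intro y hy
  have : fderivWithin ℝ f (closure Ω) y = 0 := by
    rw [fderivWithin_congr heq (heq hy)]
    simp
  simp [gradOn, gradientWithin, this]

end Boundary

section Equivariance

variable {Ω : Set E3} {S : E3 ≃ₗᵢ[ℝ] E3}

theorem inner_map_of_involutive (hS : Function.Involutive S) (x y : E3) :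
    ⟪S x, y⟫ = ⟪x, S y⟫ := by
  rw [← S.inner_map_map x (S y), hS y]

theorem preimage_eq_of_image_eq (hS : Function.Involutive S) {s : Set E3} (h : S '' s = s) :
    S ⁻¹' s = s := by
  rw [← hS.image_eq_preimage_symm, h]

theorem image_closure_eq (h : S '' Ω = Ω) : S '' closure Ω = closure Ω := by
  have := S.toHomeomorph.image_closure Ω
  simp only [LinearIsometryEquiv.coe_toHomeomorph] at this
  rw [this, h]

theorem image_frontier_eq (h : S '' Ω = Ω) : S '' frontier Ω = frontier Ω := by
  have := S.toHomeomorph.image_frontier Ω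
  simp only [LinearIsometryEquiv.coe_toHomeomorph] at this
  rw [this, h]

theorem fderiv_comp_isometry (g : E3 → ℝ) (z v : E3) (hg : DifferentiableAt ℝ g (S z)) :
    fderiv ℝ (g ∘ S) z v = fderiv ℝ g (S z) (S v) := by
  have h1 : HasFDerivAt S S.toContinuousLinearEquiv.toContinuousLinearMap z :=
    S.toContinuousLinearEquiv.hasFDerivAt
  rw [(hg.hasFDerivAt.comp z h1).fderiv]
  rfl

theorem IsLocalDefiningFunction.comp_involution (hS : Function.Involutive S) (hΩ : S '' Ω = Ω)
    {z : E3} {g : E3 → ℝ} (h : IsLocalDefiningFunction Ω z g) :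
    IsLocalDefiningFunction Ω (S z) (g ∘ S) ∧
      gradient (g ∘ S) (S z) = S (gradient g z) := by
  have hgrad : gradient (g ∘ S) (S z) = S (gradient g z) := by
    refine ext_inner_right ℝ fun v => ?_
    rw [inner_gradient_left, fderiv_comp_isometry _ _ _ ((h.1.differentiable (by simp)) _),
      inner_map_of_involutive hS, inner_gradient_left, hS z]
  refine ⟨⟨h.1.comp S.contDiff, ?_, ?_, ?_⟩, hgrad⟩
  · simp [hS z, h.2.1]
  · rw [hgrad]
    simpa using h.2.2.1
  · have ht : Tendsto S (𝓝 (S z)) (𝓝 z) := by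
      simpa [hS z] using S.continuous.tendsto (S z)
    filter_upwards [ht.eventually h.2.2.2] with y hy
    rw [Function.comp_apply, ← hy, ← mem_preimage, preimage_eq_of_image_eq hS hΩ]

theorem outwardNormal_comp_involution (hS : Function.Involutive S) (hΩ : S '' Ω = Ω)
    (hb : HasSmoothBoundary Ω) {z : E3} (hz : z ∈ frontier Ω) :
    outwardNormal Ω (S z) = (S (WithLp.toLp 2 (outwardNormal Ω z))).ofLp := by
  obtain ⟨g, hg⟩ := hb z hz
  obtain ⟨h1, h2⟩ := hg.comp_involution hS hΩ
  rw [hg.outwardNormal_eq, h1.outwardNormal_eq, h2, S.norm_map]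
  simp

theorem gradOn_comp_involution (hS : Function.Involutive S) (hΩ : S '' Ω = Ω) (f : E3 → ℝ)
    {y : E3} (hy : UniqueDiffWithinAt ℝ (closure Ω) y) :
    gradOn Ω (f ∘ S) y = (S (WithLp.toLp 2 (gradOn Ω f (S y)))).ofLp := by
  have hpre : S.toContinuousLinearEquiv ⁻¹' closure Ω = closure Ω :=
    preimage_eq_of_image_eq hS (image_closure_eq hΩ)
  have h1 := S.toContinuousLinearEquiv.comp_right_fderivWithin (f := f) (s := closure Ω) (x := y)
    (by rw [hpre]; exact hy)
  rw [hpre] at h1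
  have h2 : gradientWithin (f ∘ S) (closure Ω) y = S (gradientWithin f (closure Ω) (S y)) := by
    refine ext_inner_right ℝ fun v => ?_
    rw [inner_gradientWithin_left, inner_map_of_involutive hS, inner_gradientWithin_left]
    exact congrArg (fun l : E3 →L[ℝ] ℝ => l v) h1
  simp [gradOn, h2]

theorem tendsto_cobounded_isometry (S : E3 ≃ₗᵢ[ℝ] E3) :
    Tendsto S (Bornology.cobounded E3) (Bornology.cobounded E3) := by
  rw [← tendsto_norm_atTop_iff_cobounded]
  simpa using tendsto_norm_cobounded_atTop

theorem dotProduct_eq_inner (a b : Fin 3 → ℝ) :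
    a ⬝ᵥ b = ⟪(WithLp.toLp 2 a : E3), (WithLp.toLp 2 b : E3)⟫ := by
  rw [EuclideanSpace.inner_eq_star_dotProduct, dotProduct_comm]
  simp

theorem isNeumannSolution_gradOn_comp (hS : Function.Involutive S) (hΩ : S '' Ω = Ω)
    (ho : IsOpen Ω) (hc : IsPreconnected Ω) (hb : HasSmoothBoundary Ω)
    (hcompl : Bornology.IsBounded Ωᶜ) {f g : E3 → ℝ} (hf : IsNeumannSolution Ω g f) {a : ℝ}
    (ha : a * a = 1) (hg : ∀ y ∈ frontier Ω, g (S y) = a * g y) {y : E3} (hy : y ∈ closure Ω) :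
    gradOn Ω f (S y) = a • (S (WithLp.toLp 2 (gradOn Ω f y))).ofLp := by
  have hu := uniqueDiffOn_closure_of_smoothBoundary ho hb
  have hd : DifferentiableOn ℝ f (closure Ω) := hf.smooth.differentiableOn (by simp)
  have hmaps : MapsTo S (closure Ω) (closure Ω) := fun x hx => by
    rw [← image_closure_eq hΩ]; exact mem_image_of_mem _ hx
  have hmapsΩ : MapsTo S Ω Ω := fun x hx => by
    rw [← hΩ]; exact mem_image_of_mem _ hx
  have hdS : DifferentiableOn ℝ (f ∘ S) (closure Ω) :=
    hd.comp S.toContinuousLinearEquiv.differentiable.differentiableOn hmaps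
  have hgrad : ∀ x ∈ closure Ω, gradOn Ω (f - a • (f ∘ S)) x
      = gradOn Ω f x - a • (S (WithLp.toLp 2 (gradOn Ω f (S x)))).ofLp := by
    intro x hx
    rw [← gradOn_comp_involution hS hΩ f (hu x hx)]
    have h1 : DifferentiableWithinAt ℝ (a • (f ∘ S)) (closure Ω) x := (hdS x hx).const_smul a
    simp only [gradOn, gradientWithin]
    rw [fderivWithin_sub (hu x hx) (hd x hx) h1,
      fderivWithin_const_smul (hu x hx) (hdS x hx) a]
    simp
  have hzero := gradOn_eq_zero_of_neumann_zero (f := f - a • (f ∘ S)) ho hc hb hcompl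
    (hd.sub (hdS.const_smul a))
    (fun x hx => (hf.harmonic x hx).sub
      (harmonicAt_comp_linearIsometryEquiv S (hf.harmonic _ (hmapsΩ hx))).const_smul) ?_ ?_
  · have h := hzero (S y) (hmaps hy)
    rw [hgrad _ (hmaps hy), hS y] at h
    exact sub_eq_zero.1 h
  · intro z hz
    have hSz : S z ∈ frontier Ω := by
      rw [← image_frontier_eq hΩ]; exact mem_image_of_mem _ hz
    have h1 : (S (WithLp.toLp 2 (gradOn Ω f (S z)))).ofLp ⬝ᵥ outwardNormal Ω z = a * g z := by
      rw [← hg z hz, ← hf.boundary _ hSz, outwardNormal_comp_involution hS hΩ hb hz,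
        dotProduct_eq_inner, dotProduct_eq_inner]
      simp only [WithLp.toLp_ofLp]
      rw [inner_map_of_involutive hS]
    rw [hgrad z hz.1, sub_dotProduct, smul_dotProduct, h1, hf.boundary z hz, smul_eq_mul,
      ← mul_assoc, ha, one_mul, sub_self]
  · have h1 : Tendsto S (Bornology.cobounded E3 ⊓ 𝓟 Ω) (Bornology.cobounded E3 ⊓ 𝓟 Ω) :=
      (tendsto_cobounded_isometry S).inf (tendsto_principal_principal.2 hmapsΩ)
    have hcont : Continuous fun v : Fin 3 → ℝ => a • (S (WithLp.toLp 2 v)).ofLp := by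
      have := PiLp.continuous_toLp 2 (fun _ : Fin 3 => ℝ)
      have h2 := PiLp.continuous_ofLp 2 (fun _ : Fin 3 => ℝ)
      exact (h2.comp (S.continuous.comp this)).const_smul a
    have h2 := hf.decay.sub ((hcont.tendsto 0).comp (hf.decay.comp h1))
    have h3 : (0 : Fin 3 → ℝ) - a • (S (WithLp.toLp 2 0)).ofLp = 0 := by simp
    rw [h3] at h2
    refine h2.congr' ?_
    filter_upwards [mem_inf_of_right (mem_principal_self Ω)] with x hx
    rw [hgrad x (subset_closure hx)]
    rfl

theorem neumannPotential_gradOn_comp (hS : Function.Involutive S) (hΩ : S '' Ω = Ω)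
    (ho : IsOpen Ω) (hc : IsPreconnected Ω) (hb : HasSmoothBoundary Ω)
    (hcompl : Bornology.IsBounded Ωᶜ) {g : E3 → ℝ} {a : ℝ}
    (ha : a * a = 1) (hg : ∀ y ∈ frontier Ω, g (S y) = a * g y) {y : E3} (hy : y ∈ closure Ω) :
    gradOn Ω (neumannPotential Ω g) (S y)
      = a • (S (WithLp.toLp 2 (gradOn Ω (neumannPotential Ω g) y))).ofLp := by
  by_cases h : ∃ f : E3 → ℝ, IsNeumannSolution Ω g f
  · rw [neumannPotential, dif_pos h]
    exact isNeumannSolution_gradOn_comp hS hΩ ho hc hb hcompl h.choose_spec ha hg hy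
  · rw [neumannPotential, dif_neg h]
    have : ∀ x, gradOn Ω 0 x = 0 := fun x => by
      simp [gradOn, gradientWithin]
    simp [this]

theorem setIntegral_eq_zero_of_odd (hS : Function.Involutive S) {μ : Measure E3}
    (hμ : MeasurePreserving S μ μ) {s : Set E3} (hs : MeasurableSet s) (hsS : S '' s = s)
    {F : E3 → ℝ} (hF : ∀ y ∈ s, F (S y) = -F y) : ∫ y in s, F y ∂μ = 0 := by
  have h1 := hμ.setIntegral_preimage_emb S.toHomeomorph.measurableEmbedding F s
  rw [preimage_eq_of_image_eq hS hsS, setIntegral_congr_fun hs hF, integral_neg] at h1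
  linarith

end Equivariance

section PlaneReflection

/-- The reflection `planeReflection p` as a linear isometry. -/
noncomputable def planeReflectionEquiv (p : Fin 3) : E3 ≃ₗᵢ[ℝ] E3 :=
  (ℝ ∙ (EuclideanSpace.single p (1 : ℝ) : E3))ᗮ.reflection

theorem planeReflectionEquiv_apply (p : Fin 3) (y : E3) :
    planeReflectionEquiv p y = planeReflection p y := by
  rw [planeReflectionEquiv, reflection_orthogonal_unit_apply (by simp), planeReflection]
  simp [EuclideanSpace.inner_single_right]

theorem involutive_planeReflectionEquiv (p : Fin 3) :
    Function.Involutive (planeReflectionEquiv p) :=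
  Submodule.reflection_involutive _

/-- The sign by which `planeReflection p` acts on the `i`-th coordinate. -/
def reflectionSign (p i : Fin 3) : ℝ := if i = p then -1 else 1

theorem reflectionSign_mul_self (p i : Fin 3) : reflectionSign p i * reflectionSign p i = 1 := by
  unfold reflectionSign; split_ifs <;> norm_num

theorem planeReflectionEquiv_coord (p : Fin 3) (y : E3) (i : Fin 3) :
    (planeReflectionEquiv p y) i = reflectionSign p i * y i := by
  rw [planeReflectionEquiv_apply, planeReflection, reflectionSign]
  by_cases h : i = p
  · subst h; simp; ring
  · simp [h]

theorem crossProduct_reflectionSign (p : Fin 3) {a b a' b' : Fin 3 → ℝ}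
    (ha : ∀ i, a' i = reflectionSign p i * a i) (c : ℝ)
    (hb : ∀ i, b' i = c * reflectionSign p i * b i)
    (i : Fin 3) :
    crossProduct a' b' i = -(c * reflectionSign p i * crossProduct a b i) := by
  simp only [cross_apply, ha, hb, reflectionSign]
  fin_cases p <;> fin_cases i <;> simp <;> ring

end PlaneReflection

namespace Vehicle

variable {m : ℕ} (V : Vehicle m)

theorem isOpen_exterior : IsOpen V.exterior := V.isCompact_body.isClosed.isOpen_compl

theorem isBounded_compl_exterior : Bornology.IsBounded V.exteriorᶜ := by
  rw [exterior, compl_compl]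
  exact V.isCompact_body.isBounded

variable {V}

theorem image_exterior {p : Fin 3} (hp : planeReflection p '' V.exterior = V.exterior) :
    planeReflectionEquiv p '' V.exterior = V.exterior := by
  have : ⇑(planeReflectionEquiv p) = planeReflection p := funext (planeReflectionEquiv_apply p)
  rw [this, hp]

theorem normal_reflection {p : Fin 3} (hp : planeReflection p '' V.exterior = V.exterior)
    {y : E3} (hy : y ∈ frontier V.exterior) (i : Fin 3) :
    V.normal (planeReflectionEquiv p y) i = reflectionSign p i * V.normal y i := by
  rw [normal, outwardNormal_comp_involution (involutive_planeReflectionEquiv p)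
    (image_exterior hp) V.smooth_exterior hy, planeReflectionEquiv_coord]
  rfl

theorem potential_reflection {p : Fin 3} (hp : planeReflection p '' V.exterior = V.exterior)
    {g : E3 → ℝ} {a : ℝ} (ha : a * a = 1)
    (hg : ∀ y ∈ frontier V.exterior, g (planeReflectionEquiv p y) = a * g y)
    {y : E3} (hy : y ∈ closure V.exterior) (k : Fin 3) :
    gradOn V.exterior (neumannPotential V.exterior g) (planeReflectionEquiv p y) k
      = a * reflectionSign p k * gradOn V.exterior (neumannPotential V.exterior g) y k := by
  rw [neumannPotential_gradOn_comp (involutive_planeReflectionEquiv p)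
    (image_exterior hp) V.isOpen_exterior V.isConnected_exterior.isPreconnected
    V.smooth_exterior V.isBounded_compl_exterior ha hg hy, Pi.smul_apply,
    planeReflectionEquiv_coord, smul_eq_mul, mul_assoc]

theorem gradPhi_reflection {p : Fin 3} (hp : planeReflection p '' V.exterior = V.exterior)
    (i : Fin 3) {y : E3} (hy : y ∈ closure V.exterior) (k : Fin 3) :
    V.gradPhi i (planeReflectionEquiv p y) k
      = reflectionSign p i * reflectionSign p k * V.gradPhi i y k :=
  potential_reflection hp (reflectionSign_mul_self p i)
    (fun _ hz => normal_reflection hp hz i) hy k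

theorem gradVarphi_reflection {p : Fin 3} (hp : planeReflection p '' V.exterior = V.exterior)
    (i : Fin 3) {y : E3} (hy : y ∈ closure V.exterior) (k : Fin 3) :
    V.gradVarphi i (planeReflectionEquiv p y) k
      = -reflectionSign p i * reflectionSign p k * V.gradVarphi i y k := by
  refine potential_reflection hp (by rw [neg_mul_neg, reflectionSign_mul_self]) ?_ hy k
  intro z hz
  have := crossProduct_reflectionSign p (planeReflectionEquiv_coord p z) 1
    (b := V.normal z) (b' := V.normal (planeReflectionEquiv p z))
    (fun j => by rw [one_mul, normal_reflection hp hz j]) i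
  rw [this]
  ring

theorem gradPsi_reflection {p : Fin 3} (hp : planeReflection p '' V.exterior = V.exterior)
    {j : Fin m} (hχ : ∀ y ∈ frontier V.exterior, V.flow j (planeReflection p y) = V.flow j y)
    {y : E3} (hy : y ∈ closure V.exterior) (k : Fin 3) :
    V.gradPsi j (planeReflectionEquiv p y) k = reflectionSign p k * V.gradPsi j y k := by
  have := potential_reflection hp (g := V.flow j) (one_mul (1 : ℝ))
    (fun z hz => by rw [planeReflectionEquiv_apply, hχ z hz, one_mul]) hy k
  rwa [one_mul] at this

theorem integral_exterior_eq_zero {p : Fin 3} (hp : planeReflection p '' V.exterior = V.exterior)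
    {u v : E3 → Fin 3 → ℝ} {a b : ℝ} (hab : a * b = -1)
    (hu : ∀ y ∈ closure V.exterior, ∀ k,
      u (planeReflectionEquiv p y) k = a * reflectionSign p k * u y k)
    (hv : ∀ y ∈ closure V.exterior, ∀ k,
      v (planeReflectionEquiv p y) k = b * reflectionSign p k * v y k) :
    ∫ y in V.exterior, u y ⬝ᵥ v y = 0 := by
  refine setIntegral_eq_zero_of_odd (involutive_planeReflectionEquiv p)
    (planeReflectionEquiv p).measurePreserving V.isOpen_exterior.measurableSet
    (image_exterior hp) fun y hy => ?_
  rw [dotProduct, dotProduct, ← Finset.sum_neg_distrib]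
  refine Finset.sum_congr rfl fun k _ => ?_
  rw [hu y (subset_closure hy), hv y (subset_closure hy)]
  linear_combination (reflectionSign p k * reflectionSign p k * u y k * v y k) * hab
    - u y k * v y k * reflectionSign_mul_self p k

theorem boundaryIntegral_eq_zero {p : Fin 3} (hp : planeReflection p '' V.exterior = V.exterior)
    {F : E3 → ℝ} (hF : ∀ y ∈ frontier V.exterior, F (planeReflectionEquiv p y) = -F y) :
    boundaryIntegral V.exterior F = 0 :=
  setIntegral_eq_zero_of_odd (involutive_planeReflectionEquiv p)
    ((planeReflectionEquiv p).toIsometryEquiv.measurePreserving_euclideanHausdorffMeasure 2)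
    isClosed_frontier.measurableSet (image_frontier_eq (image_exterior hp)) hF

theorem boundaryIntegral_coord_eq_zero {p : Fin 3}
    (hp : planeReflection p '' V.exterior = V.exterior)
    {j : Fin m} (hχ : ∀ y ∈ frontier V.exterior, V.flow j (planeReflection p y) = V.flow j y)
    {u : E3 → Fin 3 → ℝ} {i : Fin 3} {a : ℝ} (ha : a * reflectionSign p i = -1)
    (hu : ∀ y ∈ closure V.exterior, ∀ k,
      u (planeReflectionEquiv p y) k = a * reflectionSign p k * u y k) :
    boundaryIntegral V.exterior (fun y => u y i * V.flow j y) = 0 :=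
  boundaryIntegral_eq_zero hp fun y hy => by
    rw [hu y hy.1, planeReflectionEquiv_apply, hχ y hy, ha]
    ring

theorem boundaryIntegral_cross_eq_zero {p : Fin 3}
    (hp : planeReflection p '' V.exterior = V.exterior)
    {j : Fin m} (hχ : ∀ y ∈ frontier V.exterior, V.flow j (planeReflection p y) = V.flow j y)
    {u : E3 → Fin 3 → ℝ} {i : Fin 3} {a : ℝ} (ha : a * reflectionSign p i = 1)
    (hu : ∀ y ∈ closure V.exterior, ∀ k,
      u (planeReflectionEquiv p y) k = a * reflectionSign p k * u y k) :
    boundaryIntegral V.exterior (fun y => crossProduct y.ofLp (u y) i * V.flow j y) = 0 :=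
  boundaryIntegral_eq_zero hp fun y hy => by
    rw [crossProduct_reflectionSign p (planeReflectionEquiv_coord p y) a (hu y hy.1), ha,
      planeReflectionEquiv_apply, hχ y hy]
    ring

/-- The body is symmetric with respect to the planes `{y_2 = 0}` and `{y_3 = 0}`. -/
def IsSymmetric (V : Vehicle m) : Prop :=
  ∀ p : Fin 3, p = 1 ∨ p = 2 → planeReflection p '' V.exterior = V.exterior

/-- The flow profile `χ_j` is symmetric with respect to the planes `{y_2 = 0}` and `{y_3 = 0}`. -/
def IsSymmetricFlow (V : Vehicle m) (j : Fin m) : Prop :=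
  ∀ p : Fin 3, p = 1 ∨ p = 2 → ∀ y ∈ frontier V.exterior,
    V.flow j (planeReflection p y) = V.flow j y

theorem exists_reflectionSign_eq_neg_one {i : Fin 3} (hi : i ≠ 0) :
    ∃ p : Fin 3, (p = 1 ∨ p = 2) ∧ reflectionSign p i = -1 ∧ reflectionSign p 0 = 1 := by
  refine ⟨i, ?_, by simp [reflectionSign], by simp [reflectionSign, hi.symm]⟩
  fin_cases i <;> simp_all

theorem exists_reflectionSign_eq_one (i : Fin 3) :
    ∃ p : Fin 3, (p = 1 ∨ p = 2) ∧ reflectionSign p i = 1 ∧ reflectionSign p 0 = 1 := by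
  by_cases h : i = 1
  · exact ⟨2, Or.inr rfl, by simp [reflectionSign, h], by simp [reflectionSign]⟩
  · exact ⟨1, Or.inl rfl, by simp [reflectionSign, h], by simp [reflectionSign]⟩

theorem matM_eq_zero (h : V.IsSymmetric) {i : Fin 3} (hi : i ≠ 0) : V.matM i 0 = 0 := by
  obtain ⟨p, hp, h1, h2⟩ := exists_reflectionSign_eq_neg_one hi
  exact integral_exterior_eq_zero (h p hp) (by rw [h1, h2]; norm_num)
    (fun _ hy => gradPhi_reflection (h p hp) i hy) (fun _ hy => gradPhi_reflection (h p hp) 0 hy)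

theorem matN_eq_zero (h : V.IsSymmetric) (i : Fin 3) : V.matN 0 i = 0 := by
  obtain ⟨p, hp, h1, h2⟩ := exists_reflectionSign_eq_one i
  exact integral_exterior_eq_zero (h p hp) (by rw [h1, h2]; norm_num)
    (fun _ hy => gradPhi_reflection (h p hp) 0 hy)
    (fun _ hy => gradVarphi_reflection (h p hp) i hy)

theorem matCM_eq_zero (h : V.IsSymmetric) {j : Fin m} (hχ : V.IsSymmetricFlow j) {i : Fin 3}
    (hi : i ≠ 0) : V.matCM i j = 0 := by
  obtain ⟨p, hp, h1, -⟩ := exists_reflectionSign_eq_neg_one hi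
  exact integral_exterior_eq_zero (h p hp) (b := 1) (by rw [h1]; norm_num)
    (fun _ hy => gradPhi_reflection (h p hp) i hy)
    (fun _ hy k => by rw [one_mul]; exact gradPsi_reflection (h p hp) (hχ p hp) hy k)

theorem matCJ_eq_zero (h : V.IsSymmetric) {j : Fin m} (hχ : V.IsSymmetricFlow j) (i : Fin 3) :
    V.matCJ i j = 0 := by
  obtain ⟨p, hp, h1, -⟩ := exists_reflectionSign_eq_one i
  exact integral_exterior_eq_zero (h p hp) (b := 1) (by rw [h1]; norm_num)
    (fun _ hy => gradVarphi_reflection (h p hp) i hy)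
    (fun _ hy k => by rw [one_mul]; exact gradPsi_reflection (h p hp) (hχ p hp) hy k)

theorem matLM_eq_zero (h : V.IsSymmetric) {j : Fin m} (hχ : V.IsSymmetricFlow j) {i : Fin 3}
    (hi : i ≠ 0) : V.matLM j i 0 = 0 := by
  obtain ⟨p, hp, h1, h2⟩ := exists_reflectionSign_eq_neg_one hi
  exact boundaryIntegral_coord_eq_zero (h p hp) (hχ p hp) (by rw [h1, h2]; norm_num)
    (fun _ hy => gradPhi_reflection (h p hp) 0 hy)

theorem matLJ_eq_zero (h : V.IsSymmetric) {j : Fin m} (hχ : V.IsSymmetricFlow j) (i : Fin 3) :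
    V.matLJ j i 0 = 0 := by
  obtain ⟨p, hp, h1, h2⟩ := exists_reflectionSign_eq_one i
  exact boundaryIntegral_cross_eq_zero (h p hp) (hχ p hp) (by rw [h1, h2]; norm_num)
    (fun _ hy => gradPhi_reflection (h p hp) 0 hy)

theorem matWM_eq_zero (h : V.IsSymmetric) {j : Fin m} (hχ : V.IsSymmetricFlow j) {i : Fin 3}
    (hi : i ≠ 0) : V.matWM j i j = 0 := by
  obtain ⟨p, hp, h1, -⟩ := exists_reflectionSign_eq_neg_one hi
  exact boundaryIntegral_coord_eq_zero (h p hp) (hχ p hp) (a := 1) (by rw [h1]; norm_num)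
    (fun _ hy k => by rw [one_mul]; exact gradPsi_reflection (h p hp) (hχ p hp) hy k)

theorem matWJ_eq_zero (h : V.IsSymmetric) {j : Fin m} (hχ : V.IsSymmetricFlow j) (i : Fin 3) :
    V.matWJ j i j = 0 := by
  obtain ⟨p, hp, h1, -⟩ := exists_reflectionSign_eq_one i
  exact boundaryIntegral_cross_eq_zero (h p hp) (hχ p hp) (a := 1) (by rw [h1]; norm_num)
    (fun _ hy k => by rw [one_mul]; exact gradPsi_reflection (h p hp) (hχ p hp) hy k)

end Vehicle

end ExteriorNeumann

section Nemytskii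

variable {K E F : Type*} [TopologicalSpace K] [CompactSpace K]
  [NormedAddCommGroup E] [NormedSpace ℝ E] [NormedAddCommGroup F] [NormedSpace ℝ F]

/-- Pointwise application of a continuous family of continuous linear maps, as a bilinear map. -/
noncomputable def pointwiseBilin : C(K, E →L[ℝ] F) →ₗ[ℝ] C(K, E) →ₗ[ℝ] C(K, F) where
  toFun a :=
    { toFun := fun v => ⟨fun t => a t (v t), by fun_prop⟩
      map_add' := fun u v => by ext t; simp
      map_smul' := fun c v => by ext t; simp }
  map_add' a b := by ext v t; simp
  map_smul' c a := by ext v t; simp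

/-- Pointwise application of a continuous family of continuous linear maps. -/
noncomputable def pointwiseCLM :
    C(K, E →L[ℝ] F) →L[ℝ] (C(K, E) →L[ℝ] C(K, F)) :=
  LinearMap.mkContinuous₂ (𝕜 := ℝ) (𝕜₂ := ℝ) (𝕜₃ := ℝ) (E := C(K, E →L[ℝ] F)) (F := C(K, E))
    (G := C(K, F)) pointwiseBilin 1 fun a v => by
      refine (ContinuousMap.norm_le _ (by positivity)).2 fun t => ?_
      rw [one_mul]
      exact ((a t).le_opNorm _).trans
        (mul_le_mul (a.norm_coe_le_norm t) (v.norm_coe_le_norm t) (norm_nonneg _) (norm_nonneg a))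

@[simp] theorem pointwiseCLM_apply (a : C(K, E →L[ℝ] F)) (v : C(K, E)) (t : K) :
    pointwiseCLM a v t = a t (v t) := rfl

/-- The superposition operator `u ↦ g ∘ u` on continuous functions. -/
def superposition (g : C(E, F)) (u : C(K, E)) : C(K, F) := g.comp u

theorem hasFDerivAt_superposition {g : C(E, F)} (hg : ContDiff ℝ 1 g) (u : C(K, E)) :
    HasFDerivAt (superposition (K := K) g)
      (pointwiseCLM (superposition ⟨fderiv ℝ g, hg.continuous_fderiv (by simp)⟩ u)) u := by
  set g' : C(E, E →L[ℝ] F) := ⟨fderiv ℝ g, hg.continuous_fderiv (by simp)⟩ with hg'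
  have hcont : Continuous (superposition (K := K) g') := ContinuousMap.continuous_postcomp g'
  rw [hasFDerivAt_iff_isLittleO_nhds_zero, Asymptotics.isLittleO_iff]
  intro ε hε
  obtain ⟨δ, hδ, hball⟩ := Metric.continuous_iff.1 hcont u ε hε
  filter_upwards [Metric.ball_mem_nhds (0 : C(K, E)) hδ] with v hv
  rw [mem_ball_zero_iff] at hv
  refine (ContinuousMap.norm_le _ (by positivity)).2 fun t => ?_
  have hbound : ∀ y ∈ segment ℝ (u t) (u t + v t), ‖fderiv ℝ g y - fderiv ℝ g (u t)‖ ≤ ε := by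
    intro y hy
    rw [segment_eq_image'] at hy
    obtain ⟨s, hs, rfl⟩ := hy
    have h1 : dist (u + s • v) u < δ := by
      rw [dist_eq_norm, add_sub_cancel_left, norm_smul, Real.norm_eq_abs, abs_of_nonneg hs.1]
      nlinarith [hs.2, norm_nonneg v]
    have h2 := (ContinuousMap.dist_apply_le_dist t).trans (hball _ h1).le
    rw [dist_eq_norm] at h2
    simpa [superposition, hg'] using h2
  have h3 := (convex_segment (u t) (u t + v t)).norm_image_sub_le_of_norm_fderiv_le'
    (fun y _ => (hg.differentiable (by simp)) y) hbound (left_mem_segment ℝ _ _)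
    (right_mem_segment ℝ _ _)
  rw [add_sub_cancel_left] at h3
  exact h3.trans (mul_le_mul_of_nonneg_left (v.norm_coe_le_norm t) hε.le)

theorem contDiff_superposition {g : C(E, F)} (hg : ContDiff ℝ 1 g) :
    ContDiff ℝ 1 (superposition (K := K) g) := by
  rw [contDiff_one_iff_hasFDerivAt]
  exact ⟨_, pointwiseCLM.continuous.comp (ContinuousMap.continuous_postcomp _),
    hasFDerivAt_superposition hg⟩

end Nemytskii

section Volterra

variable {E : Type*} [NormedAddCommGroup E] {T : ℝ}

theorem continuous_extend (hT : 0 ≤ T) (f : C(Icc (0 : ℝ) T, E)) :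
    Continuous (IccExtend hT f) := f.continuous.Icc_extend'

theorem norm_extend_le (hT : 0 ≤ T) (f : C(Icc (0 : ℝ) T, E)) (s : ℝ) :
    ‖IccExtend hT f s‖ ≤ ‖f‖ := f.norm_coe_le_norm _

variable [NormedSpace ℝ E]

/-- The primitive vanishing at `0`, as an operator on `C([0, T])`. -/
noncomputable def primitiveCLM (hT : 0 ≤ T) : C(Icc (0 : ℝ) T, E) →L[ℝ] C(Icc (0 : ℝ) T, E) :=
  LinearMap.mkContinuous
    { toFun := fun f => ⟨fun t => ∫ s in (0 : ℝ)..t, IccExtend hT f s,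
        ((intervalIntegral.continuous_primitive
          (fun a b => (continuous_extend hT f).intervalIntegrable a b) 0).comp
          continuous_subtype_val)⟩
      map_add' := fun f g => by
        ext t
        simp only [ContinuousMap.coe_mk, ContinuousMap.add_apply]
        rw [← intervalIntegral.integral_add ((continuous_extend hT f).intervalIntegrable _ _)
          ((continuous_extend hT g).intervalIntegrable _ _)]
        rfl
      map_smul' := fun c f => by
        ext t
        simp only [ContinuousMap.coe_mk, ContinuousMap.smul_apply, RingHom.id_apply]
        rw [← intervalIntegral.integral_smul]
        rfl }
    T fun f => by
      refine (ContinuousMap.norm_le _ (by positivity)).2 fun t => ?_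
      refine (intervalIntegral.norm_integral_le_of_norm_le_const
        (fun s _ => norm_extend_le hT f s)).trans ?_
      rw [sub_zero, abs_of_nonneg t.2.1, mul_comm]
      exact mul_le_mul_of_nonneg_right t.2.2 (norm_nonneg _)

theorem primitiveCLM_apply (hT : 0 ≤ T) (f : C(Icc (0 : ℝ) T, E)) (t : Icc (0 : ℝ) T) :
    primitiveCLM hT f t = ∫ s in (0 : ℝ)..t, IccExtend hT f s := rfl

theorem norm_volterra_pow_le (hT : 0 ≤ T) (a : C(Icc (0 : ℝ) T, E →L[ℝ] E)) (n : ℕ)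
    (u : C(Icc (0 : ℝ) T, E)) (t : Icc (0 : ℝ) T) :
    ‖(((primitiveCLM hT).comp (pointwiseCLM a)) ^ n) u t‖
      ≤ (‖a‖ * t) ^ n / n.factorial * ‖u‖ := by
  induction n generalizing t with
  | zero => simpa using u.norm_coe_le_norm t
  | succ n ih =>
    rw [pow_succ']
    set v := (((primitiveCLM hT).comp (pointwiseCLM a)) ^ n) u with hv
    change ‖∫ s in (0 : ℝ)..t, IccExtend hT (pointwiseCLM a v) s‖ ≤ _
    have hb : ∀ s ∈ Ioc (0 : ℝ) t, ‖IccExtend hT (pointwiseCLM a v) s‖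
        ≤ ‖a‖ * ((‖a‖ * s) ^ n / n.factorial * ‖u‖) := by
      intro s hs
      have hsI : s ∈ Icc (0 : ℝ) T := ⟨hs.1.le, hs.2.trans t.2.2⟩
      rw [IccExtend_of_mem hT _ hsI, pointwiseCLM_apply]
      exact ((a _).le_opNorm _).trans (mul_le_mul (a.norm_coe_le_norm _) (ih ⟨s, hsI⟩)
        (norm_nonneg _) (norm_nonneg a))
    refine (intervalIntegral.norm_integral_le_of_norm_le t.2.1
      (Eventually.of_forall hb) (Continuous.intervalIntegrable (by fun_prop) _ _)).trans ?_
    have h1 : (fun s : ℝ => ‖a‖ * ((‖a‖ * s) ^ n / n.factorial * ‖u‖))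
        = fun s => (‖a‖ ^ (n + 1) / n.factorial * ‖u‖) * s ^ n := by
      ext s; rw [mul_pow, pow_succ]; ring
    rw [h1, intervalIntegral.integral_const_mul, integral_pow, Nat.factorial_succ]
    apply le_of_eq
    push_cast
    have : (n.factorial : ℝ) ≠ 0 := by exact_mod_cast n.factorial_ne_zero
    have : (n : ℝ) + 1 ≠ 0 := by positivity
    rw [mul_pow]
    field_simp
    simp

variable [CompleteSpace E]

theorem isUnit_one_sub_volterra (hT : 0 ≤ T) (a : C(Icc (0 : ℝ) T, E →L[ℝ] E)) :
    IsUnit (1 - (primitiveCLM hT).comp (pointwiseCLM a) :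
      C(Icc (0 : ℝ) T, E) →L[ℝ] C(Icc (0 : ℝ) T, E)) := by
  set V := (primitiveCLM hT).comp (pointwiseCLM a) with hV
  obtain ⟨n, hn⟩ := ((FloorSemiring.tendsto_pow_div_factorial_atTop (‖a‖ * T)).eventually_lt_const
    one_pos).exists
  have hnorm : ‖V ^ n‖ < 1 := by
    refine lt_of_le_of_lt (ContinuousLinearMap.opNorm_le_bound _ (by positivity) fun u => ?_) hn
    refine (ContinuousMap.norm_le _ (by positivity)).2 fun t => ?_
    refine (norm_volterra_pow_le hT a n u t).trans ?_
    have ht0 := t.2.1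
    have ht := t.2.2
    gcongr
  have hu := isUnit_one_sub_of_norm_lt_one
    (R := C(Icc (0 : ℝ) T, E) →L[ℝ] C(Icc (0 : ℝ) T, E)) hnorm
  rw [← mul_neg_geom_sum] at hu
  have hcomm : Commute (1 - V) (∑ i ∈ Finset.range n, V ^ i) := by
    refine Commute.sum_right _ _ _ fun i _ => ?_
    exact ((Commute.one_left _).sub_left ((Commute.refl V).pow_right i))
  exact (hcomm.isUnit_mul_iff.1 hu).1

theorem volterra_bijective (hT : 0 ≤ T) (a : C(Icc (0 : ℝ) T, E →L[ℝ] E)) :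
    Function.Bijective fun Y : C(Icc (0 : ℝ) T, E) => Y - primitiveCLM hT (pointwiseCLM a Y) := by
  obtain ⟨U, hU⟩ := isUnit_one_sub_volterra hT a
  have h1 : ∀ Y, (U : C(Icc (0 : ℝ) T, E) →L[ℝ] C(Icc (0 : ℝ) T, E)) Y
      = Y - primitiveCLM hT (pointwiseCLM a Y) := fun Y => by rw [hU]; rfl
  have h2 := (ContinuousLinearEquiv.unitsEquiv ℝ _ U).bijective
  convert h2 using 1
  ext1 Y
  exact (h1 Y).symm

end Volterra

section Primitive

variable {E : Type*} [NormedAddCommGroup E] [NormedSpace ℝ E] [CompleteSpace E] {T : ℝ}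

theorem hasDerivWithinAt_extend_of_eq_primitive (hT : 0 ≤ T) {X f : C(Icc (0 : ℝ) T, E)} {x₀ : E}
    (h : ∀ t, X t = x₀ + primitiveCLM hT f t) {t : ℝ} (ht : t ∈ Icc 0 T) :
    HasDerivWithinAt (IccExtend hT X) (f ⟨t, ht⟩) (Icc 0 T) t := by
  have h1 : HasDerivAt (fun r => x₀ + ∫ s in (0 : ℝ)..r, IccExtend hT f s)
      (IccExtend hT f t) t :=
    ((continuous_extend hT f).integral_hasStrictDerivAt 0 t).hasDerivAt.const_add x₀
  rw [IccExtend_of_mem hT f ht] at h1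
  have h2 : ∀ s ∈ Icc 0 T, IccExtend hT X s = x₀ + ∫ r in (0 : ℝ)..s, IccExtend hT f r :=
    fun s hs => by
      rw [IccExtend_of_mem hT _ hs, h, primitiveCLM_apply]
  exact h1.hasDerivWithinAt.congr h2 (h2 t ht)

theorem eq_primitive_of_hasDerivWithinAt (hT : 0 ≤ T) {x : ℝ → E} {f : C(Icc (0 : ℝ) T, E)}
    (h : ∀ t : Icc (0 : ℝ) T, HasDerivWithinAt x (f t) (Icc 0 T) t) (t : Icc (0 : ℝ) T) :
    x t = x 0 + primitiveCLM hT f t := by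
  rw [primitiveCLM_apply, intervalIntegral.integral_eq_sub_of_hasDerivAt_of_le (f := x) t.2.1]
  · abel
  · exact fun s hs => ((h ⟨s, hs.1, hs.2.trans t.2.2⟩).continuousWithinAt).mono
      (Icc_subset_Icc_right t.2.2)
  · intro s hs
    have hsI : s ∈ Icc (0 : ℝ) T := ⟨hs.1.le, hs.2.le.trans t.2.2⟩
    rw [IccExtend_of_mem hT _ hsI]
    exact (h ⟨s, hsI⟩).hasDerivAt (Icc_mem_nhds hs.1 (hs.2.trans_le t.2.2))
  · exact (continuous_extend hT f).intervalIntegrable _ _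

/-- Global existence for linear differential equations. -/
theorem exists_linear_ode_solution (hT : 0 ≤ T) {a : ℝ → E →L[ℝ] E} {f : ℝ → E}
    (ha : ContinuousOn a (Icc 0 T)) (hf : ContinuousOn f (Icc 0 T)) (y₀ : E) :
    ∃ y : ℝ → E, y 0 = y₀ ∧
      ∀ t ∈ Icc 0 T, HasDerivWithinAt y (a t (y t) + f t) (Icc 0 T) t := by
  set a' : C(Icc (0 : ℝ) T, E →L[ℝ] E) := ⟨_, continuousOn_iff_continuous_domRestrict.1 ha⟩ with ha'
  set f' : C(Icc (0 : ℝ) T, E) := ⟨_, continuousOn_iff_continuous_domRestrict.1 hf⟩ with hf'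
  obtain ⟨Y, hY⟩ := (volterra_bijective hT a').2
    (ContinuousMap.const _ y₀ + primitiveCLM hT f')
  have hY' : ∀ t, Y t = y₀ + primitiveCLM hT (pointwiseCLM a' Y + f') t := fun t => by
    have := congrArg (fun Z : C(Icc (0 : ℝ) T, E) => Z t) (sub_eq_iff_eq_add.1 hY)
    simp only [ContinuousMap.add_apply, ContinuousMap.const_apply] at this
    rw [this, map_add, ContinuousMap.add_apply]
    abel
  refine ⟨IccExtend hT Y, ?_, fun t ht => ?_⟩
  · rw [IccExtend_of_mem hT _ (left_mem_Icc.2 hT), hY', primitiveCLM_apply]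
    simp
  · have := hasDerivWithinAt_extend_of_eq_primitive hT hY' ht
    rw [IccExtend_of_mem hT _ ht]
    exact this

end Primitive

section Steering

variable {E P Q : Type*} [NormedAddCommGroup E] [NormedSpace ℝ E]
  [NormedAddCommGroup P] [NormedSpace ℝ P] [NormedAddCommGroup Q] [NormedSpace ℝ Q] {T : ℝ}

/-- The linear map `(X, c) ↦ (t ↦ (X t, b t c))`. -/
noncomputable def pairCurve {K : Type*} [TopologicalSpace K] [CompactSpace K]
    (b : C(K, P →L[ℝ] Q)) : C(K, E) × P →L[ℝ] C(K, E × Q) :=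
  LinearMap.mkContinuous (E := C(K, E) × P) (F := C(K, E × Q))
    { toFun := fun p => ⟨fun t => (p.1 t, b t p.2), by fun_prop⟩
      map_add' := fun p q => by ext t <;> simp
      map_smul' := fun c p => by ext t <;> simp }
    (1 + ‖b‖) fun p => by
      refine (ContinuousMap.norm_le _ (by positivity)).2 fun t => ?_
      have h1 : ‖p.1 t‖ ≤ ‖p‖ := (p.1.norm_coe_le_norm t).trans (norm_fst_le p)
      have h2 : ‖b t p.2‖ ≤ ‖b‖ * ‖p‖ := ((b t).le_opNorm _).trans
        (mul_le_mul (b.norm_coe_le_norm t) (norm_snd_le p) (norm_nonneg _) (norm_nonneg b))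
      have h3 : 0 ≤ ‖b‖ * ‖p‖ := by positivity
      refine max_le ?_ ?_
      · change ‖p.1 t‖ ≤ _
        linarith
      · change ‖b t p.2‖ ≤ _
        linarith [norm_nonneg p]

@[simp] theorem pairCurve_apply {K : Type*} [TopologicalSpace K] [CompactSpace K]
    (b : C(K, P →L[ℝ] Q)) (p : C(K, E) × P) (t : K) :
    pairCurve b p t = (p.1 t, b t p.2) := rfl

theorem hasFDerivAt_superposition_affine {K F G H : Type*} [TopologicalSpace K] [CompactSpace K]
    [NormedAddCommGroup F] [NormedSpace ℝ F] [NormedAddCommGroup G] [NormedSpace ℝ G]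
    [NormedAddCommGroup H] [NormedSpace ℝ H] {g : C(E, F)} (hg : ContDiff ℝ 1 g)
    (L : G →L[ℝ] C(K, E)) (u : C(K, E)) (M : C(K, F) →L[ℝ] H) (x : G) :
    HasFDerivAt (fun p => M (superposition g (L p + u)))
      (M.comp ((pointwiseCLM
        (superposition ⟨fderiv ℝ g, hg.continuous_fderiv (by simp)⟩ (L x + u))).comp L)) x :=
  M.hasFDerivAt.comp x ((hasFDerivAt_superposition hg (L x + u)).comp x (L.hasFDerivAt.add_const u))

variable [CompleteSpace E]

set_option maxHeartbeats 800000 in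
/-- If the linearization of `x' = g (x, q)` along a trajectory `(x₀, q₀)` is controllable by means
of variations `c ↦ b c` of `q`, then so is the nonlinear system near this trajectory, with
parameters `c` depending smoothly on the end points. -/
theorem exists_steering_of_linearized (hT : 0 ≤ T) {g : E × Q → E} (hg : ContDiff ℝ 1 g)
    {x₀ : ℝ → E} {q₀ : ℝ → Q} {b : ℝ → E →L[ℝ] Q} (hq₀ : ContinuousOn q₀ (Icc 0 T))
    (hb : ContinuousOn b (Icc 0 T))
    (hx₀ : ∀ t ∈ Icc 0 T, HasDerivWithinAt x₀ (g (x₀ t, q₀ t)) (Icc 0 T) t)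
    (hlin : ∀ c : E, ∃ Y : ℝ → E, Y 0 = 0 ∧ Y T = c ∧ ∀ t ∈ Icc 0 T,
      HasDerivWithinAt Y (fderiv ℝ g (x₀ t, q₀ t) (Y t, b t c)) (Icc 0 T) t) :
    ∃ (c : E × E → E) (X : E × E → ℝ → E), ContDiffAt ℝ 1 c (x₀ 0, x₀ T) ∧
      ∀ ε > 0, ∀ᶠ p in 𝓝 (x₀ 0, x₀ T), X p 0 = p.1 ∧ X p T = p.2 ∧
        ∀ t ∈ Icc 0 T, ‖X p t - x₀ t‖ < ε ∧
          HasDerivWithinAt (X p) (g (X p t, q₀ t + b t (c p))) (Icc 0 T) t := by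
  have hx₀c : ContinuousOn x₀ (Icc 0 T) := fun t ht => (hx₀ t ht).continuousWithinAt
  set I := Icc (0 : ℝ) T with hI
  set xI : C(I, E) := ⟨_, continuousOn_iff_continuous_domRestrict.1 hx₀c⟩ with hxI
  set qI : C(I, Q) := ⟨_, continuousOn_iff_continuous_domRestrict.1 hq₀⟩ with hqI
  set bI : C(I, E →L[ℝ] Q) := ⟨_, continuousOn_iff_continuous_domRestrict.1 hb⟩ with hbI
  have h0I : (0 : ℝ) ∈ I := left_mem_Icc.2 hT
  have hTI : T ∈ I := right_mem_Icc.2 hT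
  set gC : C(E × Q, E) := ⟨g, hg.continuous⟩ with hgC
  set base : C(I, E × Q) := ⟨fun t => (0, qI t), by fun_prop⟩ with hbase
  set Ψ : C(I, E) × E → C(I, E) × E := fun p =>
    (p.1 - primitiveCLM hT (superposition gC (pairCurve bI p + base)), p.1 ⟨T, hTI⟩) with hΨ
  set evT : C(I, E) →L[ℝ] E := ContinuousMap.evalCLM ℝ ⟨T, hTI⟩ with hevT
  set g'C : C(E × Q, E × Q →L[ℝ] E) := ⟨fderiv ℝ g, hg.continuous_fderiv (by simp)⟩ with hg'C
  have hΨs : ContDiff ℝ 1 Ψ := by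
    refine ContDiff.prodMk (contDiff_fst.sub ((primitiveCLM hT).contDiff.comp
      ((contDiff_superposition (g := gC) hg).comp ((pairCurve bI).contDiff.add contDiff_const)))) ?_
    exact evT.contDiff.comp contDiff_fst
  have hbase₀ : pairCurve bI (xI, 0) + base = (⟨fun t => (xI t, qI t), by fun_prop⟩ : C(I, E × Q)) := by
    ext t <;> simp [hbase]
  set a : C(I, E × Q →L[ℝ] E) := superposition g'C (pairCurve bI (xI, 0) + base) with ha
  have ha_apply : ∀ t : I, a t = fderiv ℝ g (x₀ t, q₀ t) := fun t => by
    rw [ha, hbase₀]; rfl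
  set aE : C(I, E →L[ℝ] E) :=
    ⟨fun t => (a t).comp (ContinuousLinearMap.inl ℝ E Q), by fun_prop⟩ with haE
  set D : C(I, E) × E →L[ℝ] C(I, E) × E :=
    ((ContinuousLinearMap.fst ℝ _ _) - (primitiveCLM hT).comp
      ((pointwiseCLM a).comp (pairCurve bI))).prod (evT.comp (ContinuousLinearMap.fst ℝ _ _))
    with hD
  have hΨD : HasFDerivAt Ψ D (xI, 0) := by
    have h3 := hasFDerivAt_superposition_affine (g := gC) hg (pairCurve bI) base (primitiveCLM hT)
      ((xI, 0) : C(I, E) × E)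
    have h4 : HasFDerivAt (fun p : C(I, E) × E => p.1) (ContinuousLinearMap.fst ℝ C(I, E) E)
      (xI, 0) := hasFDerivAt_fst
    exact (h4.sub h3).prodMk (evT.hasFDerivAt.comp (xI, (0 : E)) h4)
  have hD_apply : ∀ p, D p = (p.1 - primitiveCLM hT (pointwiseCLM a (pairCurve bI p)),
      p.1 ⟨T, hTI⟩) := fun p => rfl
  have hsplit : ∀ p : C(I, E) × E, pointwiseCLM a (pairCurve bI p)
      = pointwiseCLM aE p.1 + pointwiseCLM a (pairCurve bI (0, p.2)) := fun p => by
    ext t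
    simp [haE, ← map_add]
  have hlin' : ∀ c : E, ∃ Y : C(I, E), D (Y, c) = (0, c) := by
    intro c
    obtain ⟨Y, hY0, hYT, hY⟩ := hlin c
    have hYc : ContinuousOn Y I := fun t ht => (hY t ht).continuousWithinAt
    set YI : C(I, E) := ⟨_, continuousOn_iff_continuous_domRestrict.1 hYc⟩ with hYI
    refine ⟨YI, ?_⟩
    rw [hD_apply]
    refine Prod.ext ?_ hYT
    ext t
    have := eq_primitive_of_hasDerivWithinAt hT (x := Y)
      (f := pointwiseCLM a (pairCurve bI (YI, c))) (fun t => by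
        have := hY t t.2
        rw [pointwiseCLM_apply, ha_apply]
        exact this) t
    rw [hY0, zero_add] at this
    rw [ContinuousMap.sub_apply, ← this]
    exact sub_self _
  have hinj : ∀ p, D p = 0 → p = 0 := by
    rintro ⟨Y, c⟩ h
    obtain ⟨Z, hZ⟩ := hlin' c
    have h1 : D (Z - Y, 0) = (0, c) := by
      have : ((Z - Y, 0) : C(I, E) × E) = (Z, c) - (Y, c) := by simp
      rw [this, map_sub, hZ, h, sub_zero]
    have h2 := congrArg Prod.fst h1
    rw [hD_apply, hsplit] at h2
    have h3 : pairCurve bI ((0 : C(I, E)), (0 : E)) = 0 := (pairCurve bI).map_zero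
    simp only [h3, map_zero, add_zero] at h2
    have h4 : Z - Y = 0 := by
      refine (volterra_bijective hT aE).1 ?_
      simp only [map_zero, sub_zero]
      exact h2
    have h5 := congrArg Prod.snd h1
    rw [hD_apply, h4] at h5
    have hc : c = 0 := h5.symm
    have h6 := congrArg Prod.fst h
    rw [hD_apply, hsplit, hc, h3] at h6
    simp only [map_zero, add_zero] at h6
    have hY : Y = 0 := by
      refine (volterra_bijective hT aE).1 ?_
      simp only [map_zero, sub_zero]
      exact h6
    rw [hY, hc]
    rfl
  have hsurj : ∀ z, ∃ p, D p = z := by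
    rintro ⟨Z, y⟩
    obtain ⟨Y₁, hY₁⟩ := (volterra_bijective hT aE).2 Z
    have h1 : D (Y₁, 0) = (Z, Y₁ ⟨T, hTI⟩) := by
      rw [hD_apply, hsplit]
      have h3 : pairCurve bI ((0 : C(I, E)), (0 : E)) = 0 := (pairCurve bI).map_zero
      simp only [h3, map_zero, add_zero]
      exact Prod.ext hY₁ rfl
    obtain ⟨Y₂, hY₂⟩ := hlin' (y - Y₁ ⟨T, hTI⟩)
    refine ⟨(Y₁, 0) + (Y₂, y - Y₁ ⟨T, hTI⟩), ?_⟩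
    rw [map_add, h1, hY₂]
    ext <;> simp
  set De := ContinuousLinearEquiv.ofBijective D (LinearMap.ker_eq_bot'.2 hinj)
    (LinearMap.range_eq_top.2 hsurj) with hDe
  have hΨD' : HasFDerivAt Ψ (De : C(I, E) × E →L[ℝ] C(I, E) × E) (xI, 0) := by
    rw [hDe, ContinuousLinearEquiv.coe_ofBijective]
    exact hΨD
  have hat : ContDiffAt ℝ 1 Ψ (xI, 0) := hΨs.contDiffAt
  have hΨ0 : Ψ (xI, 0) = (ContinuousMap.const _ (x₀ 0), x₀ T) := by
    refine Prod.ext ?_ rfl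
    ext t
    have := eq_primitive_of_hasDerivWithinAt hT (x := x₀)
      (f := superposition gC (pairCurve bI (xI, 0) + base)) (fun t => by
        rw [hbase₀]; exact hx₀ t t.2) t
    change x₀ t - primitiveCLM hT (superposition gC (pairCurve bI (xI, 0) + base)) t = x₀ 0
    rw [this]
    abel
  set Φ := hat.localInverse hΨD' (by simp) with hΦ
  have hΦs : ContDiffAt ℝ 1 Φ (Ψ (xI, 0)) := hat.to_localInverse hΨD' (by simp)
  have hΦ0 : Φ (Ψ (xI, 0)) = (xI, 0) := hat.localInverse_apply_image hΨD' (by simp)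
  set emb : E × E → C(I, E) × E := fun p => (ContinuousMap.const _ p.1, p.2) with hemb
  have hembs : ContDiff ℝ 1 emb := by
    refine ContDiff.prodMk ?_ contDiff_snd
    have : IsBoundedLinearMap ℝ fun e : E => (ContinuousMap.const I e : C(I, E)) :=
      { map_add := fun x y => by ext; simp
        map_smul := fun c x => by ext; simp
        bound := ⟨1, one_pos, fun x => (ContinuousMap.norm_le _ (by positivity)).2 fun t => by
          simp⟩ }
    exact this.contDiff.comp contDiff_fst
  have hemb0 : emb (x₀ 0, x₀ T) = Ψ (xI, 0) := hΨ0.symm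
  have hcomp : ContDiffAt ℝ 1 (Φ ∘ emb) (x₀ 0, x₀ T) :=
    ContDiffAt.comp _ (by rw [hemb0]; exact hΦs) hembs.contDiffAt
  refine ⟨fun p => (Φ (emb p)).2, fun p => IccExtend hT (Φ (emb p)).1,
    contDiffAt_snd.comp _ hcomp, fun ε hε => ?_⟩
  have hright : ∀ᶠ p in 𝓝 (x₀ 0, x₀ T), Ψ (Φ (emb p)) = emb p := by
    have h1 : Tendsto emb (𝓝 (x₀ 0, x₀ T)) (𝓝 (Ψ (xI, 0))) := by
      rw [← hemb0]; exact hembs.continuous.tendsto _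
    exact h1.eventually ((hat.hasStrictFDerivAt' hΨD' (by simp)).eventually_right_inverse)
  have hnear : ∀ᶠ p in 𝓝 (x₀ 0, x₀ T), dist (Φ (emb p)).1 xI < ε := by
    have h1 : Tendsto (fun p => (Φ (emb p)).1) (𝓝 (x₀ 0, x₀ T)) (𝓝 xI) := by
      have := (continuous_fst.tendsto _).comp hcomp.continuousAt.tendsto
      simp only [Function.comp_apply, hemb0, hΦ0] at this
      exact this
    exact h1.eventually (Metric.ball_mem_nhds _ hε)
  filter_upwards [hright, hnear] with p hp hp'
  set X := (Φ (emb p)).1 with hX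
  set c := (Φ (emb p)).2 with hc
  have hXc : Φ (emb p) = (X, c) := rfl
  rw [hXc] at hp
  have h1 : ∀ t, X t = p.1 + primitiveCLM hT (superposition gC (pairCurve bI (X, c) + base)) t := by
    intro t
    have := congrArg (fun Z : C(I, E) => Z t) (congrArg Prod.fst hp)
    exact sub_eq_iff_eq_add.1 this
  refine ⟨?_, ?_, fun t ht => ⟨?_, ?_⟩⟩
  · rw [IccExtend_of_mem hT _ h0I, h1, primitiveCLM_apply]
    simp
  · rw [IccExtend_of_mem hT _ hTI]
    exact congrArg Prod.snd hp
  · rw [IccExtend_of_mem hT _ ht, ← dist_eq_norm]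
    exact (ContinuousMap.dist_apply_le_dist (f := X) (g := xI) ⟨t, ht⟩).trans_lt hp'
  · have := hasDerivWithinAt_extend_of_eq_primitive hT h1 ht
    convert this using 1
    rw [IccExtend_of_mem hT _ ht]
    change g (X ⟨t, ht⟩, q₀ t + b t c) = g ((X ⟨t, ht⟩, b t c) + (0, q₀ t))
    rw [Prod.mk_add_mk, add_zero, add_comm]

end Steering

section LinearControl

variable {n k : Type*} {T : ℝ}

theorem continuousOn_matrix {A : ℝ → Matrix n k ℝ} {s : Set ℝ}
    (hA : ∀ i j, ContinuousOn (fun t => A t i j) s) : ContinuousOn A s :=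
  continuousOn_pi.2 fun i => continuousOn_pi.2 fun j => hA i j

/-- The continuous linear map of multiplication by a matrix, as a linear function of the matrix. -/
noncomputable def mulVecCLM [Fintype k] : Matrix n k ℝ →ₗ[ℝ] ((k → ℝ) →L[ℝ] (n → ℝ)) where
  toFun A := LinearMap.toContinuousLinearMap A.mulVecLin
  map_add' A B := by ext v : 1; simp
  map_smul' c A := by ext v : 1; simp

@[simp] theorem mulVecCLM_apply [Fintype k] (A : Matrix n k ℝ) (v : k → ℝ) : mulVecCLM A v = A *ᵥ v := rfl

variable [Fintype n]

theorem HasDerivWithinAt.dotProduct {x y : ℝ → n → ℝ} {x' y' : n → ℝ} {s : Set ℝ} {t : ℝ}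
    (hx : HasDerivWithinAt x x' s t) (hy : HasDerivWithinAt y y' s t) :
    HasDerivWithinAt (fun r => x r ⬝ᵥ y r) (x' ⬝ᵥ y t + x t ⬝ᵥ y') s t := by
  have := HasDerivWithinAt.fun_sum (u := Finset.univ) fun i _ =>
    ((hasDerivWithinAt_pi.1 hx) i).mul ((hasDerivWithinAt_pi.1 hy) i)
  rw [Finset.sum_add_distrib] at this
  exact this

theorem contDiffOn_controlMatrix (hT : 0 < T) {A : ℝ → Matrix n n ℝ} {B : ℝ → Matrix n k ℝ}
    {C : Matrix n k ℝ} (hA : ∀ i j, ContDiffOn ℝ ∞ (fun t => A t i j) (Icc 0 T))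
    (hB : ∀ i j, ContDiffOn ℝ ∞ (fun t => B t i j) (Icc 0 T)) (r : ℕ) :
    ∀ i j, ContDiffOn ℝ ∞ (fun t => controlMatrix T A B C r t i j) (Icc 0 T) := by
  induction r with
  | zero =>
    intro i j
    simp only [controlMatrix, Matrix.add_apply, Matrix.mul_apply]
    exact (hB i j).add (ContDiffOn.sum fun l _ => (hA i l).mul contDiffOn_const)
  | succ r ih =>
    intro i j
    simp only [controlMatrix, Matrix.sub_apply, Matrix.mul_apply, Matrix.of_apply]
    refine ContDiffOn.sub ?_ (ContDiffOn.sum fun l _ => (hA i l).mul (ih l j))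
    exact ((contDiffOn_infty_iff_derivWithin (uniqueDiffOn_Icc hT)).1 (ih i j)).2

theorem dotProduct_controlMatrix_eq_zero (hT : 0 < T) {A : ℝ → Matrix n n ℝ}
    {B : ℝ → Matrix n k ℝ} {C : Matrix n k ℝ}
    (hA : ∀ i j, ContDiffOn ℝ ∞ (fun t => A t i j) (Icc 0 T))
    (hB : ∀ i j, ContDiffOn ℝ ∞ (fun t => B t i j) (Icc 0 T)) {P : ℝ → n → ℝ}
    (hP : ∀ t ∈ Icc 0 T, HasDerivWithinAt P (-(P t ᵥ* A t)) (Icc 0 T) t) {j : k}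
    (h0 : ∀ t ∈ Icc 0 T, P t ⬝ᵥ (controlMatrix T A B C 0 t).col j = 0) (r : ℕ) :
    ∀ t ∈ Icc 0 T, P t ⬝ᵥ (controlMatrix T A B C r t).col j = 0 := by
  induction r with
  | zero => exact h0
  | succ r ih =>
    intro t ht
    have hd : HasDerivWithinAt (fun s => (controlMatrix T A B C r s).col j)
        (fun i => derivWithin (fun s => controlMatrix T A B C r s i j) (Icc 0 T) t)
        (Icc 0 T) t := hasDerivWithinAt_pi.2 fun i =>
      ((contDiffOn_controlMatrix hT hA hB r i j).differentiableOn (by simp) t ht).hasDerivWithinAt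
    have h1 := (hP t ht).dotProduct hd
    have h2 : HasDerivWithinAt (fun s => P s ⬝ᵥ (controlMatrix T A B C r s).col j) 0
        (Icc 0 T) t := (hasDerivWithinAt_const t (Icc 0 T) (0 : ℝ)).congr ih (ih t ht)
    have h3 := (uniqueDiffOn_Icc hT t ht).eq_deriv _ h1 h2
    have h4 : (controlMatrix T A B C (r + 1) t).col j
        = (fun i => derivWithin (fun s => controlMatrix T A B C r s i j) (Icc 0 T) t)
          - A t *ᵥ (controlMatrix T A B C r t).col j := by
      ext i
      simp [controlMatrix, Matrix.mul_apply, Matrix.mulVec, dotProduct]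
    rw [h4, dotProduct_sub, dotProduct_mulVec]
    rw [neg_dotProduct] at h3
    linarith

variable [Fintype k]

theorem continuousOn_mulVecCLM {A : ℝ → Matrix n k ℝ} {s : Set ℝ}
    (hA : ∀ i j, ContinuousOn (fun t => A t i j) s) :
    ContinuousOn (fun t => mulVecCLM (A t)) s :=
  (LinearMap.continuous_of_finiteDimensional (mulVecCLM (n := n) (k := k))).comp_continuousOn
    (continuousOn_matrix hA)

theorem exists_adjoint_solution (hT : 0 ≤ T) {A : ℝ → Matrix n n ℝ}
    (hA : ∀ i j, ContinuousOn (fun t => A t i j) (Icc 0 T)) (p : n → ℝ) :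
    ∃ P : ℝ → n → ℝ, P T = p ∧ ∀ t ∈ Icc 0 T, HasDerivWithinAt P (-(P t ᵥ* A t)) (Icc 0 T) t := by
  have hmaps : MapsTo (fun t => T - t) (Icc 0 T) (Icc 0 T) := fun t ht =>
    ⟨by linarith [ht.2], by linarith [ht.1]⟩
  have hcont : ContinuousOn (fun t => mulVecCLM (A (T - t))ᵀ) (Icc 0 T) :=
    continuousOn_mulVecCLM fun i j => (hA j i).comp (by fun_prop) hmaps
  obtain ⟨y, hy0, hy⟩ := exists_linear_ode_solution hT hcont
    (continuousOn_const (c := (0 : n → ℝ))) p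
  refine ⟨fun t => y (T - t), by simpa using hy0, fun t ht => ?_⟩
  have h1 : HasDerivWithinAt (fun t : ℝ => T - t) (-1) (Icc 0 T) t :=
    ((hasDerivAt_id t).const_sub T).hasDerivWithinAt
  have h2 := (hy (T - t) (hmaps ht)).scomp t h1 hmaps
  refine h2.congr_deriv ?_
  simp [Matrix.mulVec_transpose]

/-- The admissible controls of a linear control system: smooth and vanishing at time `0`. -/
def admissibleControls (k : Type*) [Fintype k] : Submodule ℝ (ℝ → k → ℝ) where
  carrier := {u | ContDiff ℝ ∞ u ∧ u 0 = 0}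
  add_mem' hu hv := ⟨hu.1.add hv.1, by simp [hu.2, hv.2]⟩
  zero_mem' := ⟨contDiff_const, rfl⟩
  smul_mem' c u hu := ⟨contDiff_const.smul hu.1, by simp [hu.2]⟩

/-- `y` is a response of `y' = A y + B u + C u'` to the control `u`, starting from `0`. -/
def IsResponse (T : ℝ) (A : ℝ → Matrix n n ℝ) (B : ℝ → Matrix n k ℝ) (C : Matrix n k ℝ)
    (u : ℝ → k → ℝ) (y : ℝ → n → ℝ) : Prop :=
  y 0 = 0 ∧ ∀ t ∈ Icc 0 T,
    HasDerivWithinAt y (A t *ᵥ y t + B t *ᵥ u t + C *ᵥ deriv u t) (Icc 0 T) t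

theorem IsResponse.add {A : ℝ → Matrix n n ℝ} {B : ℝ → Matrix n k ℝ} {C : Matrix n k ℝ}
    {u v : ℝ → k → ℝ} {y z : ℝ → n → ℝ} (hu : ContDiff ℝ ∞ u) (hv : ContDiff ℝ ∞ v)
    (hy : IsResponse T A B C u y) (hz : IsResponse T A B C v z) :
    IsResponse T A B C (u + v) (y + z) := by
  refine ⟨by simp [hy.1, hz.1], fun t ht => ?_⟩
  refine ((hy.2 t ht).add (hz.2 t ht)).congr_deriv ?_
  rw [deriv_add (hu.differentiable (by simp) t) (hv.differentiable (by simp) t)]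
  simp only [Pi.add_apply, mulVec_add]
  abel

theorem IsResponse.smul {A : ℝ → Matrix n n ℝ} {B : ℝ → Matrix n k ℝ} {C : Matrix n k ℝ}
    {u : ℝ → k → ℝ} {y : ℝ → n → ℝ} (c : ℝ) (hu : ContDiff ℝ ∞ u)
    (hy : IsResponse T A B C u y) : IsResponse T A B C (c • u) (c • y) := by
  refine ⟨by simp [hy.1], fun t ht => ?_⟩
  refine ((hy.2 t ht).const_smul c).congr_deriv ?_
  rw [deriv_const_smul c (hu.differentiable (by simp) t)]
  simp only [Pi.smul_apply, mulVec_smul, smul_add]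

/-- The states which are reachable from `0` at time `T`. -/
def reachable (T : ℝ) (A : ℝ → Matrix n n ℝ) (B : ℝ → Matrix n k ℝ) (C : Matrix n k ℝ) :
    Submodule ℝ (n → ℝ) where
  carrier := {c | ∃ u ∈ admissibleControls k, ∃ y, IsResponse T A B C u y ∧ y T = c}
  add_mem' := by
    rintro _ _ ⟨u, hu, y, hy, rfl⟩ ⟨v, hv, z, hz, rfl⟩
    exact ⟨u + v, add_mem hu hv, y + z, hy.add hu.1 hv.1 hz, rfl⟩
  zero_mem' := by
    refine ⟨0, zero_mem _, 0, ⟨rfl, fun t _ => ?_⟩, rfl⟩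
    have : deriv (0 : ℝ → k → ℝ) t = 0 := by simp
    refine (hasDerivWithinAt_const t (Icc 0 T) (0 : n → ℝ)).congr_deriv ?_
    simp [this]
  smul_mem' := by
    rintro c _ ⟨u, hu, y, hy, rfl⟩
    exact ⟨c • u, Submodule.smul_mem _ c hu, c • y, hy.smul c hu.1, rfl⟩

theorem exists_response (hT : 0 ≤ T) {A : ℝ → Matrix n n ℝ} {B : ℝ → Matrix n k ℝ}
    {C : Matrix n k ℝ} (hA : ∀ i j, ContinuousOn (fun t => A t i j) (Icc 0 T))
    (hB : ∀ i j, ContinuousOn (fun t => B t i j) (Icc 0 T)) {u : ℝ → k → ℝ}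
    (hu : ContDiff ℝ ∞ u) : ∃ y, IsResponse T A B C u y := by
  obtain ⟨y, hy0, hy⟩ := exists_linear_ode_solution hT (continuousOn_mulVecCLM hA)
    (f := fun t => mulVecCLM (B t) (u t) + mulVecCLM C (deriv u t))
    (((continuousOn_mulVecCLM hB).clm_apply hu.continuous.continuousOn).add
      ((mulVecCLM C).continuous.comp_continuousOn
        (hu.continuous_deriv (by simp)).continuousOn)) 0
  exact ⟨y, hy0, fun t ht => by simpa [add_assoc] using hy t ht⟩

theorem integral_adjoint_eq (hT : 0 < T) {A : ℝ → Matrix n n ℝ} {B : ℝ → Matrix n k ℝ}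
    {C : Matrix n k ℝ} (hA : ∀ i j, ContDiffOn ℝ ∞ (fun t => A t i j) (Icc 0 T))
    (hB : ∀ i j, ContDiffOn ℝ ∞ (fun t => B t i j) (Icc 0 T)) {P : ℝ → n → ℝ}
    (hP : ∀ t ∈ Icc 0 T, HasDerivWithinAt P (-(P t ᵥ* A t)) (Icc 0 T) t) {u : ℝ → k → ℝ}
    (hu : u ∈ admissibleControls k) {y : ℝ → n → ℝ} (hy : IsResponse T A B C u y) :
    ∫ t in (0 : ℝ)..T, P t ⬝ᵥ (controlMatrix T A B C 0 t *ᵥ u t)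
      = P T ⬝ᵥ y T - P T ⬝ᵥ (C *ᵥ u T) := by
  have hd : ∀ t ∈ Icc 0 T, HasDerivWithinAt (fun t => P t ⬝ᵥ (y t - C *ᵥ u t))
      (P t ⬝ᵥ (controlMatrix T A B C 0 t *ᵥ u t)) (Icc 0 T) t := by
    intro t ht
    have h1 : HasDerivWithinAt (fun t => C *ᵥ u t) (C *ᵥ deriv u t) (Icc 0 T) t :=
      ((mulVecCLM C).hasFDerivAt.comp_hasDerivAt t
        (hu.1.differentiable (by simp) t).hasDerivAt).hasDerivWithinAt
    refine ((hP t ht).dotProduct ((hy.2 t ht).sub h1)).congr_deriv ?_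
    have h2 : A t *ᵥ y t + B t *ᵥ u t + C *ᵥ deriv u t - C *ᵥ deriv u t
        = A t *ᵥ y t + B t *ᵥ u t := by abel
    rw [h2]
    change -(P t ᵥ* A t) ⬝ᵥ (y t - C *ᵥ u t) + _ = _
    rw [neg_dotProduct, dotProduct_sub, dotProduct_add, ← dotProduct_mulVec, ← dotProduct_mulVec,
      Matrix.mulVec_mulVec]
    simp only [controlMatrix, Matrix.add_mulVec, dotProduct_add]
    ring
  rw [intervalIntegral.integral_eq_sub_of_hasDerivAt_of_le
    (f := fun t => P t ⬝ᵥ (y t - C *ᵥ u t)) hT.le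
    (fun t ht => (hd t ht).continuousWithinAt)
    (fun t ht => (hd t (Ioo_subset_Icc_self ht)).hasDerivAt (Icc_mem_nhds ht.1 ht.2))]
  · simp [hy.1, hu.2, dotProduct_sub]
  · refine ContinuousOn.intervalIntegrable_of_Icc hT.le ?_
    simp only [dotProduct, Matrix.mulVec]
    have hPc : ∀ i, ContinuousOn (fun t => P t i) (Icc 0 T) := fun i t ht =>
      (hasDerivWithinAt_pi.1 (hP t ht) i).continuousWithinAt
    have huc : ∀ j, Continuous fun t => u t j := fun j =>
      (continuous_apply j).comp hu.1.continuous
    exact continuousOn_finsetSum _ fun i _ => (hPc i).mul (continuousOn_finsetSum _ fun j _ =>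
      ((contDiffOn_controlMatrix hT hA hB 0 i j).continuousOn).mul (huc j).continuousOn)

/-- The rank condition for time-varying linear systems. -/
theorem reachable_eq_top [DecidableEq k] (hT : 0 < T) {A : ℝ → Matrix n n ℝ}
    {B : ℝ → Matrix n k ℝ}
    {C : Matrix n k ℝ} (hA : ∀ i j, ContDiffOn ℝ ∞ (fun t => A t i j) (Icc 0 T))
    (hB : ∀ i j, ContDiffOn ℝ ∞ (fun t => B t i j) (Icc 0 T))
    (hrank : Submodule.span ℝ (range C.col ∪ ⋃ r : ℕ, range (controlMatrix T A B C r T).col) = ⊤) :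
    reachable T A B C = ⊤ := by
  classical
  by_contra hne
  obtain ⟨f, hf0, hf⟩ := Submodule.exists_le_ker_of_lt_top _ (lt_top_iff_ne_top.2 hne)
  set p : n → ℝ := fun i => f (Pi.single i 1) with hp
  have hfp : ∀ v, f v = p ⬝ᵥ v := fun v => by
    conv_lhs => rw [pi_eq_sum_univ' v]
    simp [hp, dotProduct, mul_comm]
  obtain ⟨P, hPT, hP⟩ := exists_adjoint_solution hT.le (fun i j => (hA i j).continuousOn) p
  have key : ∀ u ∈ admissibleControls k,
      ∫ t in (0 : ℝ)..T, P t ⬝ᵥ (controlMatrix T A B C 0 t *ᵥ u t) = -(p ⬝ᵥ (C *ᵥ u T)) := by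
    intro u hu
    obtain ⟨y, hy⟩ := exists_response hT.le (C := C) (fun i j => (hA i j).continuousOn)
      (fun i j => (hB i j).continuousOn) hu.1
    have h1 : f (y T) = 0 := hf ⟨u, hu, y, hy, rfl⟩
    rw [integral_adjoint_eq hT hA hB hP hu hy, hPT, ← hfp, h1, zero_sub]
  have hqc : ∀ j, ContinuousOn (fun t => P t ⬝ᵥ (controlMatrix T A B C 0 t).col j) (Icc 0 T) := by
    intro j
    refine continuousOn_finsetSum _ fun i _ => ContinuousOn.mul
      (fun t ht => (hasDerivWithinAt_pi.1 (hP t ht) i).continuousWithinAt)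
      (contDiffOn_controlMatrix hT hA hB 0 i j).continuousOn
  have hzero : ∀ j, ∀ t ∈ Icc 0 T, P t ⬝ᵥ (controlMatrix T A B C 0 t).col j = 0 := by
    intro j
    set q : ℝ → ℝ := fun t => P t ⬝ᵥ (controlMatrix T A B C 0 t).col j with hq
    have hae := isOpen_Ioo.ae_eq_zero_of_integral_contDiff_smul_eq_zero (μ := volume)
      (U := Ioo 0 T) (f := q)
      (((hqc j).mono Ioo_subset_Icc_self).locallyIntegrableOn measurableSet_Ioo) ?_
    · have h2 : q =ᵐ[volume.restrict (Icc 0 T)] fun _ => 0 := by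
        rw [restrict_Ioo_eq_restrict_Icc.symm]
        exact (ae_restrict_iff' measurableSet_Ioo).2 hae
      exact Measure.eqOn_Icc_of_ae_eq volume hT.ne h2 (hqc j) continuousOn_const
    · intro φ hφ hφc hφs
      have hφ0 : ∀ t, t ∉ Ioo 0 T → φ t = 0 := fun t ht =>
        image_eq_zero_of_notMem_tsupport fun h => ht (hφs h)
      have h3 := key (fun t => φ t • Pi.single j 1) ⟨hφ.smul contDiff_const, by
        simp [hφ0 0 (by simp)]⟩
      simp only [hφ0 T (by simp), zero_smul, mulVec_zero, dotProduct_zero, neg_zero,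
        mulVec_smul, mulVec_single_one, dotProduct_smul] at h3
      rw [← h3, intervalIntegral.integral_of_le hT.le]
      refine (setIntegral_eq_integral_of_forall_compl_eq_zero fun t ht => ?_).symm
      rw [hφ0 t (fun h => ht (Ioo_subset_Ioc_self h)), zero_smul]
  have hC : ∀ j, p ⬝ᵥ C.col j = 0 := by
    intro j
    have h1 := key (fun t => t • Pi.single j 1) ⟨contDiff_id.smul contDiff_const, by simp⟩
    simp only [mulVec_smul, mulVec_single_one, dotProduct_smul] at h1
    rw [intervalIntegral.integral_congr (g := fun _ => 0)] at h1
    · simp only [intervalIntegral.integral_zero, smul_eq_mul] at h1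
      have := mul_eq_zero.1 (neg_eq_zero.1 h1.symm)
      exact this.resolve_left hT.ne'
    · intro t ht
      rw [uIcc_of_le hT.le] at ht
      simp [hzero j t ht]
  refine hf0 (LinearMap.ext fun v => ?_)
  have hle : Submodule.span ℝ
      (range C.col ∪ ⋃ r : ℕ, range (controlMatrix T A B C r T).col) ≤ LinearMap.ker f := by
    rw [Submodule.span_le]
    rintro _ (⟨j, rfl⟩ | h)
    · exact (hfp _).trans (hC j)
    · obtain ⟨r, j, rfl⟩ := mem_iUnion.1 h
      refine (hfp _).trans ?_
      rw [← hPT]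
      exact dotProduct_controlMatrix_eq_zero hT hA hB hP (hzero j) r T (right_mem_Icc.2 hT.le)
  rw [hrank] at hle
  exact hle (Submodule.mem_top (x := v))

end LinearControl

section Calculus

theorem exists_smooth_sqrt_one_sub :
    ∃ ρ : ℝ → ℝ, ContDiff ℝ ∞ ρ ∧ ∀ s, |s| ≤ 1 / 4 → ρ s = Real.sqrt (1 - s) := by
  let f : ContDiffBump (0 : ℝ) := ⟨1 / 4, 1 / 2, by norm_num, by norm_num⟩
  refine ⟨fun s => Real.sqrt (1 - s * f s), ?_, fun s hs => ?_⟩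
  · refine ContDiff.sqrt (contDiff_const.sub (contDiff_id.mul f.contDiff)) fun s => ?_
    have h0 : 0 ≤ f s := f.nonneg
    have h1 : f s ≤ 1 := f.le_one
    have h2 : s * f s < 1 := by
      rcases lt_or_ge s (1 / 2) with h | h
      · nlinarith
      · have : f s = 0 := f.zero_of_le_dist (by
          rw [Real.dist_eq, sub_zero]; exact h.trans (le_abs_self s))
        rw [this, mul_zero]; exact one_pos
    linarith
  · have : f s = 1 := f.one_of_mem_closedBall (by
      rw [mem_closedBall_zero_iff]; exact hs)
    simp only [this, mul_one]

theorem contDiff_crossProduct {E : Type*} [NormedAddCommGroup E] [NormedSpace ℝ E]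
    {a b : E → Fin 3 → ℝ} (ha : ContDiff ℝ ∞ a) (hb : ContDiff ℝ ∞ b) :
    ContDiff ℝ ∞ fun x => crossProduct (a x) (b x) := by
  have ha' := contDiff_pi.1 ha
  have hb' := contDiff_pi.1 hb
  refine contDiff_pi.2 fun i => ?_
  simp only [cross_apply]
  fin_cases i
  · exact ((ha' 1).mul (hb' 2)).sub ((ha' 2).mul (hb' 1))
  · exact ((ha' 2).mul (hb' 0)).sub ((ha' 0).mul (hb' 2))
  · exact ((ha' 0).mul (hb' 1)).sub ((ha' 1).mul (hb' 0))

theorem contDiff_dotProduct {ι E : Type*} [Fintype ι] [NormedAddCommGroup E] [NormedSpace ℝ E]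
    {a b : E → ι → ℝ} (ha : ContDiff ℝ ∞ a) (hb : ContDiff ℝ ∞ b) :
    ContDiff ℝ ∞ fun x => a x ⬝ᵥ b x :=
  ContDiff.sum fun i _ => (contDiff_pi.1 ha i).mul (contDiff_pi.1 hb i)

theorem contDiff_mulVec {ι κ E : Type*} [Fintype ι] [Fintype κ] [NormedAddCommGroup E]
    [NormedSpace ℝ E] {A : E → Matrix κ ι ℝ} {b : E → ι → ℝ}
    (hA : ∀ i j, ContDiff ℝ ∞ fun x => A x i j) (hb : ContDiff ℝ ∞ b) :
    ContDiff ℝ ∞ fun x => A x *ᵥ b x :=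
  contDiff_pi.2 fun i => contDiff_dotProduct (contDiff_pi.2 (hA i)) hb

theorem hasDerivAt_crossProduct {a b : ℝ → Fin 3 → ℝ} {a' b' : Fin 3 → ℝ} {t : ℝ}
    (ha : HasDerivAt a a' t) (hb : HasDerivAt b b' t) :
    HasDerivAt (fun s => crossProduct (a s) (b s))
      (crossProduct a' (b t) + crossProduct (a t) b') t := by
  have ha' := hasDerivAt_pi.1 ha
  have hb' := hasDerivAt_pi.1 hb
  have key : ∀ i j, HasDerivAt (fun s => a s i * b s j - a s j * b s i)
      (a' i * b t j - a' j * b t i + (a t i * b' j - a t j * b' i)) t := fun i j => by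
    refine (((ha' i).mul (hb' j)).sub ((ha' j).mul (hb' i))).congr_deriv ?_
    ring
  refine hasDerivAt_pi.2 fun i => ?_
  simp only [cross_apply, Pi.add_apply]
  fin_cases i
  · exact key 1 2
  · exact key 2 0
  · exact key 0 1

theorem hasDerivAt_dotProduct {ι : Type*} [Fintype ι] {a b : ℝ → ι → ℝ} {a' b' : ι → ℝ} {t : ℝ}
    (ha : HasDerivAt a a' t) (hb : HasDerivAt b b' t) :
    HasDerivAt (fun s => a s ⬝ᵥ b s) (a' ⬝ᵥ b t + a t ⬝ᵥ b') t := by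
  have := ha.hasDerivWithinAt (s := univ) |>.dotProduct (hb.hasDerivWithinAt (s := univ))
  rwa [hasDerivWithinAt_univ] at this

theorem skew_mulVec (a b : Fin 3 → ℝ) : skew a *ᵥ b = crossProduct a b := by
  ext i
  fin_cases i <;> simp [skew, cross_apply, Matrix.mulVec, dotProduct, Fin.sum_univ_three] <;> ring

end Calculus

namespace Vehicle

variable {m : ℕ} (V : Vehicle m)

theorem contDiff_F : ContDiff ℝ ∞
    fun p : (Fin 3 ⊕ Fin 3 → ℝ) × (Fin m → ℝ) => V.F p.1 p.2 := by
  have hk : ContDiff ℝ ∞ fun p : (Fin 3 ⊕ Fin 3 → ℝ) × (Fin m → ℝ) => p.1 := contDiff_fst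
  have hw : ContDiff ℝ ∞ fun p : (Fin 3 ⊕ Fin 3 → ℝ) × (Fin m → ℝ) => p.2 := contDiff_snd
  have hki := contDiff_pi.1 hk
  have hwi := contDiff_pi.1 hw
  have hl : ContDiff ℝ ∞ fun p : (Fin 3 ⊕ Fin 3 → ℝ) × (Fin m → ℝ) => p.1 ∘ Sum.inl :=
    contDiff_pi.2 fun i => hki _
  have hr : ContDiff ℝ ∞ fun p : (Fin 3 ⊕ Fin 3 → ℝ) × (Fin m → ℝ) => p.1 ∘ Sum.inr :=
    contDiff_pi.2 fun i => hki _
  have hskew : ∀ {a : (Fin 3 ⊕ Fin 3 → ℝ) × (Fin m → ℝ) → Fin 3 → ℝ}, ContDiff ℝ ∞ a →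
      ∀ i j, ContDiff ℝ ∞ fun p => skew (a p) i j := fun ha i j => by
    have ha' := contDiff_pi.1 ha
    fin_cases i <;> fin_cases j <;> simp [skew] <;>
      first | exact contDiff_const | exact ha' _ | exact (ha' _).neg
  have hconst : ∀ {ι κ : Type} [Fintype ι] [Fintype κ] (A : Matrix κ ι ℝ)
      {b : (Fin 3 ⊕ Fin 3 → ℝ) × (Fin m → ℝ) → ι → ℝ}, ContDiff ℝ ∞ b →
      ContDiff ℝ ∞ fun x => A *ᵥ b x := fun A _ hb =>
    contDiff_mulVec (fun _ _ => contDiff_const) hb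
  unfold F
  refine ContDiff.sub (contDiff_mulVec (fun i j => ?_)
    ((hconst _ hk).sub (hconst _ hw))) (ContDiff.sum fun p _ => (hwi p).smul ?_)
  · rcases i with i | i <;> rcases j with j | j
    · simpa using (hskew hr i j).neg
    · simpa using contDiff_const
    · simpa using (hskew hl i j).neg
    · simpa using (hskew hr i j).neg
  · refine contDiff_pi.2 fun i => ?_
    rcases i with i | i
    · exact contDiff_pi.1 (((hconst _ hl).add (hconst _ hr)).add (hconst _ hw)) i
    · exact contDiff_pi.1 (((hconst _ hl).add (hconst _ hr)).add (hconst _ hw)) i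

theorem fderiv_F (k δk : Fin 3 ⊕ Fin 3 → ℝ) (w δw : Fin m → ℝ) :
    fderiv ℝ (fun p : (Fin 3 ⊕ Fin 3 → ℝ) × (Fin m → ℝ) => V.F p.1 p.2) (k, w) (δk, δw)
      = fderiv ℝ (fun k' => V.F k' w) k δk + fderiv ℝ (fun w' => V.F k w') w δw := by
  have h := (V.contDiff_F.differentiable (by simp) (k, w)).hasFDerivAt
  have h1 := (HasFDerivAt.comp (f := fun k' => (k', w)) k h (hasFDerivAt_prodMk_left k w)).fderiv
  have h2 := (HasFDerivAt.comp (f := fun w' => (k, w')) w h (hasFDerivAt_prodMk_right k w)).fderiv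
  simp only [Function.comp_def] at h1 h2
  rw [h1, h2]
  simp [← map_add]

/-- The right-hand side of the reduced system, as a function of `(x, (w, w'))`, with the square
root replaced by a function `ρ`. -/
noncomputable def rhsWith (ρ : ℝ → ℝ) (p : State × ((Fin m → ℝ) × (Fin m → ℝ))) : State :=
  let q := p.1.2.1
  let l := p.1.2.2.1
  let r := p.1.2.2.2
  ((1 - q ⬝ᵥ q) • l + (2 * ρ (q ⬝ᵥ q)) • crossProduct q l + (l ⬝ᵥ q) • q
      - crossProduct (crossProduct q l) q,
    (1 / 2 : ℝ) • (ρ (q ⬝ᵥ q) • r + crossProduct q r),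
    V.accel l r p.2.1 p.2.2 ∘ Sum.inl,
    V.accel l r p.2.1 p.2.2 ∘ Sum.inr)

theorem rhsWith_eq_rhs {ρ : ℝ → ℝ} (hρ : ∀ s, |s| ≤ 1 / 4 → ρ s = Real.sqrt (1 - s)) {x : State}
    (hx : |x.2.1 ⬝ᵥ x.2.1| ≤ 1 / 4) (w dw : Fin m → ℝ) :
    V.rhsWith ρ (x, (w, dw)) = V.rhs x w dw := by
  simp only [rhsWith, rhs, hρ _ hx]

theorem contDiff_elim {E : Type*} [NormedAddCommGroup E] [NormedSpace ℝ E]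
    {a b : E → Fin 3 → ℝ} (ha : ContDiff ℝ ∞ a) (hb : ContDiff ℝ ∞ b) :
    ContDiff ℝ ∞ fun x => (Sum.elim (a x) (b x) : Fin 3 ⊕ Fin 3 → ℝ) :=
  contDiff_pi.2 fun i => by
    rcases i with i | i
    · exact contDiff_pi.1 ha i
    · exact contDiff_pi.1 hb i

theorem contDiff_rhsWith {ρ : ℝ → ℝ} (hρ : ContDiff ℝ ∞ ρ) : ContDiff ℝ ∞ (V.rhsWith ρ) := by
  have hq : ContDiff ℝ ∞ fun p : State × ((Fin m → ℝ) × (Fin m → ℝ)) => p.1.2.1 := by fun_prop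
  have hl : ContDiff ℝ ∞ fun p : State × ((Fin m → ℝ) × (Fin m → ℝ)) => p.1.2.2.1 := by fun_prop
  have hr : ContDiff ℝ ∞ fun p : State × ((Fin m → ℝ) × (Fin m → ℝ)) => p.1.2.2.2 := by fun_prop
  have hw : ContDiff ℝ ∞ fun p : State × ((Fin m → ℝ) × (Fin m → ℝ)) => p.2.1 := by fun_prop
  have hdw : ContDiff ℝ ∞ fun p : State × ((Fin m → ℝ) × (Fin m → ℝ)) => p.2.2 := by fun_prop
  have hqq := contDiff_dotProduct hq hq
  have hacc : ContDiff ℝ ∞ fun p : State × ((Fin m → ℝ) × (Fin m → ℝ)) =>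
      V.accel p.1.2.2.1 p.1.2.2.2 p.2.1 p.2.2 := by
    unfold accel
    have h1 := contDiff_mulVec (A := fun _ => V.matC) (fun _ _ => contDiff_const) hdw
    have h2 : ContDiff ℝ ∞ fun p : State × ((Fin m → ℝ) × (Fin m → ℝ)) =>
        V.F (Sum.elim p.1.2.2.1 p.1.2.2.2) p.2.1 :=
      ContDiff.comp (f := fun p : State × ((Fin m → ℝ) × (Fin m → ℝ)) =>
        ((Sum.elim p.1.2.2.1 p.1.2.2.2 : Fin 3 ⊕ Fin 3 → ℝ), p.2.1))
        V.contDiff_F ((contDiff_elim hl hr).prodMk hw)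
    exact contDiff_mulVec (A := fun _ => V.inertia⁻¹) (fun _ _ => contDiff_const) (h1.add h2)
  have hacc' := contDiff_pi.1 hacc
  have hρq := hρ.comp hqq
  have hfst := ((((contDiff_const (c := (1 : ℝ))).sub hqq).smul hl).add
      (((contDiff_const (c := (2 : ℝ))).mul hρq).smul (contDiff_crossProduct hq hl))).add
      ((contDiff_dotProduct hl hq).smul hq) |>.sub
      (contDiff_crossProduct (contDiff_crossProduct hq hl) hq)
  have hsnd := ((hρq.smul hr).add (contDiff_crossProduct hq hr)).const_smul (1 / 2 : ℝ)
  exact hfst.prodMk (hsnd.prodMk ((contDiff_pi.2 fun i => hacc' (Sum.inl i)).prodMk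
    (contDiff_pi.2 fun i => hacc' (Sum.inr i))))

/-- The linearization of the right-hand side at a state with `q⃗ = 0` and `r = 0`. -/
theorem fderiv_rhsWith {ρ : ℝ → ℝ} (hρ : ContDiff ℝ ∞ ρ) (hρ0 : ρ 0 = 1)
    (h l δh δq δl δr : Fin 3 → ℝ) (w dw δw δdw : Fin m → ℝ) :
    fderiv ℝ (V.rhsWith ρ) ((h, 0, l, 0), (w, dw)) ((δh, δq, δl, δr), (δw, δdw))
      = (δl + (2 : ℝ) • crossProduct δq l, (1 / 2 : ℝ) • δr,
        (V.inertia⁻¹ *ᵥ (V.matC *ᵥ δdw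
          + fderiv ℝ (fun k => V.F k w) (Sum.elim l 0) (Sum.elim δl δr)
          + fderiv ℝ (fun w' => V.F (Sum.elim l 0) w') w δw)) ∘ Sum.inl,
        (V.inertia⁻¹ *ᵥ (V.matC *ᵥ δdw
          + fderiv ℝ (fun k => V.F k w) (Sum.elim l 0) (Sum.elim δl δr)
          + fderiv ℝ (fun w' => V.F (Sum.elim l 0) w') w δw)) ∘ Sum.inr) := by
  set p : State × ((Fin m → ℝ) × (Fin m → ℝ)) := ((h, 0, l, 0), (w, dw)) with hp
  set v : State × ((Fin m → ℝ) × (Fin m → ℝ)) := ((δh, δq, δl, δr), (δw, δdw)) with hv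
  have hline : HasDerivAt (fun s : ℝ => p + s • v) v 0 := by
    simpa using ((hasDerivAt_id (0 : ℝ)).smul_const v).const_add p
  have h0 : HasFDerivAt (V.rhsWith ρ) (fderiv ℝ (V.rhsWith ρ) p) (p + (0 : ℝ) • v) := by
    simpa using ((V.contDiff_rhsWith hρ).differentiable (by simp) p).hasFDerivAt
  refine (h0.comp_hasDerivAt (0 : ℝ) hline).unique ?_
  have hq : HasDerivAt (fun s : ℝ => s • δq) δq 0 := by
    simpa using (hasDerivAt_id (0 : ℝ)).smul_const δq
  have hl : HasDerivAt (fun s : ℝ => l + s • δl) δl 0 := by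
    simpa using ((hasDerivAt_id (0 : ℝ)).smul_const δl).const_add l
  have hr : HasDerivAt (fun s : ℝ => s • δr) δr 0 := by
    simpa using (hasDerivAt_id (0 : ℝ)).smul_const δr
  have hdw : HasDerivAt (fun s : ℝ => dw + s • δdw) δdw 0 := by
    simpa using ((hasDerivAt_id (0 : ℝ)).smul_const δdw).const_add dw
  have hqq := hasDerivAt_dotProduct hq hq
  have hρq : HasDerivAt (fun s : ℝ => ρ ((s • δq) ⬝ᵥ (s • δq))) 0 0 := by
    refine ((hρ.differentiable (by simp) _).hasDerivAt.comp (0 : ℝ) hqq).congr_deriv ?_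
    simp
  have hcross := hasDerivAt_crossProduct hq hl
  have hkline : HasDerivAt (fun s : ℝ => ((Sum.elim l 0, w) : (Fin 3 ⊕ Fin 3 → ℝ) × (Fin m → ℝ))
      + s • (Sum.elim δl δr, δw)) (Sum.elim δl δr, δw) 0 := by
    simpa using ((hasDerivAt_id (0 : ℝ)).smul_const
      ((Sum.elim δl δr, δw) : (Fin 3 ⊕ Fin 3 → ℝ) × (Fin m → ℝ))).const_add (Sum.elim l 0, w)
  have hF0 : HasFDerivAt (fun p : (Fin 3 ⊕ Fin 3 → ℝ) × (Fin m → ℝ) => V.F p.1 p.2)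
      (fderiv ℝ (fun p : (Fin 3 ⊕ Fin 3 → ℝ) × (Fin m → ℝ) => V.F p.1 p.2) (Sum.elim l 0, w))
      ((Sum.elim l 0, w) + (0 : ℝ) • (Sum.elim δl δr, δw)) := by
    simpa using (V.contDiff_F.differentiable (by simp) (Sum.elim l 0, w)).hasFDerivAt
  have hF := hF0.comp_hasDerivAt (0 : ℝ) hkline
  rw [fderiv_F] at hF
  have hacc : HasDerivAt (fun s : ℝ => V.accel (l + s • δl) (s • δr) (w + s • δw) (dw + s • δdw))
      (V.inertia⁻¹ *ᵥ (V.matC *ᵥ δdw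
          + fderiv ℝ (fun k => V.F k w) (Sum.elim l 0) (Sum.elim δl δr)
          + fderiv ℝ (fun w' => V.F (Sum.elim l 0) w') w δw)) 0 := by
    have h1 := (mulVecCLM V.inertia⁻¹).hasFDerivAt.comp_hasDerivAt (0 : ℝ)
      (((mulVecCLM V.matC).hasFDerivAt.comp_hasDerivAt (0 : ℝ) hdw).add hF)
    rw [mulVecCLM_apply, mulVecCLM_apply, ← add_assoc] at h1
    refine h1.congr_of_eventuallyEq (Eventually.of_forall fun s => ?_)
    simp only [accel, Function.comp_apply, mulVecCLM_apply, Pi.add_apply]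
    congr 3
    ext i
    rcases i with i | i <;> simp
  have hacc' := hasDerivAt_pi.1 hacc
  have hmain := ((((hqq.const_sub 1).smul hl).add ((hρq.const_mul 2).smul hcross)).add
      ((hasDerivAt_dotProduct hl hq).smul hq)).sub (hasDerivAt_crossProduct hcross hq)
  have hsecond := ((hρq.smul hr).add (hasDerivAt_crossProduct hq hr)).const_smul (1 / 2 : ℝ)
  have hall := (hmain.congr_deriv (g' := δl + (2 : ℝ) • crossProduct δq l) (by simp [hρ0])).prodMk
    ((hsecond.congr_deriv (g' := (1 / 2 : ℝ) • δr) (by simp [hρ0])).prodMk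
      ((hasDerivAt_pi.2 fun i => hacc' (Sum.inl i)).prodMk
        (hasDerivAt_pi.2 fun i => hacc' (Sum.inr i))))
  refine hall.congr_of_eventuallyEq (Eventually.of_forall fun s => ?_)
  simp only [Function.comp_apply, rhsWith, hp, hv, Prod.smul_mk, Prod.mk_add_mk, zero_add]
  rfl

end Vehicle

section Loop

variable {T lam : ℝ} {ξ : ℝ → ℝ}

theorem contDiff_loopPosition (hξ : ContDiff ℝ ∞ ξ) : ContDiff ℝ ∞ (loopPosition T lam ξ) := by
  unfold loopPosition
  fun_prop

theorem contDiff_loopVelocity (hξ : ContDiff ℝ ∞ ξ) : ContDiff ℝ ∞ (loopVelocity T lam ξ) :=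
  (contDiff_infty_iff_deriv.1 (contDiff_loopPosition hξ)).2

theorem hasDerivAt_loopPosition (hξ : ContDiff ℝ ∞ ξ) (t : ℝ) :
    HasDerivAt (loopPosition T lam ξ) (loopVelocity T lam ξ t) t :=
  ((contDiff_loopPosition hξ).differentiable (by simp) t).hasDerivAt

theorem hasDerivAt_loopVelocity (hξ : ContDiff ℝ ∞ ξ) (t : ℝ) :
    HasDerivAt (loopVelocity T lam ξ) (deriv (loopVelocity T lam ξ) t) t :=
  ((contDiff_loopVelocity hξ).differentiable (by simp) t).hasDerivAt

theorem loopPosition_zero (hT : 0 < T) (hξ0 : ∀ t, t < T / 3 → ξ t = 0) :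
    loopPosition T lam ξ 0 = 0 := by
  simp [loopPosition, hξ0 0 (by linarith)]

theorem loopPosition_end : loopPosition T lam ξ T = 0 := by simp [loopPosition]

theorem loopVelocity_zero (hT : 0 < T) (hξ0 : ∀ t, t < T / 3 → ξ t = 0) :
    loopVelocity T lam ξ 0 = 0 := by
  have h : loopPosition T lam ξ =ᶠ[𝓝 0] fun _ => 0 := by
    filter_upwards [gt_mem_nhds (show (0 : ℝ) < T / 3 by linarith)] with t ht
    simp [loopPosition, hξ0 t ht]
  rw [loopVelocity, h.deriv_eq, deriv_const]

theorem loopVelocity_end (hξ : ContDiff ℝ ∞ ξ) : loopVelocity T lam ξ T = 0 := by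
  have h1 := ((hξ.differentiable (by simp) T).hasDerivAt.const_mul lam).mul
    (((hasDerivAt_id T).sub_const T).pow 2)
  have h2 : HasDerivAt (loopPosition T lam ξ) 0 T := by
    refine h1.congr_deriv ?_
    simp
  rw [loopVelocity, h2.deriv]

/-- Solutions of a scalar Riccati equation with smooth coefficients are smooth. -/
theorem contDiffOn_of_riccati (hT : 0 < T) {w a b : ℝ → ℝ} {c : ℝ}
    (ha : ContDiffOn ℝ ∞ a (Icc 0 T)) (hb : ContDiffOn ℝ ∞ b (Icc 0 T))
    (hw : ∀ t ∈ Icc 0 T, HasDerivWithinAt w (a t + b t * w t + c * w t ^ 2) (Icc 0 T) t) :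
    ContDiffOn ℝ ∞ w (Icc 0 T) := by
  have hu := uniqueDiffOn_Icc hT
  refine contDiffOn_infty.2 fun n => ?_
  induction n with
  | zero => exact contDiffOn_zero.2 fun t ht => (hw t ht).continuousWithinAt
  | succ n ih =>
    refine (contDiffOn_succ_iff_derivWithin (n := (n : WithTop ℕ∞)) hu).2
      ⟨fun t ht => (hw t ht).differentiableWithinAt, by simp, ?_⟩
    have ha' := contDiffOn_infty.1 ha n
    have hb' := contDiffOn_infty.1 hb n
    refine (ha'.add (hb'.mul ih) |>.add ((contDiffOn_const (c := c)).mul (ih.pow 2))).congr fun t ht => ?_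
    exact (hw t ht).derivWithin (hu t ht)

end Loop

namespace Vehicle

variable {m : ℕ} {V : Vehicle m} {T lam : ℝ} {ξ w₁ : ℝ → ℝ}

theorem mulVec_single_zero {ι κ : Type*} [Fintype κ] [DecidableEq κ] [DecidableEq ι]
    (A : Matrix ι κ ℝ) (i₀ : ι) (j₀ : κ) (hA : ∀ i, i ≠ i₀ → A i j₀ = 0) (a : ℝ) :
    A *ᵥ Pi.single j₀ a = Pi.single i₀ (A i₀ j₀ * a) := by
  ext i
  rw [mulVec_single]
  by_cases hi : i = i₀
  · subst hi; simp
  · simp [hi, hA i hi]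

theorem inertia_mulVec_single (h : V.IsSymmetric) (a : ℝ) :
    V.inertia *ᵥ Sum.elim (Pi.single 0 a) 0
      = Sum.elim (Pi.single 0 ((V.mass + V.matM 0 0) * a)) 0 := by
  have h1 : V.matNᵀ *ᵥ Pi.single 0 a = 0 := by
    ext i
    simp [mulVec_single, V.matN_eq_zero h i]
  have h2 := mulVec_single_zero V.matM 0 0 (fun i hi => V.matM_eq_zero h hi) a
  rw [inertia, add_mulVec, fromBlocks_mulVec, fromBlocks_mulVec]
  simp only [Sum.elim_comp_inl, Sum.elim_comp_inr, h1, h2, mulVec_zero, zero_mulVec, add_zero,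
    smul_mulVec, one_mulVec]
  ext i
  rcases i with i | i
  · by_cases hi : i = 0
    · subst hi; simp [add_mul]
    · simp [hi]
  · simp

variable [NeZero m]

theorem IsLoopControl.contDiffOn (hT : 0 < T) (hξ : ContDiff ℝ ∞ ξ)
    (h : V.IsLoopControl T lam ξ w₁) : ContDiffOn ℝ ∞ w₁ (Icc 0 T) := by
  refine contDiffOn_of_riccati hT
    (a := fun t => V.alpha⁻¹ * deriv (loopVelocity T lam ξ) t)
    (b := fun t => -(V.alpha⁻¹ * V.beta) * loopVelocity T lam ξ t)
    (c := -(V.alpha⁻¹ * V.gamma)) ?_ ?_ fun t ht => (h.2 t ht).congr_deriv (by ring)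
  · exact (contDiff_const.mul
      (contDiff_infty_iff_deriv.1 (contDiff_loopVelocity hξ)).2).contDiffOn
  · exact (contDiff_const.mul (contDiff_loopVelocity hξ)).contDiffOn

theorem matC_mulVec_single (h : V.IsSymmetric) (hχ : V.IsSymmetricFlow 0) (a : ℝ) :
    V.matC *ᵥ Pi.single 0 a = Sum.elim (Pi.single 0 (-V.matCM 0 0 * a)) 0 := by
  have h1 := mulVec_single_zero V.matCM 0 0 (fun i hi => V.matCM_eq_zero h hχ hi) a
  have h2 : V.matCJ *ᵥ Pi.single 0 a = 0 := by
    ext i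
    simp [mulVec_single, V.matCJ_eq_zero h hχ i]
  rw [matC, neg_mulVec, fromRows_mulVec, h1, h2]
  ext i
  rcases i with i | i <;> simp [Pi.single_apply]
  split_ifs <;> simp

theorem F_single (h : V.IsSymmetric) (hχ : V.IsSymmetricFlow 0) (l w : ℝ) :
    V.F (Sum.elim (Pi.single 0 l) 0) (Pi.single 0 w)
      = Sum.elim (Pi.single 0 (-(V.matLM 0 0 0 * l * w + V.matWM 0 0 0 * w ^ 2))) 0 := by
  have hL := mulVec_single_zero (V.matLM 0) 0 0 (fun i hi => V.matLM_eq_zero h hχ hi) l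
  have hW := mulVec_single_zero (V.matWM 0) 0 0 (fun i hi => V.matWM_eq_zero h hχ hi) w
  have hLJ : V.matLJ 0 *ᵥ Pi.single 0 l = 0 := by
    ext i
    simp [mulVec_single, V.matLJ_eq_zero h hχ i]
  have hWJ : V.matWJ 0 *ᵥ Pi.single 0 w = 0 := by
    ext i
    simp [mulVec_single, V.matWJ_eq_zero h hχ i]
  have hskew : ∀ c : ℝ, skew (Pi.single 0 l) *ᵥ Pi.single 0 c = 0 := fun c => by
    rw [skew_mulVec]
    ext i
    fin_cases i <;> simp [cross_apply]
  have hskew0 : skew 0 = 0 := by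
    ext i j
    fin_cases i <;> fin_cases j <;> simp [skew]
  simp only [F, Sum.elim_comp_inl, Sum.elim_comp_inr]
  rw [inertia_mulVec_single h, matC_mulVec_single h hχ, Finset.sum_eq_single 0
    (fun p _ hp => by simp [hp]) (by simp), hL, hW, hLJ, hWJ, hskew0, neg_mulVec]
  have hsub : ∀ a b : ℝ, (Sum.elim (Pi.single 0 a) 0 : Fin 3 ⊕ Fin 3 → ℝ)
      - Sum.elim (Pi.single 0 b) 0 = Sum.elim (Pi.single 0 (a - b)) 0 := fun a b => by
    ext i
    rcases i with i | i <;> simp [Pi.single_apply]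
    split_ifs <;> simp
  rw [hsub, fromBlocks_mulVec]
  simp only [Sum.elim_comp_inl, Sum.elim_comp_inr, hskew, mulVec_zero, zero_mulVec, add_zero,
    Pi.single_eq_same]
  ext i
  rcases i with i | i
  · by_cases hi : i = 0
    · subst hi
      simp
      ring
    · simp [hi]
  · simp

theorem accel_single (h : V.IsSymmetric) (hχ : V.IsSymmetricFlow 0) (hα : V.alpha ≠ 0)
    (hdet : IsUnit V.inertia.det) (l w dw : ℝ) :
    V.accel (Pi.single 0 l) 0 (Pi.single 0 w) (Pi.single 0 dw)
      = Sum.elim (Pi.single 0 (V.alpha * dw + V.beta * l * w + V.gamma * w ^ 2)) 0 := by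
  have hm : V.mass + V.matM 0 0 ≠ 0 := fun h0 => hα (by simp [alpha, h0])
  have key : V.matC *ᵥ Pi.single 0 dw + V.F (Sum.elim (Pi.single 0 l) 0) (Pi.single 0 w)
      = V.inertia *ᵥ
        Sum.elim (Pi.single 0 (V.alpha * dw + V.beta * l * w + V.gamma * w ^ 2)) 0 := by
    rw [F_single h hχ, matC_mulVec_single h hχ, inertia_mulVec_single h]
    have e : (V.mass + V.matM 0 0) * (V.alpha * dw + V.beta * l * w + V.gamma * w ^ 2)
        = -V.matCM 0 0 * dw + -(V.matLM 0 0 0 * l * w + V.matWM 0 0 0 * w ^ 2) := by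
      simp only [alpha, beta, gamma]
      field_simp
      ring
    rw [e]
    ext i
    rcases i with i | i <;> simp [Pi.single_apply]
    split_ifs <;> simp
  rw [accel, key, mulVec_mulVec, nonsing_inv_mul _ hdet, one_mulVec]

theorem hasDerivWithinAt_single {s : Set ℝ} {t : ℝ} {f : ℝ → ℝ} {f' : ℝ}
    (hf : HasDerivWithinAt f f' s t) :
    HasDerivWithinAt (fun r => (Pi.single 0 (f r) : Fin m → ℝ)) (Pi.single 0 f') s t :=
  hasDerivWithinAt_pi.2 fun i => by
    by_cases hi : i = 0
    · subst hi; simpa using hf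
    · simpa [hi] using hasDerivWithinAt_const t s (0 : ℝ)

/-- The reference trajectory. -/
noncomputable def loopState (T lam : ℝ) (ξ : ℝ → ℝ) (t : ℝ) : State :=
  (Pi.single 0 (loopPosition T lam ξ t), 0, loopL T lam ξ t, 0)

theorem hasDerivWithinAt_loopState (h : V.IsSymmetric) (hχ : V.IsSymmetricFlow 0)
    (hα : V.alpha ≠ 0) (hdet : IsUnit V.inertia.det) (hT : 0 < T) (hξ : ContDiff ℝ ∞ ξ)
    (hw : V.IsLoopControl T lam ξ w₁) {ρ : ℝ → ℝ} {t : ℝ} (ht : t ∈ Icc 0 T) :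
    HasDerivWithinAt (loopState T lam ξ)
      (V.rhsWith ρ (loopState T lam ξ t,
        (loopW w₁ t, Pi.single 0 (derivWithin w₁ (Icc 0 T) t)))) (Icc 0 T) t := by
  have hdw : derivWithin w₁ (Icc 0 T) t = _ :=
    (hw.2 t ht).derivWithin (uniqueDiffOn_Icc hT t ht)
  have hacc := accel_single h hχ hα hdet (loopVelocity T lam ξ t) (w₁ t)
    (derivWithin w₁ (Icc 0 T) t)
  have e : V.alpha * derivWithin w₁ (Icc 0 T) t + V.beta * loopVelocity T lam ξ t * w₁ t
      + V.gamma * w₁ t ^ 2 = deriv (loopVelocity T lam ξ) t := by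
    rw [hdw]
    field_simp
    ring
  rw [e] at hacc
  have hmain := (hasDerivWithinAt_single (m := 3)
      (hasDerivAt_loopPosition (T := T) (lam := lam) hξ t).hasDerivWithinAt).prodMk
    ((hasDerivWithinAt_const t (Icc 0 T) (0 : Fin 3 → ℝ)).prodMk
      ((hasDerivWithinAt_single (m := 3)
        (hasDerivAt_loopVelocity (T := T) (lam := lam) hξ t).hasDerivWithinAt).prodMk
        (hasDerivWithinAt_const t (Icc 0 T) (0 : Fin 3 → ℝ))))
  refine hmain.congr_deriv ?_
  simp only [rhsWith, loopState, loopL, loopW, hacc, Sum.elim_comp_inl, Sum.elim_comp_inr]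
  simp

theorem contDiff_loopL (hξ : ContDiff ℝ ∞ ξ) : ContDiff ℝ ∞ (loopL T lam ξ) :=
  contDiff_pi.2 fun i => by
    by_cases hi : i = 0
    · subst hi; simpa [loopL] using contDiff_loopVelocity hξ
    · simpa [loopL, hi] using contDiff_const

theorem contDiffOn_single {s : Set ℝ} {f : ℝ → ℝ} (hf : ContDiffOn ℝ ∞ f s) :
    ContDiffOn ℝ ∞ (fun t => (Pi.single 0 (f t) : Fin m → ℝ)) s :=
  contDiffOn_pi.2 fun i => by
    by_cases hi : i = 0
    · subst hi; simpa using hf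
    · simpa [hi] using contDiffOn_const

theorem linA_mulVec (t : ℝ) (v : Fin 3 ⊕ Fin 3 → ℝ) :
    V.linA T lam ξ w₁ t *ᵥ v
      = fderiv ℝ (fun k => V.F k (loopW w₁ t)) (loopK T lam ξ t) v := by
  rw [linA, LinearMap.toMatrix'_mulVec]
  rfl

theorem linB_mulVec (t : ℝ) (v : Fin m → ℝ) :
    V.linB T lam ξ w₁ t *ᵥ v
      = fderiv ℝ (fun w => V.F (loopK T lam ξ t) w) (loopW w₁ t) v := by
  rw [linB, LinearMap.toMatrix'_mulVec]
  rfl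

theorem contDiffOn_fderiv_F (hξ : ContDiff ℝ ∞ ξ) {s : Set ℝ} (hw : ContDiffOn ℝ ∞ w₁ s)
    (v : (Fin 3 ⊕ Fin 3 → ℝ) × (Fin m → ℝ)) :
    ContDiffOn ℝ ∞ (fun t => fderiv ℝ (fun p : (Fin 3 ⊕ Fin 3 → ℝ) × (Fin m → ℝ) => V.F p.1 p.2)
      (loopK T lam ξ t, loopW w₁ t) v) s := by
  have h1 : ContDiff ℝ ∞ (fderiv ℝ
      (fun p : (Fin 3 ⊕ Fin 3 → ℝ) × (Fin m → ℝ) => V.F p.1 p.2)) :=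
    V.contDiff_F.fderiv_right (by simp)
  have h2 : ContDiffOn ℝ ∞
      (fun t => ((loopK T lam ξ t, loopW w₁ t) : (Fin 3 ⊕ Fin 3 → ℝ) × (Fin m → ℝ))) s :=
    (contDiff_elim (contDiff_loopL hξ) contDiff_const).contDiffOn.prodMk (contDiffOn_single hw)
  exact (h1.comp_contDiffOn h2).clm_apply contDiffOn_const

theorem contDiffOn_linA (hξ : ContDiff ℝ ∞ ξ) {s : Set ℝ} (hw : ContDiffOn ℝ ∞ w₁ s)
    (i j : Fin 3 ⊕ Fin 3) : ContDiffOn ℝ ∞ (fun t => V.linA T lam ξ w₁ t i j) s := by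
  refine ((contDiffOn_pi.1 (contDiffOn_fderiv_F (V := V) (T := T) (lam := lam) hξ hw
    (Pi.single j 1, 0))) i).congr fun t _ => ?_
  rw [fderiv_F, ← linA_mulVec, mulVec_single_one]
  simp

theorem contDiffOn_linB (hξ : ContDiff ℝ ∞ ξ) {s : Set ℝ} (hw : ContDiffOn ℝ ∞ w₁ s)
    (i : Fin 3 ⊕ Fin 3) (j : Fin m) : ContDiffOn ℝ ∞ (fun t => V.linB T lam ξ w₁ t i j) s := by
  refine ((contDiffOn_pi.1 (contDiffOn_fderiv_F (V := V) (T := T) (lam := lam) hξ hw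
    (0, Pi.single j 1))) i).congr fun t _ => ?_
  rw [fderiv_F, ← linB_mulVec, mulVec_single_one]
  simp

theorem contDiffOn_mul_apply {ι κ μ : Type*} [Fintype κ] {s : Set ℝ} (M : Matrix ι κ ℝ)
    {A : ℝ → Matrix κ μ ℝ} (hA : ∀ i j, ContDiffOn ℝ ∞ (fun t => A t i j) s) (i : ι) (j : μ) :
    ContDiffOn ℝ ∞ (fun t => (M * A t) i j) s := by
  simp only [mul_apply]
  exact ContDiffOn.sum fun k _ => contDiffOn_const.mul (hA k j)

theorem contDiffOn_calA (hξ : ContDiff ℝ ∞ ξ) {s : Set ℝ} (hw : ContDiffOn ℝ ∞ w₁ s)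
    (i j : (Fin 3 ⊕ Fin 3) ⊕ (Fin 3 ⊕ Fin 3)) :
    ContDiffOn ℝ ∞ (fun t => V.calA T lam ξ w₁ t i j) s := by
  have hl := contDiff_pi.1 (contDiff_loopL (T := T) (lam := lam) hξ)
  rcases i with (i | i) | i <;> rcases j with (j | j) | j <;>
    simp only [calA, fromBlocks_apply₁₁, fromBlocks_apply₁₂, fromBlocks_apply₂₁,
      fromBlocks_apply₂₂] <;>
    first
    | exact contDiffOn_const
    | exact contDiffOn_mul_apply _ (contDiffOn_linA hξ hw) _ _
    | skip
  refine ContDiff.contDiffOn ?_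
  fin_cases i <;> fin_cases j <;> simp [skew] <;>
    first | exact contDiff_const | exact hl _ | exact (hl _).neg

theorem contDiffOn_calB (hξ : ContDiff ℝ ∞ ξ) {s : Set ℝ} (hw : ContDiffOn ℝ ∞ w₁ s)
    (i : (Fin 3 ⊕ Fin 3) ⊕ (Fin 3 ⊕ Fin 3)) (j : Fin m) :
    ContDiffOn ℝ ∞ (fun t => V.calB T lam ξ w₁ t i j) s := by
  rcases i with i | i
  · exact contDiffOn_const
  · exact contDiffOn_mul_apply _ (contDiffOn_linB hξ hw) _ _

theorem controlMatrix_eq_zero {n k : Type*} [Fintype n] {A : ℝ → Matrix n n ℝ} (i : ℕ) (t : ℝ) :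
    controlMatrix T A (fun _ => (0 : Matrix n k ℝ)) 0 i t = 0 := by
  induction i generalizing t with
  | zero => simp [controlMatrix]
  | succ i ih =>
    ext a b
    simp [controlMatrix, ih]

theorem isUnit_det_inertia (h : V.loopRank T lam ξ w₁ = 12) : IsUnit V.inertia.det := by
  by_contra hdet
  have hinv : V.inertia⁻¹ = 0 := nonsing_inv_apply_not_isUnit _ hdet
  have hB : V.calB T lam ξ w₁ = fun _ => 0 := by
    ext t i j
    rcases i with i | i <;> simp [calB, hinv]
  have hC : V.calC = 0 := by
    ext i j
    rcases i with i | i <;> simp [calC, hinv]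
  have hbot : Submodule.span ℝ (range V.calC.col ∪ ⋃ i : ℕ, range
      (controlMatrix T (V.calA T lam ξ w₁) (V.calB T lam ξ w₁) V.calC i T).col) = ⊥ := by
    rw [Submodule.span_eq_bot]
    rintro _ (⟨j, rfl⟩ | hx)
    · rw [hC]; rfl
    · obtain ⟨i, j, rfl⟩ := mem_iUnion.1 hx
      rw [hB, hC, controlMatrix_eq_zero]; rfl
  rw [loopRank, hbot, finrank_bot] at h
  exact absurd h (by norm_num)

theorem reachable_loop_eq_top (hT : 0 < T) (hξ : ContDiff ℝ ∞ ξ)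
    (hw : V.IsLoopControl T lam ξ w₁) (h : V.loopRank T lam ξ w₁ = 12) :
    reachable T (V.calA T lam ξ w₁) (V.calB T lam ξ w₁) V.calC = ⊤ := by
  have hs := hw.contDiffOn hT hξ
  refine reachable_eq_top hT (contDiffOn_calA hξ hs) (contDiffOn_calB hξ hs)
    (Submodule.eq_top_of_finrank_eq ?_)
  rw [Module.finrank_pi]
  exact h

end Vehicle

/-- The coordinates `((h, 2 q⃗), (l, r))` on the state space. -/
noncomputable def stateEquiv : ((Fin 3 ⊕ Fin 3) ⊕ (Fin 3 ⊕ Fin 3) → ℝ) ≃L[ℝ] State :=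
  LinearEquiv.toContinuousLinearEquiv
    { toFun := fun z => (fun i => z (Sum.inl (Sum.inl i)),
        (1 / 2 : ℝ) • fun i => z (Sum.inl (Sum.inr i)),
        fun i => z (Sum.inr (Sum.inl i)), fun i => z (Sum.inr (Sum.inr i)))
      invFun := fun x => Sum.elim (Sum.elim x.1 ((2 : ℝ) • x.2.1)) (Sum.elim x.2.2.1 x.2.2.2)
      map_add' := fun z z' => by ext i <;> simp [mul_add]
      map_smul' := fun a z => by ext i <;> simp [mul_left_comm]
      left_inv := fun z => by
        ext i
        rcases i with (i | i) | (i | i) <;> simp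
      right_inv := fun x => by
        ext i <;> simp }

theorem stateEquiv_apply (z : (Fin 3 ⊕ Fin 3) ⊕ (Fin 3 ⊕ Fin 3) → ℝ) :
    stateEquiv z = (z ∘ Sum.inl ∘ Sum.inl, (1 / 2 : ℝ) • (z ∘ Sum.inl ∘ Sum.inr),
      (z ∘ Sum.inr) ∘ Sum.inl, (z ∘ Sum.inr) ∘ Sum.inr) := rfl

namespace Vehicle

variable {m : ℕ} [NeZero m] {V : Vehicle m} {T lam : ℝ} {ξ w₁ : ℝ → ℝ}

/-- In the coordinates `stateEquiv`, the linearization of the system along the reference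
trajectory is given by the matrices `𝒜`, `ℬ`, `𝒞`. -/
theorem fderiv_rhsWith_loopState {ρ : ℝ → ℝ} (hρ : ContDiff ℝ ∞ ρ) (hρ0 : ρ 0 = 1) (t : ℝ)
    (dw u du : Fin m → ℝ) (z : (Fin 3 ⊕ Fin 3) ⊕ (Fin 3 ⊕ Fin 3) → ℝ) :
    fderiv ℝ (V.rhsWith ρ) (loopState T lam ξ t, (loopW w₁ t, dw)) (stateEquiv z, (u, du))
      = stateEquiv (V.calA T lam ξ w₁ t *ᵥ z + V.calB T lam ξ w₁ t *ᵥ u + V.calC *ᵥ du) := by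
  rw [stateEquiv_apply, loopState, fderiv_rhsWith V hρ hρ0, Sum.elim_comp_inl_inr]
  have hK : (Sum.elim (loopL T lam ξ t) 0 : Fin 3 ⊕ Fin 3 → ℝ) = loopK T lam ξ t := rfl
  rw [hK, ← linA_mulVec, ← linB_mulVec]
  set y := V.inertia⁻¹ *ᵥ (V.matC *ᵥ du + V.linA T lam ξ w₁ t *ᵥ (z ∘ Sum.inr)
    + V.linB T lam ξ w₁ t *ᵥ u) with hy
  have hsum : V.calA T lam ξ w₁ t *ᵥ z + V.calB T lam ξ w₁ t *ᵥ u + V.calC *ᵥ du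
      = Sum.elim (Sum.elim ((z ∘ Sum.inr) ∘ Sum.inl
          + (2 : ℝ) • crossProduct ((1 / 2 : ℝ) • (z ∘ Sum.inl ∘ Sum.inr)) (loopL T lam ξ t))
        ((z ∘ Sum.inr) ∘ Sum.inr)) y := by
    rw [calA, calB, calC, fromBlocks_mulVec, fromBlocks_mulVec, fromRows_mulVec, fromRows_mulVec,
      neg_mulVec, skew_mulVec, ← cross_anticomm, neg_neg, LinearMap.map_smul₂, smul_smul]
    ext i
    rcases i with (i | i) | i
    · simp [Function.comp_assoc, add_comm]
    · simp
    · simp only [hy, mulVec_add, mulVec_mulVec, Pi.add_apply, Sum.elim_inr, zero_mulVec,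
        zero_add]
      ring
  rw [hsum, stateEquiv_apply]
  rfl

end Vehicle

/-- A finite family of smooth control variations `u` with responses `y` reaching a basis. -/
theorem exists_controls_of_reachable_eq_top {n k : Type*} [Fintype n] [DecidableEq n] [Fintype k]
    {T : ℝ} {A : ℝ → Matrix n n ℝ} {B : ℝ → Matrix n k ℝ} {C : Matrix n k ℝ}
    (h : reachable T A B C = ⊤) :
    ∃ (u : n → ℝ → k → ℝ) (y : n → ℝ → n → ℝ),
      ∀ i, u i ∈ admissibleControls k ∧ IsResponse T A B C (u i) (y i) ∧ y i T = Pi.single i 1 := by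
  have : ∀ i : n, ∃ u ∈ admissibleControls k, ∃ y, IsResponse T A B C u y
      ∧ y T = Pi.single i 1 := fun i => by
    have : (Pi.single i 1 : n → ℝ) ∈ reachable T A B C := h ▸ Submodule.mem_top
    exact this
  choose u hu y hy hyT using this
  exact ⟨u, y, fun i => ⟨hu i, hy i, hyT i⟩⟩

theorem IsResponse.sum_smul {n k ι : Type*} [Fintype n] [Fintype k] [Fintype ι]
    {T : ℝ} {A : ℝ → Matrix n n ℝ} {B : ℝ → Matrix n k ℝ} {C : Matrix n k ℝ}
    {u : ι → ℝ → k → ℝ} {y : ι → ℝ → n → ℝ} (h : ∀ i, IsResponse T A B C (u i) (y i)) (z : ι → ℝ) :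
    (∑ i, z i • y i) 0 = 0 ∧ ∀ t ∈ Icc 0 T, HasDerivWithinAt (∑ i, z i • y i)
      (A t *ᵥ (∑ i, z i • y i) t + B t *ᵥ (∑ i, z i • u i t) + C *ᵥ ∑ i, z i • deriv (u i) t)
      (Icc 0 T) t := by
  refine ⟨?_, fun t ht => ?_⟩
  · simp only [Finset.sum_apply, Pi.smul_apply, (h _).1, smul_zero, Finset.sum_const_zero]
  · refine (HasDerivWithinAt.sum fun i _ => ((h i).2 t ht).const_smul (z i)).congr_deriv ?_
    simp only [Finset.sum_apply, Pi.smul_apply, smul_add, Finset.sum_add_distrib, mulVec_sum,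
      mulVec_smul]

section Sobolev

variable {m : ℕ} {T : ℝ}

theorem memLp_of_continuousOn {E : Type*} [NormedAddCommGroup E] [SecondCountableTopology E]
    [MeasurableSpace E] [BorelSpace E] {w : ℝ → E}
    (hw : ContinuousOn w (Icc 0 T)) : MemLp w 2 (timeMeasure T) := by
  obtain ⟨c, hc⟩ := isCompact_Icc.exists_bound_of_continuousOn hw
  have : IsFiniteMeasure (timeMeasure T) := by
    unfold timeMeasure; infer_instance
  refine MemLp.of_bound ((hw.mono Ioo_subset_Icc_self).aestronglyMeasurable measurableSet_Ioo) c ?_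
  filter_upwards [ae_restrict_mem measurableSet_Ioo] with t ht using hc t (Ioo_subset_Icc_self ht)

theorem isWeakDeriv_of_hasDerivWithinAt (hT : 0 < T) {w w' : ℝ → EuclideanSpace ℝ (Fin m)}
    (hw : ∀ t ∈ Icc 0 T, HasDerivWithinAt w (w' t) (Icc 0 T) t)
    (hw' : ContinuousOn w' (Icc 0 T)) : IsWeakDeriv T w w' := by
  intro f hf hc hs
  have hf0 : ∀ t, t ∉ Ioo 0 T → f t = 0 := fun t ht =>
    image_eq_zero_of_notMem_tsupport fun h => ht (hs h)
  have hwc : ContinuousOn w (Icc 0 T) := fun t ht => (hw t ht).continuousWithinAt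
  have hd : Continuous (deriv f) := hf.continuous_deriv (by simp)
  have h1 : ContinuousOn (fun t => deriv f t • w t) (Icc 0 T) := hd.continuousOn.smul hwc
  have h2 : ContinuousOn (fun t => f t • w' t) (Icc 0 T) := hf.continuous.continuousOn.smul hw'
  have key := intervalIntegral.integral_eq_sub_of_hasDerivAt_of_le hT.le
    (f := fun t => f t • w t) (f' := fun t => f t • w' t + deriv f t • w t)
    (hf.continuous.continuousOn.smul hwc)
    (fun t ht => ((hf.differentiable (by simp) t).hasDerivAt).smul
      ((hw t (Ioo_subset_Icc_self ht)).hasDerivAt (Icc_mem_nhds ht.1 ht.2)))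
    (ContinuousOn.intervalIntegrable (by rw [uIcc_of_le hT.le]; exact h2.add h1))
  rw [hf0 0 (by simp), hf0 T (by simp), zero_smul, zero_smul, sub_zero,
    intervalIntegral.integral_of_le hT.le, integral_Ioc_eq_integral_Ioo] at key
  have i1 : IntegrableOn (fun t => deriv f t • w t) (Ioo 0 T) :=
    h1.integrableOn_Icc.mono_set Ioo_subset_Icc_self
  have i2 : IntegrableOn (fun t => f t • w' t) (Ioo 0 T) :=
    h2.integrableOn_Icc.mono_set Ioo_subset_Icc_self
  rw [integral_add i2 i1, add_comm] at key
  exact eq_neg_of_add_eq_zero_left key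

theorem IsWeakDeriv.congr_ae {u v u' v' : ℝ → EuclideanSpace ℝ (Fin m)} (h : IsWeakDeriv T u v)
    (hu : u' =ᵐ[timeMeasure T] u) (hv : v' =ᵐ[timeMeasure T] v) : IsWeakDeriv T u' v' := by
  intro f hf hc hs
  have e1 : ∫ t, deriv f t • u' t ∂(timeMeasure T) = ∫ t, deriv f t • u t ∂(timeMeasure T) :=
    integral_congr_ae (by filter_upwards [hu] with t ht; rw [ht])
  have e2 : ∫ t, f t • v' t ∂(timeMeasure T) = ∫ t, f t • v t ∂(timeMeasure T) :=
    integral_congr_ae (by filter_upwards [hv] with t ht; rw [ht])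
  rw [e1, e2, h f hf hc hs]

/-- A function of class `C²` on `[0, T]` defines an element of `H²(0, T)`. -/
theorem exists_H2_of_contDiffOn (hT : 0 < T) {w : ℝ → EuclideanSpace ℝ (Fin m)}
    (hw : ContDiffOn ℝ 2 w (Icc 0 T)) : ∃ u : H2 T m, w =ᵐ[timeMeasure T] u.1 0 := by
  have hu := uniqueDiffOn_Icc hT
  set w' := derivWithin w (Icc 0 T) with hw'def
  set w'' := derivWithin w' (Icc 0 T) with hw''def
  have hw' : ContDiffOn ℝ 1 w' (Icc 0 T) := hw.derivWithin hu (by norm_num)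
  have hw'' : ContinuousOn w'' (Icc 0 T) := hw'.continuousOn_derivWithin hu le_rfl
  have hd : ∀ t ∈ Icc 0 T, HasDerivWithinAt w (w' t) (Icc 0 T) t := fun t ht =>
    (hw.differentiableOn (by simp) t ht).hasDerivWithinAt
  have hd' : ∀ t ∈ Icc 0 T, HasDerivWithinAt w' (w'' t) (Icc 0 T) t := fun t ht =>
    (hw'.differentiableOn (by simp) t ht).hasDerivWithinAt
  have m0 := memLp_of_continuousOn (T := T) hw.continuousOn
  have m1 := memLp_of_continuousOn (T := T) hw'.continuousOn
  have m2 := memLp_of_continuousOn (T := T) hw''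
  refine ⟨⟨WithLp.toLp 2 ![m0.toLp w, m1.toLp w', m2.toLp w''], ?_, ?_⟩, m0.coeFn_toLp.symm⟩
  · exact (isWeakDeriv_of_hasDerivWithinAt hT hd hw'.continuousOn).congr_ae
      m0.coeFn_toLp m1.coeFn_toLp
  · exact (isWeakDeriv_of_hasDerivWithinAt hT hd' hw'').congr_ae m1.coeFn_toLp m2.coeFn_toLp

end Sobolev

namespace Vehicle

variable {m : ℕ} [NeZero m] {V : Vehicle m} {T lam : ℝ} {ξ w₁ : ℝ → ℝ}

/-- Steering near the reference trajectory by means of controls in a finite-dimensional affine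
space of smooth functions. -/
theorem exists_steering_family (h : V.IsSymmetric) (hχ : V.IsSymmetricFlow 0)
    (hα : V.alpha ≠ 0) (hT : 0 < T) (hξ : ContDiff ℝ ∞ ξ) (hξ0 : ∀ t, t < T / 3 → ξ t = 0)
    (hw : V.IsLoopControl T lam ξ w₁) (hrank : V.loopRank T lam ξ w₁ = 12) :
    ∃ (u : (Fin 3 ⊕ Fin 3) ⊕ (Fin 3 ⊕ Fin 3) → ℝ → Fin m → ℝ)
      (z : State × State → (Fin 3 ⊕ Fin 3) ⊕ (Fin 3 ⊕ Fin 3) → ℝ)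
      (X : State × State → ℝ → State),
      (∀ i, u i ∈ admissibleControls (Fin m)) ∧ ContDiffAt ℝ 1 z 0 ∧
      ∀ᶠ p in 𝓝 (0 : State × State), X p 0 = p.1 ∧ X p T = p.2 ∧ ∀ t ∈ Icc 0 T,
        (X p t).2.1 ⬝ᵥ (X p t).2.1 < 1 ∧
        HasDerivWithinAt (X p) (V.rhs (X p t) (loopW w₁ t + ∑ i, z p i • u i t)
          (Pi.single 0 (derivWithin w₁ (Icc 0 T) t) + ∑ i, z p i • deriv (u i) t)) (Icc 0 T) t := by
  obtain ⟨ρ, hρ, hρeq⟩ := exists_smooth_sqrt_one_sub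
  have hρ0 : ρ 0 = 1 := by rw [hρeq 0 (by norm_num)]; simp
  have hdet := isUnit_det_inertia hrank
  have hs := hw.contDiffOn hT hξ
  obtain ⟨u, y, huy⟩ := exists_controls_of_reachable_eq_top (reachable_loop_eq_top hT hξ hw hrank)
  have hu : ∀ i, ContDiff ℝ ∞ (u i) := fun i => (huy i).1.1
  let b : ℝ → State →L[ℝ] (Fin m → ℝ) × (Fin m → ℝ) := fun t =>
    ∑ i, ((ContinuousLinearMap.proj i).comp
      (stateEquiv.symm : State →L[ℝ] ((Fin 3 ⊕ Fin 3) ⊕ (Fin 3 ⊕ Fin 3) → ℝ))).smulRight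
        (u i t, deriv (u i) t)
  have hbapply : ∀ t c, b t c
      = (∑ i, stateEquiv.symm c i • u i t, ∑ i, stateEquiv.symm c i • deriv (u i) t) := by
    intro t c
    simp [b, Prod.ext_iff, Prod.fst_sum, Prod.snd_sum]
  have hb : ContinuousOn b (Icc 0 T) := by
    refine continuousOn_finsetSum _ fun i _ => Continuous.continuousOn ?_
    exact (ContinuousLinearMap.smulRightL ℝ State ((Fin m → ℝ) × (Fin m → ℝ)) _).continuous.comp
      ((hu i).continuous.prodMk ((hu i).continuous_deriv (by simp)))
  have hq : ContinuousOn (fun t => (((loopW w₁ t : Fin m → ℝ),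
      (Pi.single 0 (derivWithin w₁ (Icc 0 T) t) : Fin m → ℝ)))) (Icc 0 T) :=
    (contDiffOn_single hs).continuousOn.prodMk
      (contDiffOn_single (hs.derivWithin (m := ∞) (uniqueDiffOn_Icc hT) (by simp))).continuousOn
  obtain ⟨c, X, hc, hX⟩ := exists_steering_of_linearized hT.le
    ((V.contDiff_rhsWith hρ).of_le (by simp)) hq hb
    (fun t ht => hasDerivWithinAt_loopState h hχ hα hdet hT hξ hw ht) fun d => by
      obtain ⟨h0, hd⟩ := IsResponse.sum_smul (fun i => (huy i).2.1) (stateEquiv.symm d)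
      refine ⟨fun t => stateEquiv ((∑ i, stateEquiv.symm d i • y i) t), by simp [h0], ?_, ?_⟩
      · have : (∑ i, stateEquiv.symm d i • y i) T = stateEquiv.symm d := by
          simp only [Finset.sum_apply, Pi.smul_apply, (huy _).2.2]
          exact (pi_eq_sum_univ' _).symm
        simp only [this, stateEquiv.apply_symm_apply]
      · intro t ht
        rw [hbapply, fderiv_rhsWith_loopState hρ hρ0]
        exact stateEquiv.toContinuousLinearMap.hasFDerivAt.comp_hasDerivWithinAt t (hd t ht)
  have hends : (loopState T lam ξ 0, loopState T lam ξ T) = 0 := by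
    simp [loopState, loopL, loopPosition_zero hT hξ0, loopPosition_end, loopVelocity_zero hT hξ0,
      loopVelocity_end hξ]
  rw [hends] at hc hX
  refine ⟨u, fun p => stateEquiv.symm (c p), X, fun i => (huy i).1,
    stateEquiv.symm.contDiff.contDiffAt.comp 0 hc, ?_⟩
  filter_upwards [hX (1 / 4) (by norm_num)] with p hp
  refine ⟨hp.1, hp.2.1, fun t ht => ?_⟩
  obtain ⟨hnear, hder⟩ := hp.2.2 t ht
  have hqi : ∀ i, |(X p t).2.1 i| ≤ 1 / 4 := fun i => by
    have h1 : ‖(X p t - loopState T lam ξ t).2.1 i‖ ≤ ‖X p t - loopState T lam ξ t‖ :=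
      (norm_le_pi_norm _ i).trans ((norm_fst_le _).trans (norm_snd_le _))
    have h2 : (X p t - loopState T lam ξ t).2.1 i = (X p t).2.1 i := by
      simp [loopState]
    rw [h2, Real.norm_eq_abs] at h1
    exact h1.trans hnear.le
  have hqq : |(X p t).2.1 ⬝ᵥ (X p t).2.1| ≤ 1 / 4 := by
    have h1 : ∀ i, (X p t).2.1 i * (X p t).2.1 i ≤ 1 / 16 := fun i => by
      have := abs_le.1 (hqi i)
      nlinarith
    have h2 : ∀ i, 0 ≤ (X p t).2.1 i * (X p t).2.1 i := fun i => mul_self_nonneg _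
    rw [dotProduct, Fin.sum_univ_three, abs_of_nonneg (by linarith [h2 0, h2 1, h2 2])]
    linarith [h1 0, h1 1, h1 2]
  refine ⟨by linarith [abs_le.1 hqq], ?_⟩
  rw [hbapply, Prod.mk_add_mk, rhsWith_eq_rhs V hρeq hqq] at hder
  exact hder

end Vehicle

theorem H2.ae_eq_add {m : ℕ} {T : ℝ} {u u' : H2 T m} {w w' : ℝ → EuclideanSpace ℝ (Fin m)}
    (h : w =ᵐ[timeMeasure T] u.1 0) (h' : w' =ᵐ[timeMeasure T] u'.1 0) :
    (fun t => w t + w' t) =ᵐ[timeMeasure T] (u + u').1 0 :=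
  (h.add h').trans (Lp.coeFn_add _ _).symm

theorem H2.ae_eq_smul {m : ℕ} {T : ℝ} (a : ℝ) {u : H2 T m} {w : ℝ → EuclideanSpace ℝ (Fin m)}
    (h : w =ᵐ[timeMeasure T] u.1 0) : (fun t => a • w t) =ᵐ[timeMeasure T] (a • u).1 0 :=
  (h.const_smul a).trans (Lp.coeFn_smul _ _).symm

theorem H2.ae_eq_sum {ι : Type*} {m : ℕ} {T : ℝ} (s : Finset ι) {u : ι → H2 T m}
    {w : ι → ℝ → EuclideanSpace ℝ (Fin m)} (h : ∀ i, w i =ᵐ[timeMeasure T] (u i).1 0) :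
    (fun t => ∑ i ∈ s, w i t) =ᵐ[timeMeasure T] (∑ i ∈ s, u i).1 0 := by
  classical
  induction s using Finset.induction_on with
  | empty =>
    simp only [Finset.sum_empty]
    exact (Lp.coeFn_zero (EuclideanSpace ℝ (Fin m)) 2 (timeMeasure T)).symm
  | insert i s hi ih =>
    simp only [Finset.sum_insert hi]
    exact H2.ae_eq_add (h i) ih

theorem Vehicle.locallyControllable_of_steering {m : ℕ} {V : Vehicle m} {T η : ℝ} (hη : 0 < η)
    {W : State × State → H2 T m} (h : ∀ x ∈ Metric.ball (0 : State × State) η,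
      ∃ w : ℝ → EuclideanSpace ℝ (Fin m),
        IsC1Representative (W x) w ∧ w 0 = 0 ∧ V.Steers T w x.1 x.2) :
    V.LocallyControllable T := by
  refine ⟨η, hη, fun x₀ h₀ x₁ h₁ => ?_⟩
  obtain ⟨w, hw⟩ := h (x₀, x₁) (by
    rw [← Prod.mk_zero_zero, ← ball_prod_same]
    exact ⟨h₀, h₁⟩)
  exact ⟨W (x₀, x₁), w, hw⟩

theorem theorem1 {m : ℕ} [NeZero m] (V : Vehicle m)
    (hbody : ∀ p : Fin 3, p = 1 ∨ p = 2 → planeReflection p '' V.exterior = V.exterior)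
    (hflow : ∀ p : Fin 3, p = 1 ∨ p = 2 → ∀ y ∈ frontier V.exterior,
      V.flow 0 (planeReflection p y) = V.flow 0 y)
    (hα : V.alpha ≠ 0)
    (T : ℝ) (hT : 0 < T)
    (ξ : ℝ → ℝ) (hξ : ContDiff ℝ ∞ ξ) (hξ01 : ∀ t, ξ t ∈ Set.Icc (0 : ℝ) 1)
    (hξ0 : ∀ t, t < T / 3 → ξ t = 0) (hξ1 : ∀ t, 2 * T / 3 < t → ξ t = 1)
    (lam : ℝ) (hlam : lam ≠ 0)
    (w₁ : ℝ → ℝ) (hw₁ : V.IsLoopControl T lam ξ w₁)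
    (hrank : V.loopRank T lam ξ w₁ = 12) :
    V.LocallyControllable T ∧
    ∃ η > 0, ∃ W : State × State → H2 T m,
      ContDiffOn ℝ 1 W (Metric.ball 0 η) ∧
      ∀ x ∈ Metric.ball (0 : State × State) η,
        ∃ w : ℝ → EuclideanSpace ℝ (Fin m),
          IsC1Representative (W x) w ∧ w 0 = 0 ∧ V.Steers T w x.1 x.2 := by
  suffices hW : ∃ η > 0, ∃ W : State × State → H2 T m,
      ContDiffOn ℝ 1 W (Metric.ball 0 η) ∧
      ∀ x ∈ Metric.ball (0 : State × State) η,
        ∃ w : ℝ → EuclideanSpace ℝ (Fin m),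
          IsC1Representative (W x) w ∧ w 0 = 0 ∧ V.Steers T w x.1 x.2 by
    obtain ⟨η, hη, W, hC, h⟩ := hW
    exact ⟨Vehicle.locallyControllable_of_steering hη h, η, hη, W, hC, h⟩
  obtain ⟨u, z, X, hu, hz, hX⟩ :=
    Vehicle.exists_steering_family hbody hflow hα hT hξ hξ0 hw₁ hrank
  have hs := hw₁.contDiffOn hT hξ
  let L := (PiLp.continuousLinearEquiv 2 ℝ (fun _ : Fin m => ℝ)).symm
  have hL0 : ContDiffOn ℝ ∞ (fun t => L (Vehicle.loopW w₁ t)) (Icc 0 T) :=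
    L.contDiff.comp_contDiffOn (Vehicle.contDiffOn_single hs)
  have hLu : ∀ i, ContDiff ℝ ∞ fun t => L (u i t) := fun i => L.contDiff.comp (hu i).1
  have h2 : (2 : WithTop ℕ∞) ≤ ∞ := WithTop.coe_le_coe.2 le_top
  obtain ⟨e₀, he₀⟩ := exists_H2_of_contDiffOn hT (hL0.of_le h2)
  choose e he using fun i => exists_H2_of_contDiffOn hT
    (((hLu i).of_le h2).contDiffOn (s := Icc 0 T))
  let W : State × State → H2 T m := fun p => e₀ + ∑ i, z p i • e i
  have hWz : ContDiffAt ℝ 1 W 0 := contDiffAt_const.add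
    (ContDiffAt.sum fun i _ => (contDiffAt_pi.1 hz i).smul contDiffAt_const)
  obtain ⟨s, hs0, hWs⟩ := hWz.contDiffOn le_rfl (by simp)
  obtain ⟨η, hη, hball⟩ := Metric.mem_nhds_iff.1 (inter_mem hs0 hX)
  refine ⟨η, hη, W, hWs.mono fun p hp => (hball hp).1, fun p hp => ?_⟩
  obtain ⟨hX0, hXT, hXd⟩ := (hball hp).2
  have hder : ∀ t ∈ Icc 0 T, HasDerivWithinAt (fun t => L (Vehicle.loopW w₁ t) + ∑ i, z p i • L (u i t))
      (L (Pi.single 0 (derivWithin w₁ (Icc 0 T) t) + ∑ i, z p i • deriv (u i) t))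
      (Icc 0 T) t := by
    intro t ht
    have h1 : HasDerivWithinAt (fun t => (Vehicle.loopW w₁ t : Fin m → ℝ))
        (Pi.single 0 (derivWithin w₁ (Icc 0 T) t)) (Icc 0 T) t :=
      Vehicle.hasDerivWithinAt_single ((hs.differentiableOn (by simp) t ht).hasDerivWithinAt)
    have h2 : ∀ i, HasDerivWithinAt (u i) (deriv (u i) t) (Icc 0 T) t := fun i =>
      ((hu i).1.differentiable (by simp) t).hasDerivAt.hasDerivWithinAt
    have h3 := L.toContinuousLinearMap.hasFDerivAt.comp_hasDerivWithinAt t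
      (h1.add (HasDerivWithinAt.fun_sum (u := Finset.univ) fun i _ => (h2 i).const_smul (z p i)))
    refine h3.congr_of_mem (fun r _ => ?_) ht
    simp
  refine ⟨fun t => L (Vehicle.loopW w₁ t) + ∑ i, z p i • L (u i t), ⟨?_, ?_⟩, ?_, X p, ?_, hX0, hXT⟩
  · exact (hL0.of_le (by simp)).add
      (ContDiffOn.sum fun i _ => (((hLu i).of_le (one_le_two.trans h2)).const_smul (z p i)).contDiffOn)
  · exact H2.ae_eq_add he₀ (H2.ae_eq_sum _ fun i => H2.ae_eq_smul _ (he i))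
  · simp [(hu _).2, Vehicle.loopW, hw₁.1]
  · intro t ht
    refine ⟨(hXd t ht).1, ?_⟩
    rw [(hder t ht).derivWithin (uniqueDiffOn_Icc hT t ht)]
    have e1 : L (Vehicle.loopW w₁ t) + ∑ i, z p i • L (u i t) = L (Vehicle.loopW w₁ t + ∑ i, z p i • u i t) := by
      simp
    simp only [e1]
    exact (hXd t ht).2
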